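/- Conventions. Manifolds are smooth, finite-dimensional, Hausdorff, second countable and without boundary. For a manifold $M$ let $\mathbb{T}M=TM\oplus T^*M$, with the pairing $\langle u+\xi,v+\eta\rangle=\eta(u)+\xi(v)$ and the Dorfman bracket $[u+\xi,v+\eta]=[u,v]+\mathscr{L}_u\eta-\iota_v\mathrm{d}\xi$. A Lagrangian family $L$ on $M$ is a choice of a subspace $L_x=L_x^{\perp}\subset\mathbb{T}_xM$ for every $x\in M$; it is involutive if its smooth sections are closed under the Dorfman bracket, and it is a Dirac structure if it is involutive and a smooth vector subbundle of $\mathbb{T}M$. Write $K(L)=L\cap TM$. Two Dirac structures $L,R$ on $M$ concur weakly if the Lagrangian family $$L\circledast R=\{u_L+u_R+\xi \mid u_L+\xi\in L,\ u_R+\xi\in R\}$$ is involutive. For a smooth map $\phi:M\to P$, a Dirac structure $L_M$ on $M$ pushes forward under $\phi$ to the Dirac structure $L_P=\phi_!(L_M)$ on $P$ if for all $x\in M$ and $u_P+\xi_P\in L_{P,\phi(x)}$ there is $u_M+\xi_M\in L_{M,x}$ with $\phi_*u_M=u_P$ and $\xi_M=\phi^*\xi_P$. A Dirac structure is Poisson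 if it is the graph $\{\pi(\xi)+\xi \mid \xi\in T^*M\}$ of a Poisson bivector field $\pi$; two Poisson bivector fields commute if their sum is again Poisson. Corollary. Let $L_M$ and $R_M$ be weakly concurring Dirac structures on $M$, put $K=K(L_M)+K(R_M)$, and let $$p_L:M\to M_L,\qquad p_R:M\to M_R,\qquad q_R:M_L\to M_{LR},\qquad q_L:M_R\to M_{LR},\qquad r:M\to M_{LR}$$ be surjective submersions with connected fibres such that $q_R\circ p_L=r=q_L\circ p_R$ and $$\ker (p_L)_*=K(L_M),\qquad \ker (p_R)_*=K(R_M),\qquad \ker (q_R)_*=K/K(L_M),\qquad \ker (q_L)_*=K/K(R_M),$$ where the last two equalities mean that, for every $x\in M$, the kernel of $(q_R)_*$ at $p_L(x)$ is $(p_L)_*(K_x)$ and the kernel of $(q_L)_*$ at $p_R(x)$ is $(p_R)_*(K_x)$. Then $L_M$ and $R_M$ push forward under each of $p_L$, $p_R$ and $r$ to Dirac structures on $M_L$, $M_R$ and $M_{LR}$, respectively, and at each of these three vertices the two resulting Dirac structures concur weakly. The structures on $M_{LR}$ are also the push-forwards under $q_R$ of those on $M_L$, and under $q_L$ of those on $M_R$.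 Moreover, ${p_L}_!(L_M)$, ${p_R}_!(R_M)$, $r_!(L_M)$ and $r_!(R_M)$ are Poisson, and the Poisson bivector fields of $r_!(L_M)$ and $r_!(R_M)$ commute. -/

import Mathlib

open scoped Manifold ContDiff

noncomputable section

namespace DiracGeometry

section

variable {E : Type*} [NormedAddCommGroup E] [NormedSpace ℝ E]
  {M : Type*} [TopologicalSpace M] [ChartedSpace E M]

/-! ### One-forms and vector fields -/

variable (E M) in
/-- (Set-theoretic) vector fields on `M`. -/
abbrev VField : Type _ := ∀ x : M, TangentSpace 𝓘(ℝ, E) x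

variable (E M) in
/-- (Set-theoretic) one-forms on `M`. -/
abbrev OneForm : Type _ := ∀ x : M, TangentSpace 𝓘(ℝ, E) x →L[ℝ] ℝ

/-- The vector field `u` is smooth on the set `U`, as a section of the tangent bundle. -/
def SmoothVFieldOn [IsManifold 𝓘(ℝ, E) ∞ M] (u : VField E M) (U : Set M) : Prop :=
  ContMDiffOn 𝓘(ℝ, E) (𝓘(ℝ, E).prod 𝓘(ℝ, E)) ∞
    (fun x ↦ Bundle.TotalSpace.mk' E (E := fun x : M ↦ TangentSpace 𝓘(ℝ, E) x) x (u x)) U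

/-- The one-form `ξ` is smooth on the set `U`, as a section of the cotangent bundle. -/
def SmoothOneFormOn [IsManifold 𝓘(ℝ, E) ∞ M] (ξ : OneForm E M) (U : Set M) : Prop :=
  ContMDiffOn 𝓘(ℝ, E) (𝓘(ℝ, E).prod 𝓘(ℝ, E →L[ℝ] ℝ)) ∞
    (fun x ↦ Bundle.TotalSpace.mk' (E →L[ℝ] ℝ)
      (E := fun x : M ↦ TangentSpace 𝓘(ℝ, E) x →L[ℝ] ℝ) x (ξ x)) U

/-- The one-form `ξ` read in the preferred chart at `x`, i.e. its pullback to the model space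
under the inverse of that chart (`NormedSpace.fromTangentSpace y` is the canonical isomorphism from
the tangent space of the vector space `E` at `y` to `E`). -/
def OneForm.inChart (ξ : OneForm E M) (x : M) (y : E) : E →L[ℝ] ℝ :=
  (ξ ((extChartAt 𝓘(ℝ, E) x).symm y)).comp
    ((mfderiv 𝓘(ℝ, E) 𝓘(ℝ, E) (extChartAt 𝓘(ℝ, E) x).symm y).comp
      (NormedSpace.fromTangentSpace (𝕜 := ℝ) y).symm.toContinuousLinearMap)

/-- The contraction `ι_v dξ` at `x`: in the chart at `x`,
`dξ (v, w) = (D_v ξ) w - (D_w ξ) v`. -/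
def contractD (ξ : OneForm E M) (x : M) (v : TangentSpace 𝓘(ℝ, E) x) :
    TangentSpace 𝓘(ℝ, E) x →L[ℝ] ℝ :=
  let D : E →L[ℝ] E →L[ℝ] ℝ := fderiv ℝ (ξ.inChart x) (extChartAt 𝓘(ℝ, E) x x)
  let T : TangentSpace 𝓘(ℝ, E) x →L[ℝ] E := mvfderiv 𝓘(ℝ, E) (extChartAt 𝓘(ℝ, E) x) x
  (D (T v) - D.flip (T v)).comp T

/-- The Lie derivative of a one-form along a vector field, by Cartan's formula
`𝓛_u η = d (η u) + ι_u dη`. -/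
def lieDerivative (u : VField E M) (η : OneForm E M) : OneForm E M := fun x ↦
  mvfderiv 𝓘(ℝ, E) (fun y ↦ η y (u y)) x + contractD η x (u x)

/-! ### The generalized tangent bundle -/

/-- The fibre `T_x M ⊕ T_x^* M` of the generalized tangent bundle. -/
abbrev GenTangent (E : Type*) [NormedAddCommGroup E] [NormedSpace ℝ E]
    {M : Type*} [TopologicalSpace M] [ChartedSpace E M] (x : M) : Type _ :=
  TangentSpace 𝓘(ℝ, E) x × (TangentSpace 𝓘(ℝ, E) x →L[ℝ] ℝ)

/-- The canonical symmetric pairing `⟨u + ξ, v + η⟩ = η u + ξ v`. -/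
def pairing {x : M} (a b : GenTangent E x) : ℝ := b.2 a.1 + a.2 b.1

variable (E M) in
/-- (Set-theoretic) sections of the generalized tangent bundle. -/
abbrev GenSection : Type _ := ∀ x : M, GenTangent E x

/-- Smoothness of a section of the generalized tangent bundle on a set. -/
def SmoothGenSectionOn [IsManifold 𝓘(ℝ, E) ∞ M] (a : GenSection E M) (U : Set M) :
    Prop :=
  SmoothVFieldOn (fun x ↦ (a x).1) U ∧ SmoothOneFormOn (fun x ↦ (a x).2) U

/-- The Dorfman bracket `[u + ξ, v + η] = [u, v] + 𝓛_u η - ι_v dξ`. -/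
def dorfman (a b : GenSection E M) : GenSection E M := fun x ↦
  (VectorField.mlieBracket 𝓘(ℝ, E) (fun y ↦ (a y).1) (fun y ↦ (b y).1) x,
    lieDerivative (fun y ↦ (a y).1) (fun y ↦ (b y).2) x
      - contractD (fun y ↦ (a y).2) x (b x).1)

variable (E M) in
/-- Families of linear subspaces of the fibres of the generalized tangent bundle. -/
abbrev Family : Type _ := ∀ x : M, Submodule ℝ (GenTangent E x)

/-- Each `L x` is Lagrangian, i.e. equal to its own orthogonal for the pairing. -/
def IsLagrangian (L : Family E M) : Prop :=
  ∀ (x : M) (a : GenTangent E x), a ∈ L x ↔ ∀ b ∈ L x, pairing a b = 0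

/-- `L` is a smooth vector subbundle: it has a smooth frame near every point. -/
def IsSubbundle [IsManifold 𝓘(ℝ, E) ∞ M] (L : Family E M) : Prop :=
  ∀ x₀ : M, ∃ (U : Set M) (k : ℕ) (s : Fin k → GenSection E M), IsOpen U ∧ x₀ ∈ U ∧
    (∀ i, SmoothGenSectionOn (s i) U) ∧
    ∀ x ∈ U, LinearIndependent ℝ (fun i ↦ s i x) ∧
      Submodule.span ℝ (Set.range fun i ↦ s i x) = L x

/-- The space of smooth sections with values in `L`. -/
def sections [IsManifold 𝓘(ℝ, E) ∞ M] (L : Family E M) : Set (GenSection E M) :=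
  {a | SmoothGenSectionOn a Set.univ ∧ ∀ x, a x ∈ L x}

/-- The smooth sections of `L` are closed under the Dorfman bracket. -/
def IsInvolutive [IsManifold 𝓘(ℝ, E) ∞ M] (L : Family E M) : Prop :=
  ∀ a ∈ sections L, ∀ b ∈ sections L, ∀ x, dorfman a b x ∈ L x

/-- Dirac structures. -/
structure IsDirac [IsManifold 𝓘(ℝ, E) ∞ M] (L : Family E M) : Prop where
  lagrangian : IsLagrangian L
  subbundle : IsSubbundle L
  involutive : IsInvolutive L

/-- The cotangent product
`L ⊛ R = {u_L + u_R + ξ | u_L + ξ ∈ L, u_R + ξ ∈ R}`. -/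
def cotangentProduct (L R : Family E M) : Family E M := fun x ↦
  { carrier := {a | ∃ uL uR : TangentSpace 𝓘(ℝ, E) x,
      (uL, a.2) ∈ L x ∧ (uR, a.2) ∈ R x ∧ a.1 = uL + uR}
    add_mem' := by
      rintro a b ⟨u, v, hu, hv, h⟩ ⟨u', v', hu', hv', h'⟩
      refine ⟨u + u', v + v', (L x).add_mem hu hu', (R x).add_mem hv hv', ?_⟩
      rw [Prod.fst_add, h, h']
      abel
    zero_mem' := ⟨0, 0, (L x).zero_mem, (R x).zero_mem, by simp⟩
    smul_mem' := by
      rintro c a ⟨u, v, hu, hv, h⟩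
      refine ⟨c • u, c • v, (L x).smul_mem c hu, (R x).smul_mem c hv, ?_⟩
      rw [Prod.smul_fst, h, smul_add] }

/-- Weak concurrence: the sections of `L ⊛ R` are closed under the Dorfman bracket (while
`L ⊛ R` need not be a subbundle). -/
def WeaklyConcur [IsManifold 𝓘(ℝ, E) ∞ M] (L R : Family E M) : Prop := IsInvolutive (cotangentProduct L R)

/-- The kernel `K(L) = L ∩ TM`. -/
def kernel (L : Family E M) (x : M) : Submodule ℝ (TangentSpace 𝓘(ℝ, E) x) :=
  (L x).comap (LinearMap.inl ℝ (TangentSpace 𝓘(ℝ, E) x) (TangentSpace 𝓘(ℝ, E) x →L[ℝ] ℝ))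

/-! ### Poisson structures -/

variable (E M) in
/-- Fields of linear maps `T^*M → TM`. -/
abbrev CotangentToTangent : Type _ :=
  ∀ x : M, (TangentSpace 𝓘(ℝ, E) x →L[ℝ] ℝ) →ₗ[ℝ] TangentSpace 𝓘(ℝ, E) x

/-- `π` is (the contraction map `T^*M → TM` of) a smooth bivector field: it is skew-symmetric and
maps smooth one-forms to smooth vector fields. -/
structure IsBivectorField [IsManifold 𝓘(ℝ, E) ∞ M] (π : CotangentToTangent E M) : Prop where
  skew : ∀ (x : M) (ξ η : TangentSpace 𝓘(ℝ, E) x →L[ℝ] ℝ), η (π x ξ) = - ξ (π x η)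
  smooth : ∀ ξ : OneForm E M, SmoothOneFormOn ξ Set.univ →
    SmoothVFieldOn (fun x ↦ π x (ξ x)) Set.univ

/-- The bracket `{f, g} = π(df, dg) = dg (π df)` of functions. -/
def poissonBracket (π : CotangentToTangent E M) (f g : M → ℝ) : M → ℝ := fun x ↦
  mvfderiv 𝓘(ℝ, E) g x (π x (mvfderiv 𝓘(ℝ, E) f x))

/-- Poisson structures: bivector fields whose bracket of smooth functions satisfies the Jacobi
identity. -/
structure IsPoissonBivector [IsManifold 𝓘(ℝ, E) ∞ M] (π : CotangentToTangent E M) : Prop where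
  bivector : IsBivectorField π
  jacobi : ∀ f g h : M → ℝ, ContMDiff 𝓘(ℝ, E) 𝓘(ℝ, ℝ) ∞ f → ContMDiff 𝓘(ℝ, E) 𝓘(ℝ, ℝ) ∞ g →
    ContMDiff 𝓘(ℝ, E) 𝓘(ℝ, ℝ) ∞ h → ∀ x,
      poissonBracket π f (poissonBracket π g h) x + poissonBracket π g (poissonBracket π h f) x
        + poissonBracket π h (poissonBracket π f g) x = 0

/-- The graph `Gr(π) = {π ξ + ξ}`. -/
def bivectorGraph (π : CotangentToTangent E M) : Family E M := fun x ↦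
  LinearMap.range ((π x).prod LinearMap.id)

/-- `L` is (the graph of) a Poisson structure. -/
def IsPoisson [IsManifold 𝓘(ℝ, E) ∞ M] (L : Family E M) : Prop := ∃ π, IsPoissonBivector π ∧ L = bivectorGraph π

/-- `π` and `ρ` are commuting Poisson structures: both are Poisson and so is their sum. -/
def CommutingPoisson [IsManifold 𝓘(ℝ, E) ∞ M] (π ρ : CotangentToTangent E M) : Prop :=
  IsPoissonBivector π ∧ IsPoissonBivector ρ ∧ IsPoissonBivector (π + ρ)

end

/-! ### Maps -/

section

variable {E E' : Type*} [NormedAddCommGroup E] [NormedSpace ℝ E]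
  [NormedAddCommGroup E'] [NormedSpace ℝ E']
  {M : Type*} [TopologicalSpace M] [ChartedSpace E M]
  {P : Type*} [TopologicalSpace P] [ChartedSpace E' P]

/-- The relation `u_M + ξ_M ∼_φ u_P + ξ_P`, i.e. `φ_* u_M = u_P` and `ξ_M = φ^* ξ_P`. -/
def Related (φ : M → P) (x : M) (a : GenTangent E x) (b : GenTangent E' (φ x)) : Prop :=
  mfderiv 𝓘(ℝ, E) 𝓘(ℝ, E') φ x a.1 = b.1 ∧
    a.2 = b.2.comp (mfderiv 𝓘(ℝ, E) 𝓘(ℝ, E') φ x)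

/-- `φ : (M, L) → (P, L')` is forward. -/
def IsForward (φ : M → P) (L : Family E M) (L' : Family E' P) : Prop :=
  ∀ (x : M), ∀ b ∈ L' (φ x), ∃ a ∈ L x, Related φ x a b

/-- `L` pushes forward under `φ` to the Dirac structure `L'`, i.e. `φ_! L = L'`. -/
def PushesForwardTo [IsManifold 𝓘(ℝ, E') ∞ P] (φ : M → P) (L : Family E M) (L' : Family E' P) : Prop :=
  IsDirac L' ∧ IsForward φ L L'

variable (E E') in
/-- Smooth surjective submersions with connected fibres. -/
structure IsConnectedSubmersion (φ : M → P) : Prop where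
  submersion : Manifold.IsSubmersion 𝓘(ℝ, E) 𝓘(ℝ, E') ∞ φ
  surjective : Function.Surjective φ
  connected_fibres : ∀ y, IsConnected (φ ⁻¹' {y})

end

end DiracGeometry

end

/-! The engine is a descent principle for a submersion `φ` with connected fibres and an isotropic,
involutive family `Λ` whose kernel is vertical. Suppose each function `f` on the base has local
smooth lifts: vector fields `X` with `X + d(f ∘ φ)` in `Λ`. Then `X(g ∘ φ)` does not depend on the
choice of `X`. If it also has zero derivative along the fibres, it is the pullback of a bracket `{f,
g}`, which comes from a bivector field on the base. The Jacobiator of this bracket is the pairing of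
`[X + df, Y + dg]` with `Z + dh`, which vanishes by involutivity and isotropy
(`pairing_dorfman_pullbackSection`, `exists_isReduction_of_lifts`).

Lifts exist because the kernel of a Dirac structure, being here the vertical bundle of `pL` or `pR`,
has constant rank. Every smooth one-form annihilating it is therefore locally the covector part of a
smooth section (`IsDirac.exists_lift`).

For the fibre derivatives, the pairing of `[k, X + df]` with `Y + dg` is `k(X(g ∘ φ))` when `k` is
vertical (`pairing_dorfman_vertical`). So involutivity makes the bracket constant along the kernel
of the family itself. This suffices for `L` under `pL`, for `R` under `pR`, and for `L ⊛ R` under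
`r`, since the kernel of `L ⊛ R` is `K(L) + K(R)`. For `L` under `r` the directions `k` in `K(R)`
are missing, and weak concurrence supplies them. If `Y + d(f ∘ r)` lies in `R`, then `k((X + Y)(g ∘
r)) = 0` by involutivity of `L ⊛ R`, while `k(Y(g ∘ r)) = 0` by involutivity of `R`; subtract.

Thus `r` induces Poisson structures `νL`, `νR` and `ν` from `L`, `R` and `L ⊛ R`. Adding lifts shows
`ν = νL + νR`, so `νL` and `νR` commute.

At the left vertex `L` descends to a Poisson structure `ρ`. The push-forward of `R` need not be a
graph; it is the pullback under `qR` of the graph of `νR`, which is Dirac because pullbacks of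
Poisson structures under submersions are. Its cotangent product with the graph of `ρ` is the
pullback of the graph of `νL + νR`, hence involutive. The right vertex is symmetric. -/

noncomputable section

namespace DiracGeometry

open Bundle Set Filter
open scoped Topology

/-! ### Smoothness of vector fields and one-forms in a chart -/

section Coordinates

variable {E : Type*} [NormedAddCommGroup E] [NormedSpace ℝ E]
  {M : Type*} [TopologicalSpace M] [ChartedSpace E M] [IsManifold 𝓘(ℝ, E) ∞ M]

/-- The tangent space at `y` read in the preferred chart at `x₀`. -/
def coordMap (x₀ y : M) : TangentSpace 𝓘(ℝ, E) y →L[ℝ] E :=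
  (trivializationAt E (TangentSpace 𝓘(ℝ, E)) x₀).continuousLinearMapAt ℝ y

/-- The inverse of `coordMap` over the chart domain. -/
def coordSymm (x₀ y : M) : E →L[ℝ] TangentSpace 𝓘(ℝ, E) y :=
  (trivializationAt E (TangentSpace 𝓘(ℝ, E)) x₀).symmL ℝ y

variable {x₀ y : M}

lemma coordMap_coordSymm (hy : y ∈ (chartAt E x₀).source) (v : E) :
    coordMap x₀ y (coordSymm x₀ y v) = v :=
  (trivializationAt E (TangentSpace 𝓘(ℝ, E)) x₀).continuousLinearMapAt_symmL (R := ℝ) hy v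

lemma coordSymm_coordMap (hy : y ∈ (chartAt E x₀).source) (v : TangentSpace 𝓘(ℝ, E) y) :
    coordSymm x₀ y (coordMap x₀ y v) = v :=
  (trivializationAt E (TangentSpace 𝓘(ℝ, E)) x₀).symmL_continuousLinearMapAt (R := ℝ) hy v

lemma coordMap_eq_mvfderiv (hy : y ∈ (chartAt E x₀).source) :
    coordMap x₀ y = mvfderiv 𝓘(ℝ, E) (extChartAt 𝓘(ℝ, E) x₀) y :=
  TangentBundle.continuousLinearMapAt_trivializationAt hy

lemma coordSymm_eq_mfderiv {z : E} (hz : z ∈ (extChartAt 𝓘(ℝ, E) x₀).target) :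
    coordSymm x₀ ((extChartAt 𝓘(ℝ, E) x₀).symm z) =
      (mfderiv 𝓘(ℝ, E) 𝓘(ℝ, E) (extChartAt 𝓘(ℝ, E) x₀).symm z).comp
        (NormedSpace.fromTangentSpace (𝕜 := ℝ) z).symm.toContinuousLinearMap := by
  have := TangentBundle.symmL_trivializationAt (I := 𝓘(ℝ, E)) (𝕜 := ℝ) (E := E) (x₀ := x₀)
    (x := (extChartAt 𝓘(ℝ, E) x₀).symm z)
    (by simpa using (extChartAt 𝓘(ℝ, E) x₀).map_target hz)
  rw [modelWithCornersSelf_coe, range_id, mfderivWithin_univ,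
    (extChartAt 𝓘(ℝ, E) x₀).right_inv hz] at this
  exact this

lemma smoothVFieldOn_iff {u : VField E M} {U : Set M} (hU : IsOpen U)
    (hUx : U ⊆ (chartAt E x₀).source) :
    SmoothVFieldOn u U ↔
      ContMDiffOn 𝓘(ℝ, E) 𝓘(ℝ, E) ∞ (fun y ↦ coordMap x₀ y (u y)) U := by
  unfold SmoothVFieldOn
  rw [(trivializationAt E (TangentSpace 𝓘(ℝ, E)) x₀).contMDiffOn_section_iff hU hUx]
  refine contMDiffOn_congr fun y hy ↦ ?_
  exact congrFun (Trivialization.coe_linearMapAt_of_mem (R := ℝ) _ (hUx hy)).symm (u y)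

lemma inCoordinates_covector (ξ : TangentSpace 𝓘(ℝ, E) y →L[ℝ] ℝ) :
    ContinuousLinearMap.inCoordinates E (TangentSpace 𝓘(ℝ, E)) ℝ (Trivial M ℝ) x₀ y x₀ y ξ
      = ξ.comp (coordSymm x₀ y) := by
  ext v
  simp only [ContinuousLinearMap.inCoordinates, coordSymm, ContinuousLinearMap.comp_apply]
  exact congrArg (fun f : ℝ →L[ℝ] ℝ ↦ f (ξ ((trivializationAt E (TangentSpace 𝓘(ℝ, E)) x₀).symmL
    ℝ y v))) (Trivial.continuousLinearMapAt_trivialization ℝ M ℝ y)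

lemma smoothOneFormOn_iff {ξ : OneForm E M} {U : Set M} (hU : IsOpen U)
    (hUx : U ⊆ (chartAt E x₀).source) :
    SmoothOneFormOn ξ U ↔
      ContMDiffOn 𝓘(ℝ, E) 𝓘(ℝ, E →L[ℝ] ℝ) ∞ (fun y ↦ (ξ y).comp (coordSymm x₀ y)) U := by
  unfold SmoothOneFormOn
  have := (trivializationAt (E →L[ℝ] ℝ) (fun x ↦ TangentSpace 𝓘(ℝ, E) x →L[ℝ] Trivial M ℝ x)
    x₀).contMDiffOn_section_iff (IB := 𝓘(ℝ, E)) (n := ∞) (s := ξ) hU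
      (fun y hy ↦ by simpa using hUx hy)
  refine Iff.trans this ?_
  refine contMDiffOn_congr fun y hy ↦ ?_
  rw [hom_trivializationAt_apply]
  exact inCoordinates_covector (ξ y)

end Coordinates

end DiracGeometry

namespace DiracGeometry

open Bundle Set Filter
open scoped Topology

/-! ### Brackets and exterior derivatives in charts; Cartan's formula -/

section Cartan

variable {E : Type*} [NormedAddCommGroup E] [NormedSpace ℝ E]
  {M : Type*} [TopologicalSpace M] [ChartedSpace E M] [IsManifold 𝓘(ℝ, E) ∞ M]
  {x : M}

/-- A vector field read in the preferred chart at `x`. -/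
def VField.inChart (u : VField E M) (x : M) (z : E) : E :=
  coordMap x ((extChartAt 𝓘(ℝ, E) x).symm z) (u ((extChartAt 𝓘(ℝ, E) x).symm z))

lemma coordMap_self (v : TangentSpace 𝓘(ℝ, E) x) : coordMap x x v = v := by
  rw [coordMap_eq_mvfderiv (mem_chart_source E x)]
  exact congrArg (fun f ↦ f v) (mfderiv_extChartAt_self (I := 𝓘(ℝ, E)) (x := x))

lemma OneForm.inChart_eq (ξ : OneForm E M) {z : E} (hz : z ∈ (extChartAt 𝓘(ℝ, E) x).target) :
    ξ.inChart x z = (ξ ((extChartAt 𝓘(ℝ, E) x).symm z)).comp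
      (coordSymm x ((extChartAt 𝓘(ℝ, E) x).symm z)) := by
  rw [coordSymm_eq_mfderiv hz]
  rfl

omit [IsManifold 𝓘(ℝ, E) ∞ M] in
lemma target_mem_nhds (x : M) :
    (extChartAt 𝓘(ℝ, E) x).target ∈ 𝓝 (extChartAt 𝓘(ℝ, E) x x) :=
  extChartAt_target_mem_nhds x

lemma contMDiffAt_symm (x : M) :
    ContMDiffAt 𝓘(ℝ, E) 𝓘(ℝ, E) ∞ (extChartAt 𝓘(ℝ, E) x).symm (extChartAt 𝓘(ℝ, E) x x) :=
  (contMDiffOn_extChartAt_symm x).contMDiffAt (target_mem_nhds x)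

lemma contDiffAt_comp_symm {F : Type*} [NormedAddCommGroup F] [NormedSpace ℝ F] {g : M → F}
    (hg : ContMDiffAt 𝓘(ℝ, E) 𝓘(ℝ, F) ∞ g x) :
    ContDiffAt ℝ ∞ (g ∘ (extChartAt 𝓘(ℝ, E) x).symm) (extChartAt 𝓘(ℝ, E) x x) := by
  rw [← contMDiffAt_iff_contDiffAt]
  exact ContMDiffAt.comp (I' := 𝓘(ℝ, E)) _ (by rwa [extChartAt_to_inv]) (contMDiffAt_symm x)

lemma SmoothVFieldOn.mono {u : VField E M} {U V : Set M} (h : SmoothVFieldOn u U) (hV : V ⊆ U) :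
    SmoothVFieldOn u V := ContMDiffOn.mono h hV

lemma SmoothOneFormOn.mono {u : OneForm E M} {U V : Set M} (h : SmoothOneFormOn u U)
    (hV : V ⊆ U) : SmoothOneFormOn u V := ContMDiffOn.mono h hV

lemma SmoothVFieldOn.contDiffAt_inChart {u : VField E M} {U : Set M} (hu : SmoothVFieldOn u U)
    (hU : IsOpen U) (hx : x ∈ U) :
    ContDiffAt ℝ ∞ (u.inChart x) (extChartAt 𝓘(ℝ, E) x x) := by
  have hV : IsOpen (U ∩ (chartAt E x).source) := hU.inter (chartAt E x).open_source
  have h := (smoothVFieldOn_iff hV inter_subset_right).1 (hu.mono inter_subset_left)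
  exact contDiffAt_comp_symm (h.contMDiffAt (hV.mem_nhds ⟨hx, mem_chart_source E x⟩))

lemma SmoothOneFormOn.contDiffAt_inChart {ξ : OneForm E M} {U : Set M} (hξ : SmoothOneFormOn ξ U)
    (hU : IsOpen U) (hx : x ∈ U) :
    ContDiffAt ℝ ∞ (ξ.inChart x) (extChartAt 𝓘(ℝ, E) x x) := by
  have hV : IsOpen (U ∩ (chartAt E x).source) := hU.inter (chartAt E x).open_source
  have h := (smoothOneFormOn_iff hV inter_subset_right).1 (hξ.mono inter_subset_left)
  refine (contDiffAt_comp_symm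
    (h.contMDiffAt (hV.mem_nhds ⟨hx, mem_chart_source E x⟩))).congr_of_eventuallyEq ?_
  filter_upwards [target_mem_nhds x] with z hz using ξ.inChart_eq hz

/-- The preferred chart at `x` has identity derivative at its own centre, under the identification
of the tangent space with `E`. The bracket of the chart representatives therefore needs no change of
frame there. -/
lemma mlieBracket_eq_lieBracket (u v : VField E M) :
    VectorField.mlieBracket 𝓘(ℝ, E) u v x =
      VectorField.lieBracket ℝ (u.inChart x) (v.inChart x) (extChartAt 𝓘(ℝ, E) x x) := by
  have key : ∀ w : VField E M,
      VectorField.mpullback 𝓘(ℝ, E) 𝓘(ℝ, E) (extChartAt 𝓘(ℝ, E) x).symm w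
        =ᶠ[𝓝 (extChartAt 𝓘(ℝ, E) x x)] w.inChart x := by
    intro w
    filter_upwards [target_mem_nhds x] with z hz
    rw [VectorField.mpullback_apply]
    have hz' : (extChartAt 𝓘(ℝ, E) x).symm z ∈ (chartAt E x).source := by
      simpa using (extChartAt 𝓘(ℝ, E) x).map_target hz
    refine congrArg (fun f : TangentSpace 𝓘(ℝ, E) ((extChartAt 𝓘(ℝ, E) x).symm z) →L[ℝ] E ↦ f (w _))
      (ContinuousLinearMap.inverse_eq (f := mfderiv 𝓘(ℝ, E) 𝓘(ℝ, E) (extChartAt 𝓘(ℝ, E) x).symm z)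
        (g := coordMap x ((extChartAt 𝓘(ℝ, E) x).symm z)) ?_ ?_)
    · ext v
      have := coordSymm_coordMap hz' v
      rw [coordSymm_eq_mfderiv hz] at this
      exact this
    · ext v
      have := coordMap_coordSymm hz' v
      rw [coordSymm_eq_mfderiv hz] at this
      exact this
  have h1 : VectorField.mlieBracket 𝓘(ℝ, E) u v x =
      (mfderiv 𝓘(ℝ, E) 𝓘(ℝ, E) (extChartAt 𝓘(ℝ, E) x) x).inverse
      (VectorField.lieBracket ℝ (E := E)
        (VectorField.mpullback 𝓘(ℝ, E) 𝓘(ℝ, E) (extChartAt 𝓘(ℝ, E) x).symm u)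
        (VectorField.mpullback 𝓘(ℝ, E) 𝓘(ℝ, E) (extChartAt 𝓘(ℝ, E) x).symm v)
        (extChartAt 𝓘(ℝ, E) x x)) := by
    rw [← VectorField.mlieBracketWithin_univ, VectorField.mlieBracketWithin_apply]
    simp only [modelWithCornersSelf_coe, range_id, preimage_univ, univ_inter,
      VectorField.mpullbackWithin_univ]
    erw [VectorField.lieBracketWithin_univ]
  rw [h1, Filter.EventuallyEq.lieBracket_vectorField_eq (𝕜 := ℝ) (E := E) (key u) (key v),
    mfderiv_extChartAt_self]
  exact congrArg (fun f : E →L[ℝ] E ↦ f _) ContinuousLinearMap.inverse_id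

omit [IsManifold 𝓘(ℝ, E) ∞ M] in
lemma mvfderiv_eq_fderiv {g : M → ℝ} (hg : MDifferentiableAt 𝓘(ℝ, E) 𝓘(ℝ, ℝ) g x) :
    mvfderiv 𝓘(ℝ, E) g x =
      fderiv ℝ (g ∘ (extChartAt 𝓘(ℝ, E) x).symm) (extChartAt 𝓘(ℝ, E) x x) := by
  have := hg.mvfderiv
  rw [modelWithCornersSelf_coe, range_id, fderivWithin_univ] at this
  exact this

lemma contractD_apply (ξ : OneForm E M) (v w : TangentSpace 𝓘(ℝ, E) x) :
    contractD ξ x v w =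
      fderiv ℝ (ξ.inChart x) (extChartAt 𝓘(ℝ, E) x x) v w
        - fderiv ℝ (ξ.inChart x) (extChartAt 𝓘(ℝ, E) x x) w v := by
  have hT : mvfderiv 𝓘(ℝ, E) (extChartAt 𝓘(ℝ, E) x) x = ContinuousLinearMap.id ℝ E :=
    mfderiv_extChartAt_self (I := 𝓘(ℝ, E)) (x := x)
  unfold contractD
  simp only [hT]
  rfl

lemma SmoothOneFormOn.contMDiffOn_apply {ξ : OneForm E M} {v : VField E M} {U : Set M}
    (hξ : SmoothOneFormOn ξ U) (hv : SmoothVFieldOn v U) :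
    ContMDiffOn 𝓘(ℝ, E) 𝓘(ℝ, ℝ) ∞ (fun y ↦ ξ y (v y)) U := by
  have h := ContMDiffOn.clm_bundle_apply (E₂ := Trivial M ℝ) (F₂ := ℝ) (b := id) (ϕ := ξ) hξ hv
  intro y hy
  exact (contMDiffWithinAt_totalSpace.1 (h y hy)).2

lemma mvfderiv_oneForm_apply {ξ : OneForm E M} {v : VField E M} {U : Set M}
    (hξ : SmoothOneFormOn ξ U) (hv : SmoothVFieldOn v U) (hU : IsOpen U) (hx : x ∈ U)
    (w : TangentSpace 𝓘(ℝ, E) x) :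
    mvfderiv 𝓘(ℝ, E) (fun y ↦ ξ y (v y)) x w =
      fderiv ℝ (ξ.inChart x) (extChartAt 𝓘(ℝ, E) x x) w (v x) +
        ξ x (fderiv ℝ (v.inChart x) (extChartAt 𝓘(ℝ, E) x x) w) := by
  have hd : MDifferentiableAt 𝓘(ℝ, E) 𝓘(ℝ, ℝ) (fun y ↦ ξ y (v y)) x :=
    ((hξ.contMDiffOn_apply hv).contMDiffAt (hU.mem_nhds hx)).mdifferentiableAt (by simp)
  rw [mvfderiv_eq_fderiv hd]
  have he : ((fun y ↦ ξ y (v y)) ∘ (extChartAt 𝓘(ℝ, E) x).symm)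
      =ᶠ[𝓝 (extChartAt 𝓘(ℝ, E) x x)] fun z ↦ ξ.inChart x z (v.inChart x z) := by
    filter_upwards [target_mem_nhds x] with z hz
    have hz' : (extChartAt 𝓘(ℝ, E) x).symm z ∈ (chartAt E x).source := by
      simpa using (extChartAt 𝓘(ℝ, E) x).map_target hz
    rw [ξ.inChart_eq hz]
    exact congrArg (ξ _) (coordSymm_coordMap hz' _).symm
  have hx0 : x ∈ (chartAt E x).source := mem_chart_source E x
  have h1 : v.inChart x (extChartAt 𝓘(ℝ, E) x x) = v x := by
    have := coordMap_self (v x)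
    rw [VField.inChart, extChartAt_to_inv]
    exact this
  have h2 : ∀ a : E, ξ.inChart x (extChartAt 𝓘(ℝ, E) x x) a = ξ x a := by
    intro a
    have h3 := coordMap_coordSymm hx0 a
    rw [coordMap_self] at h3
    rw [ξ.inChart_eq (mem_extChartAt_target x), extChartAt_to_inv, ContinuousLinearMap.comp_apply]
    exact congrArg (ξ x) h3
  have hξ' := (hξ.contDiffAt_inChart hU hx).differentiableAt (by simp)
  have hv' := (hv.contDiffAt_inChart hU hx).differentiableAt (by simp)
  have := (hξ'.hasFDerivAt.clm_apply hv'.hasFDerivAt).congr_of_eventuallyEq he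
  have h3 := congrArg (fun f : E →L[ℝ] ℝ ↦ f w) this.fderiv
  refine h3.trans ?_
  rw [add_comm]
  refine congrArg₂ (· + ·) ?_ (h2 _)
  exact congrArg _ h1

/-- Cartan's formula `dξ (v, w) = v (ξ w) - w (ξ v) - ξ [v, w]`. -/
lemma contractD_eq {ξ : OneForm E M} {v w : VField E M} {U : Set M}
    (hξ : SmoothOneFormOn ξ U) (hv : SmoothVFieldOn v U) (hw : SmoothVFieldOn w U)
    (hU : IsOpen U) (hx : x ∈ U) :
    contractD ξ x (v x) (w x) =
      mvfderiv 𝓘(ℝ, E) (fun y ↦ ξ y (w y)) x (v x) - mvfderiv 𝓘(ℝ, E) (fun y ↦ ξ y (v y)) x (w x)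
        - ξ x (VectorField.mlieBracket 𝓘(ℝ, E) v w x) := by
  rw [contractD_apply, mvfderiv_oneForm_apply hξ hv hU hx, mvfderiv_oneForm_apply hξ hw hU hx,
    mlieBracket_eq_lieBracket, VectorField.lieBracket_eq]
  have h1 : ∀ {v : VField E M}, v.inChart x (extChartAt 𝓘(ℝ, E) x x) = v x := by
    intro v
    have := coordMap_self (v x)
    rw [VField.inChart, extChartAt_to_inv]
    exact this
  simp only [h1]
  have := (ξ x).map_sub (fderiv ℝ (w.inChart x) (extChartAt 𝓘(ℝ, E) x x) (v x))
    (fderiv ℝ (v.inChart x) (extChartAt 𝓘(ℝ, E) x x) (w x))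
  erw [this]
  ring

end Cartan

end DiracGeometry

namespace DiracGeometry

open Bundle Set Filter
open scoped Topology

/-! ### Exact one-forms and the pairing with a Dorfman bracket -/

section Differentials

variable {E : Type*} [NormedAddCommGroup E] [NormedSpace ℝ E]
  {M : Type*} [TopologicalSpace M] [ChartedSpace E M] [IsManifold 𝓘(ℝ, E) ∞ M]
  {x : M} {U : Set M}

lemma SmoothVFieldOn.of_locally {u : VField E M}
    (h : ∀ x ∈ U, ∃ V, IsOpen V ∧ x ∈ V ∧ SmoothVFieldOn u V) : SmoothVFieldOn u U :=
  contMDiffOn_of_locally_contMDiffOn fun x hx ↦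
    let ⟨V, hV, hxV, hu⟩ := h x hx
    ⟨V, hV, hxV, hu.mono inter_subset_right⟩

lemma SmoothOneFormOn.of_locally {u : OneForm E M}
    (h : ∀ x ∈ U, ∃ V, IsOpen V ∧ x ∈ V ∧ SmoothOneFormOn u V) : SmoothOneFormOn u U :=
  contMDiffOn_of_locally_contMDiffOn fun x hx ↦
    let ⟨V, hV, hxV, hu⟩ := h x hx
    ⟨V, hV, hxV, hu.mono inter_subset_right⟩

lemma mvfderiv_comp_coordSymm {F : Type*} [NormedAddCommGroup F] [NormedSpace ℝ F] {g : M → F}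
    {z : E} (hz : z ∈ (extChartAt 𝓘(ℝ, E) x).target)
    (hg : MDifferentiableAt 𝓘(ℝ, E) 𝓘(ℝ, F) g ((extChartAt 𝓘(ℝ, E) x).symm z)) :
    (mvfderiv 𝓘(ℝ, E) g ((extChartAt 𝓘(ℝ, E) x).symm z)).comp
        (coordSymm x ((extChartAt 𝓘(ℝ, E) x).symm z)) =
      fderiv ℝ (g ∘ (extChartAt 𝓘(ℝ, E) x).symm) z := by
  have hs : MDifferentiableAt 𝓘(ℝ, E) 𝓘(ℝ, E) (extChartAt 𝓘(ℝ, E) x).symm z :=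
    ((contMDiffOn_extChartAt_symm (n := ∞) x).contMDiffAt
      ((isOpen_extChartAt_target x).mem_nhds hz)).mdifferentiableAt (by simp)
  have h := mfderiv_comp z hg hs
  rw [mfderiv_eq_fderiv] at h
  rw [coordSymm_eq_mfderiv hz]
  exact h.symm

lemma inChart_mvfderiv {g : M → ℝ} {z : E} (hz : z ∈ (extChartAt 𝓘(ℝ, E) x).target)
    (hg : MDifferentiableAt 𝓘(ℝ, E) 𝓘(ℝ, ℝ) g ((extChartAt 𝓘(ℝ, E) x).symm z)) :
    OneForm.inChart (mvfderiv 𝓘(ℝ, E) g) x z =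
      fderiv ℝ (g ∘ (extChartAt 𝓘(ℝ, E) x).symm) z := by
  rw [OneForm.inChart_eq _ hz, mvfderiv_comp_coordSymm hz hg]

lemma contMDiffOn_mvfderiv_comp_coordSymm {F : Type*} [NormedAddCommGroup F] [NormedSpace ℝ F]
    {g : M → F} (hU : IsOpen U) (hUx : U ⊆ (chartAt E x).source)
    (hg : ContMDiffOn 𝓘(ℝ, E) 𝓘(ℝ, F) ∞ g U) :
    ContMDiffOn 𝓘(ℝ, E) 𝓘(ℝ, E →L[ℝ] F) ∞
      (fun y ↦ (mvfderiv 𝓘(ℝ, E) g y).comp (coordSymm x y)) U := by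
  intro y hy
  have hys : y ∈ (extChartAt 𝓘(ℝ, E) x).source := by simpa using hUx hy
  have hyt := (extChartAt 𝓘(ℝ, E) x).map_source hys
  have hg' : ContDiffAt ℝ ∞ (g ∘ (extChartAt 𝓘(ℝ, E) x).symm) (extChartAt 𝓘(ℝ, E) x y) := by
    rw [← contMDiffAt_iff_contDiffAt]
    refine ContMDiffAt.comp (I' := 𝓘(ℝ, E)) _ ?_ ((contMDiffOn_extChartAt_symm x).contMDiffAt
      ((isOpen_extChartAt_target x).mem_nhds hyt))
    rw [(extChartAt 𝓘(ℝ, E) x).left_inv hys]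
    exact hg.contMDiffAt (hU.mem_nhds hy)
  have h1 : ContDiffAt ℝ ∞ (fderiv ℝ (g ∘ (extChartAt 𝓘(ℝ, E) x).symm))
      (extChartAt 𝓘(ℝ, E) x y) := hg'.fderiv_right (by simp)
  have h2 : ContMDiffAt 𝓘(ℝ, E) 𝓘(ℝ, E →L[ℝ] F) ∞
      (fun y ↦ fderiv ℝ (g ∘ (extChartAt 𝓘(ℝ, E) x).symm) (extChartAt 𝓘(ℝ, E) x y)) y :=
    ContMDiffAt.comp (I' := 𝓘(ℝ, E)) y h1.contMDiffAt (contMDiffAt_extChartAt' (hUx hy))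
  refine (h2.congr_of_eventuallyEq ?_).contMDiffWithinAt
  filter_upwards [hU.mem_nhds hy] with z hz
  have hzs : z ∈ (extChartAt 𝓘(ℝ, E) x).source := by simpa using hUx hz
  have hzt := (extChartAt 𝓘(ℝ, E) x).map_source hzs
  have hd : MDifferentiableAt 𝓘(ℝ, E) 𝓘(ℝ, F) g
      ((extChartAt 𝓘(ℝ, E) x).symm (extChartAt 𝓘(ℝ, E) x z)) := by
    rw [(extChartAt 𝓘(ℝ, E) x).left_inv hzs]
    exact (hg.contMDiffAt (hU.mem_nhds hz)).mdifferentiableAt (by simp)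
  rw [← mvfderiv_comp_coordSymm hzt hd, (extChartAt 𝓘(ℝ, E) x).left_inv hzs]

lemma smoothOneFormOn_mvfderiv {g : M → ℝ} (hU : IsOpen U)
    (hg : ContMDiffOn 𝓘(ℝ, E) 𝓘(ℝ, ℝ) ∞ g U) : SmoothOneFormOn (mvfderiv 𝓘(ℝ, E) g) U := by
  refine .of_locally fun x hx ↦ ?_
  have hV : IsOpen (U ∩ (chartAt E x).source) := hU.inter (chartAt E x).open_source
  refine ⟨_, hV, ⟨hx, mem_chart_source E x⟩, ?_⟩
  rw [smoothOneFormOn_iff (x₀ := x) hV inter_subset_right]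
  exact contMDiffOn_mvfderiv_comp_coordSymm hV inter_subset_right (hg.mono inter_subset_left)

/-- This is `d ∘ d = 0`: in the chart, symmetry of the second derivative of `g`. -/
lemma contractD_mvfderiv {g : M → ℝ} (hU : IsOpen U) (hx : x ∈ U)
    (hg : ContMDiffOn 𝓘(ℝ, E) 𝓘(ℝ, ℝ) ∞ g U) (v : TangentSpace 𝓘(ℝ, E) x) :
    contractD (mvfderiv 𝓘(ℝ, E) g) x v = 0 := by
  ext w
  rw [contractD_apply]
  have he : OneForm.inChart (mvfderiv 𝓘(ℝ, E) g) x =ᶠ[𝓝 (extChartAt 𝓘(ℝ, E) x x)]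
      fderiv ℝ (g ∘ (extChartAt 𝓘(ℝ, E) x).symm) := by
    have hUx : U ∈ 𝓝 ((extChartAt 𝓘(ℝ, E) x).symm (extChartAt 𝓘(ℝ, E) x x)) := by
      rw [extChartAt_to_inv]
      exact hU.mem_nhds hx
    filter_upwards [target_mem_nhds x, (continuousAt_extChartAt_symm x).preimage_mem_nhds hUx]
      with z hz hzU
    exact inChart_mvfderiv hz ((hg.contMDiffAt (hU.mem_nhds hzU)).mdifferentiableAt (by simp))
  rw [he.fderiv_eq]
  have hs := (contDiffAt_comp_symm (hg.contMDiffAt (hU.mem_nhds hx))).isSymmSndFDerivAt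
    (by simp only [minSmoothness_of_isRCLikeNormedField]; exact WithTop.coe_le_coe.2 le_top)
  exact sub_eq_zero.2 (hs.eq v w)

lemma mvfderiv_mlieBracket {g : M → ℝ} {v w : VField E M}
    (hg : ContMDiffOn 𝓘(ℝ, E) 𝓘(ℝ, ℝ) ∞ g U) (hv : SmoothVFieldOn v U) (hw : SmoothVFieldOn w U)
    (hU : IsOpen U) (hx : x ∈ U) :
    mvfderiv 𝓘(ℝ, E) g x (VectorField.mlieBracket 𝓘(ℝ, E) v w x) =
      mvfderiv 𝓘(ℝ, E) (fun y ↦ mvfderiv 𝓘(ℝ, E) g y (w y)) x (v x)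
        - mvfderiv 𝓘(ℝ, E) (fun y ↦ mvfderiv 𝓘(ℝ, E) g y (v y)) x (w x) := by
  have h := contractD_eq (smoothOneFormOn_mvfderiv hU hg) hv hw hU hx
  rw [contractD_mvfderiv hU hx hg] at h
  have : (0 : TangentSpace 𝓘(ℝ, E) x →L[ℝ] ℝ) (w x) = 0 := rfl
  rw [this] at h
  linarith

/-- Cartan's formula removes both exterior derivatives. Only Lie brackets and derivatives of
contractions remain, so for exact covector parts everything becomes iterated derivatives of
functions. -/
lemma pairing_dorfman {a b c : GenSection E M} (ha : SmoothGenSectionOn a U)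
    (hb : SmoothGenSectionOn b U) (hc : SmoothGenSectionOn c U) (hU : IsOpen U) (hx : x ∈ U) :
    pairing (dorfman a b x) (c x) =
      (c x).2 (VectorField.mlieBracket 𝓘(ℝ, E) (fun y ↦ (a y).1) (fun y ↦ (b y).1) x)
      - (b x).2 (VectorField.mlieBracket 𝓘(ℝ, E) (fun y ↦ (a y).1) (fun y ↦ (c y).1) x)
      + (a x).2 (VectorField.mlieBracket 𝓘(ℝ, E) (fun y ↦ (b y).1) (fun y ↦ (c y).1) x)
      + mvfderiv 𝓘(ℝ, E) (fun y ↦ (b y).2 (c y).1) x (a x).1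
      - mvfderiv 𝓘(ℝ, E) (fun y ↦ (a y).2 (c y).1) x (b x).1
      + mvfderiv 𝓘(ℝ, E) (fun y ↦ (a y).2 (b y).1) x (c x).1 := by
  have h1 := contractD_eq hb.2 ha.1 hc.1 hU hx
  have h2 := contractD_eq ha.2 hb.1 hc.1 hU hx
  have h3 : pairing (dorfman a b x) (c x) =
      (c x).2 (VectorField.mlieBracket 𝓘(ℝ, E) (fun y ↦ (a y).1) (fun y ↦ (b y).1) x)
      + (mvfderiv 𝓘(ℝ, E) (fun y ↦ (b y).2 (a y).1) x (c x).1
        + contractD (fun y ↦ (b y).2) x (a x).1 (c x).1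
        - contractD (fun y ↦ (a y).2) x (b x).1 (c x).1) := rfl
  rw [h3, h1, h2]
  ring

end Differentials

/-! ### Locality of the Dorfman bracket -/

section Locality

variable {E : Type*} [NormedAddCommGroup E] [NormedSpace ℝ E]
  {M : Type*} [TopologicalSpace M] [ChartedSpace E M]
  {x : M} {U : Set M}

lemma contractD_congr {ξ η : OneForm E M} (h : ∀ᶠ y in 𝓝 x, ξ y = η y) : contractD ξ x = contractD η x := by
  have he : ξ.inChart x =ᶠ[𝓝 (extChartAt 𝓘(ℝ, E) x x)] η.inChart x := by
    have h' : ∀ᶠ y in 𝓝 ((extChartAt 𝓘(ℝ, E) x).symm (extChartAt 𝓘(ℝ, E) x x)), ξ y = η y := by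
      rw [extChartAt_to_inv]
      exact h
    filter_upwards [(continuousAt_extChartAt_symm x).eventually h'] with z hz
    simp only [OneForm.inChart, hz]
  funext v
  simp only [contractD, he.fderiv_eq]

lemma mvfderiv_congr {F : Type*} [NormedAddCommGroup F] [NormedSpace ℝ F] {f g : M → F}
    (h : f =ᶠ[𝓝 x] g) : mvfderiv 𝓘(ℝ, E) f x = mvfderiv 𝓘(ℝ, E) g x := by
  ext v
  exact congrArg (fun f : TangentSpace 𝓘(ℝ, E) x →L[ℝ] F ↦ f v) h.mfderiv_eq

lemma dorfman_congr {a b a' b' : GenSection E M} (ha : ∀ᶠ y in 𝓝 x, a y = a' y)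
    (hb : ∀ᶠ y in 𝓝 x, b y = b' y) :
    dorfman a b x = dorfman a' b' x := by
  have ha1 : ∀ᶠ y in 𝓝 x, (a y).1 = (a' y).1 := ha.mono fun y hy ↦ by simp only [hy]
  have ha2 : ∀ᶠ y in 𝓝 x, (a y).2 = (a' y).2 := ha.mono fun y hy ↦ by simp only [hy]
  have hb1 : ∀ᶠ y in 𝓝 x, (b y).1 = (b' y).1 := hb.mono fun y hy ↦ by simp only [hy]
  have hb2 : ∀ᶠ y in 𝓝 x, (b y).2 = (b' y).2 := hb.mono fun y hy ↦ by simp only [hy]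
  have hba : (fun y ↦ (b y).2 (a y).1) =ᶠ[𝓝 x] fun y ↦ (b' y).2 (a' y).1 :=
    ha.mp (hb.mono fun y hy hy' ↦ by simp only [hy, hy'])
  simp only [dorfman, lieDerivative]
  rw [Filter.EventuallyEq.mlieBracket_vectorField_eq ha1 hb1, contractD_congr ha2, contractD_congr hb2,
    mvfderiv_congr hba, ha.self_of_nhds, hb.self_of_nhds]

variable [FiniteDimensional ℝ E] [T2Space M] [IsManifold 𝓘(ℝ, E) ∞ M]

/-- A local smooth section of a family agrees near each point with a global one. -/
lemma exists_mem_sections {L : Family E M} {a : GenSection E M} (ha : SmoothGenSectionOn a U)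
    (haL : ∀ y ∈ U, a y ∈ L y) (hU : IsOpen U) (hx : x ∈ U) :
    ∃ b ∈ sections L, ∀ᶠ y in 𝓝 x, b y = a y := by
  obtain ⟨ψ, -, hψ⟩ := (SmoothBumpFunction.nhds_basis_tsupport (I := 𝓘(ℝ, E)) x).mem_iff.1
    (hU.mem_nhds hx)
  have hψs : ContMDiffOn 𝓘(ℝ, E) 𝓘(ℝ, ℝ) ∞ ψ U := ψ.contMDiff.contMDiffOn
  refine ⟨fun y ↦ ψ y • a y, ⟨⟨?_, ?_⟩, ?_⟩, ?_⟩
  · exact (ContMDiffOn.smul_section_of_tsupport hψs hU hψ ha.1).contMDiffOn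
  · exact (ContMDiffOn.smul_section_of_tsupport (V := fun x ↦ TangentSpace 𝓘(ℝ, E) x →L[ℝ]
      Trivial M ℝ x) hψs hU hψ ha.2).contMDiffOn
  · intro y
    by_cases hy : y ∈ U
    · exact (L y).smul_mem _ (haL y hy)
    · have : ψ y = 0 := image_eq_zero_of_notMem_tsupport fun h ↦ hy (hψ h)
      show ψ y • a y ∈ L y
      rw [this, zero_smul]
      exact (L y).zero_mem
  · filter_upwards [ψ.eventuallyEq_one] with y hy
    simp [hy]

/-- Involutivity is defined through global sections, whereas lifts and vertical extensions exist
only locally. Cutting off with a bump function bridges the gap, because the bracket at a point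
depends only on germs. -/
lemma IsInvolutive.dorfman_mem {L : Family E M} (hL : IsInvolutive L) {a b : GenSection E M}
    (ha : SmoothGenSectionOn a U) (haL : ∀ y ∈ U, a y ∈ L y) (hb : SmoothGenSectionOn b U)
    (hbL : ∀ y ∈ U, b y ∈ L y) (hU : IsOpen U) (hx : x ∈ U) : dorfman a b x ∈ L x := by
  obtain ⟨a', ha', haa⟩ := exists_mem_sections ha haL hU hx
  obtain ⟨b', hb', hbb⟩ := exists_mem_sections hb hbL hU hx
  rw [← dorfman_congr haa hbb]
  exact hL a' ha' b' hb' x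

end Locality

end DiracGeometry

namespace DiracGeometry

open Bundle Set Filter
open scoped Topology

/-! ### Smooth right inverses of families of linear maps -/

section RightInverse

variable {E : Type*} [NormedAddCommGroup E] [NormedSpace ℝ E]
  {M : Type*} [TopologicalSpace M] [ChartedSpace E M]
  {V W : Type*} [NormedAddCommGroup V] [NormedSpace ℝ V]
  [NormedAddCommGroup W] [NormedSpace ℝ W] [FiniteDimensional ℝ W]

/-- A smooth family of linear maps which is surjective at a point has a smooth family of right
inverses near that point, whose image does not depend on the point. -/
lemma exists_smooth_rightInverse {ψ : M → V →L[ℝ] W} {x : M} {U : Set M} (hU : IsOpen U)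
    (hx : x ∈ U) (hψ : ContMDiffOn 𝓘(ℝ, E) 𝓘(ℝ, V →L[ℝ] W) ∞ ψ U)
    (hs : Function.Surjective (ψ x)) :
    ∃ (U' : Set M) (ρ : M → W →L[ℝ] V), IsOpen U' ∧ x ∈ U' ∧ U' ⊆ U ∧
      ContMDiffOn 𝓘(ℝ, E) 𝓘(ℝ, W →L[ℝ] V) ∞ ρ U' ∧
      ∀ y ∈ U', (∀ w, ψ y (ρ y w) = w) ∧ (∀ w, ρ y (ψ y (ρ x w)) = ρ x w) ∧
        ∀ w, ∃ w', ρ y w = ρ x w' := by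
  have : CompleteSpace W := FiniteDimensional.complete ℝ W
  obtain ⟨B₀, hB₀⟩ := (ψ x).toLinearMap.exists_rightInverse_of_surjective
    (LinearMap.range_eq_top.2 hs)
  set B : W →L[ℝ] V := LinearMap.toContinuousLinearMap B₀ with hB
  have hxB : (ψ x).comp B = 1 := by
    ext w
    exact congrArg (fun f : W →ₗ[ℝ] W ↦ f w) hB₀
  have hcomp : ContMDiffOn 𝓘(ℝ, E) 𝓘(ℝ, W →L[ℝ] W) ∞ (fun y ↦ (ψ y).comp B) U :=
    hψ.clm_comp contMDiffOn_const
  set U' : Set M := U ∩ (fun y ↦ (ψ y).comp B) ⁻¹' {T | IsUnit T}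
  have hU' : IsOpen U' := hcomp.continuousOn.isOpen_inter_preimage hU Units.isOpen
  have hxU' : x ∈ U' := ⟨hx, by simp only [mem_preimage, hxB]; exact isUnit_one⟩
  -- With `B` a right inverse at `x`, the family is `ρ y = B (ψ y B)⁻¹`. Its image is that of `B`
  -- for every `y`, and `ρ x = B`.
  refine ⟨U', fun y ↦ B.comp (Ring.inverse ((ψ y).comp B)), hU', hxU', inter_subset_left, ?_, ?_⟩
  · refine ContMDiffOn.clm_comp contMDiffOn_const fun y hy ↦ ?_
    obtain ⟨T, hT⟩ := hy.2
    have h1 : ContDiffAt ℝ ∞ Ring.inverse ((ψ y).comp B) := by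
      have := contDiffAt_ringInverse ℝ (n := ∞) T
      rwa [hT] at this
    exact (ContMDiffAt.comp (I' := 𝓘(ℝ, W →L[ℝ] W)) y h1.contMDiffAt
      (hcomp.contMDiffAt (hU.mem_nhds hy.1))).contMDiffWithinAt
  · intro y hy
    have h1 : ((ψ y).comp B) * Ring.inverse ((ψ y).comp B) = 1 := Ring.mul_inverse_cancel _ hy.2
    have h2 : Ring.inverse ((ψ y).comp B) * ((ψ y).comp B) = 1 := Ring.inverse_mul_cancel _ hy.2
    have hρx : Ring.inverse ((ψ x).comp B) = 1 := by rw [hxB, Ring.inverse_one]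
    refine ⟨fun w ↦ congrArg (fun f : W →L[ℝ] W ↦ f w) h1, fun w ↦ ?_, fun w ↦ ?_⟩
    · simp only [hρx]
      exact congrArg (fun f : W →L[ℝ] W ↦ B (f w)) h2
    · refine ⟨Ring.inverse ((ψ y).comp B) w, ?_⟩
      simp only [hρx]
      rfl

end RightInverse

/-! ### Derivatives of maps in charts -/

section CoordDeriv

variable {E E' : Type*} [NormedAddCommGroup E] [NormedSpace ℝ E]
  [NormedAddCommGroup E'] [NormedSpace ℝ E']
  {M : Type*} [TopologicalSpace M] [ChartedSpace E M] [IsManifold 𝓘(ℝ, E) ∞ M]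
  {P : Type*} [TopologicalSpace P] [ChartedSpace E' P] [IsManifold 𝓘(ℝ, E') ∞ P]

variable (E E') in
/-- The derivative of `φ` read in the charts at `x` and `φ x`. -/
def coordDeriv (φ : M → P) (x y : M) : E →L[ℝ] E' :=
  (coordMap (φ x) (φ y)).comp ((mfderiv 𝓘(ℝ, E) 𝓘(ℝ, E') φ y).comp (coordSymm x y))

lemma contMDiffOn_coordDeriv {φ : M → P} (hφ : ContMDiff 𝓘(ℝ, E) 𝓘(ℝ, E') ∞ φ) (x : M) :
    ContMDiffOn 𝓘(ℝ, E) 𝓘(ℝ, E →L[ℝ] E') ∞ (coordDeriv E E' φ x)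
      ((chartAt E x).source ∩ φ ⁻¹' (chartAt E' (φ x)).source) := by
  have hU : IsOpen ((chartAt E x).source ∩ φ ⁻¹' (chartAt E' (φ x)).source) :=
    (chartAt E x).open_source.inter ((chartAt E' (φ x)).open_source.preimage hφ.continuous)
  have hg : ContMDiffOn 𝓘(ℝ, E) 𝓘(ℝ, E') ∞ (extChartAt 𝓘(ℝ, E') (φ x) ∘ φ)
      ((chartAt E x).source ∩ φ ⁻¹' (chartAt E' (φ x)).source) :=
    (contMDiffOn_extChartAt (x := φ x)).comp hφ.contMDiffOn inter_subset_right
  refine (contMDiffOn_mvfderiv_comp_coordSymm hU inter_subset_left hg).congr fun y hy ↦ ?_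
  have h1 : MDifferentiableAt 𝓘(ℝ, E') 𝓘(ℝ, E') (extChartAt 𝓘(ℝ, E') (φ x)) (φ y) :=
    mdifferentiableAt_extChartAt hy.2
  have h := mfderiv_comp y h1 ((hφ y).mdifferentiableAt (by simp))
  rw [coordDeriv, coordMap_eq_mvfderiv hy.2]
  exact congrArg (fun f : TangentSpace 𝓘(ℝ, E) y →L[ℝ] E' ↦ f.comp (coordSymm x y)) h.symm

lemma coordDeriv_coordMap {φ : M → P} {x y : M} (hy : y ∈ (chartAt E x).source)
    (v : TangentSpace 𝓘(ℝ, E) y) :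
    coordDeriv E E' φ x y (coordMap x y v) =
      coordMap (φ x) (φ y) (mfderiv 𝓘(ℝ, E) 𝓘(ℝ, E') φ y v) := by
  simp [coordDeriv, coordSymm_coordMap hy]

lemma mfderiv_coordSymm {φ : M → P} {x y : M} (hy : φ y ∈ (chartAt E' (φ x)).source) (v : E) :
    mfderiv 𝓘(ℝ, E) 𝓘(ℝ, E') φ y (coordSymm x y v) =
      coordSymm (φ x) (φ y) (coordDeriv E E' φ x y v) := by
  simp [coordDeriv, coordSymm_coordMap hy]

lemma coordSymm_injective {x y : M} (hy : y ∈ (chartAt E x).source) :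
    Function.Injective (coordSymm (E := E) x y) :=
  Function.LeftInverse.injective (coordMap_coordSymm hy)

/-- Near a point where `φ` is submersive its derivative, read in charts, has a smooth right inverse
with constant image. -/
lemma exists_coordSection [FiniteDimensional ℝ E'] {φ : M → P}
    (hφ : ContMDiff 𝓘(ℝ, E) 𝓘(ℝ, E') ∞ φ) (x : M)
    (hs : Function.Surjective (mfderiv 𝓘(ℝ, E) 𝓘(ℝ, E') φ x)) :
    ∃ (U : Set M) (σ : M → E' →L[ℝ] E), IsOpen U ∧ x ∈ U ∧
      U ⊆ (chartAt E x).source ∩ φ ⁻¹' (chartAt E' (φ x)).source ∧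
      ContMDiffOn 𝓘(ℝ, E) 𝓘(ℝ, E' →L[ℝ] E) ∞ σ U ∧
      ∀ y ∈ U, (∀ w, coordDeriv E E' φ x y (σ y w) = w) ∧
        (∀ w, σ y (coordDeriv E E' φ x y (σ x w)) = σ x w) ∧ ∀ w, ∃ w', σ y w = σ x w' := by
  refine exists_smooth_rightInverse ?_ ?_ (contMDiffOn_coordDeriv hφ x) ?_
  · exact (chartAt E x).open_source.inter ((chartAt E' (φ x)).open_source.preimage hφ.continuous)
  · exact ⟨mem_chart_source E x, mem_chart_source E' (φ x)⟩
  · intro w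
    obtain ⟨v, hv⟩ := hs w
    refine ⟨coordMap x x v, ?_⟩
    rw [coordDeriv_coordMap (mem_chart_source E x), hv]
    exact coordMap_self (M := P) w

lemma smoothVFieldOn_coordSymm {x : M} {U : Set M} {w : M → E} (hU : IsOpen U)
    (hUx : U ⊆ (chartAt E x).source) (hw : ContMDiffOn 𝓘(ℝ, E) 𝓘(ℝ, E) ∞ w U) :
    SmoothVFieldOn (fun y ↦ coordSymm x y (w y)) U := by
  rw [smoothVFieldOn_iff hU hUx]
  exact hw.congr fun y hy ↦ coordMap_coordSymm (hUx hy) _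

end CoordDeriv

end DiracGeometry

namespace DiracGeometry

open Bundle Set Filter
open scoped Topology

/-! ### Local sections of submersions and functions constant on fibres -/

section Submersions

universe u

variable {E : Type u} {E' : Type*} [NormedAddCommGroup E] [NormedSpace ℝ E]
  [NormedAddCommGroup E'] [NormedSpace ℝ E']
  {M : Type*} [TopologicalSpace M] [ChartedSpace E M]
  {P : Type*} [TopologicalSpace P] [ChartedSpace E' P]
  {φ : M → P}

/-- Near every point a submersion is, in suitable charts, a linear projection. -/
lemma exists_submersion_charts (hφ : Manifold.IsSubmersion 𝓘(ℝ, E) 𝓘(ℝ, E') ∞ φ) (x : M) :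
    ∃ (F : Type u) (_ : NormedAddCommGroup F) (_ : NormedSpace ℝ F) (A : E ≃L[ℝ] E' × F)
      (e : OpenPartialHomeomorph M E) (e' : OpenPartialHomeomorph P E'),
      x ∈ e.source ∧ MapsTo φ e.source e'.source ∧
      ContMDiffOn 𝓘(ℝ, E) 𝓘(ℝ, E) ∞ e.symm e.target ∧
      ContMDiffOn 𝓘(ℝ, E') 𝓘(ℝ, E') ∞ e' e'.source ∧
      ∀ z ∈ e.target, e' (φ (e.symm z)) = (A z).1 := by
  have h := hφ.isSubmersionAt x
  refine ⟨h.complement, inferInstance, inferInstance, h.equiv, h.domChart, h.codChart,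
    h.mem_domChart_source, h.source_subset_preimage_source,
    contMDiffOn_symm_of_mem_maximalAtlas h.domChart_mem_maximalAtlas,
    contMDiffOn_of_mem_maximalAtlas h.codChart_mem_maximalAtlas, fun z hz ↦ ?_⟩
  simpa using h.writtenInCharts (by simpa using hz)

/-- A submersion has smooth local sections. -/
lemma exists_local_section (hφ : Manifold.IsSubmersion 𝓘(ℝ, E) 𝓘(ℝ, E') ∞ φ) (x : M) :
    ∃ (V : Set P) (σ : P → M), IsOpen V ∧ φ x ∈ V ∧ ContMDiffOn 𝓘(ℝ, E') 𝓘(ℝ, E) ∞ σ V ∧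
      σ (φ x) = x ∧ ∀ p ∈ V, φ (σ p) = p := by
  obtain ⟨F, _, _, A, e, e', hx, hmaps, he, he', heq⟩ := exists_submersion_charts hφ x
  -- In the product chart the section moves the base coordinate and freezes the fibre coordinate at
  -- its value at `x`.
  set τ : P → E := fun p ↦ A.symm (e' p, (A (e x)).2)
  have hτ : ContMDiffOn 𝓘(ℝ, E') 𝓘(ℝ, E) ∞ τ e'.source :=
    ContMDiffOn.comp (I' := 𝓘(ℝ, E')) (g := fun w ↦ A.symm (w, (A (e x)).2)) (t := univ)
      (ContDiff.contMDiff (A.symm.contDiff.comp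
        (contDiff_id.prodMk contDiff_const))).contMDiffOn he' (fun _ _ ↦ mem_univ _)
  have hτx : τ (φ x) = e x := by
    have := heq (e x) (e.map_source hx)
    rw [e.left_inv hx] at this
    simp only [τ, this]
    exact A.symm_apply_apply (e x)
  set V : Set P := e'.source ∩ τ ⁻¹' e.target
  refine ⟨V, fun p ↦ e.symm (τ p), hτ.continuousOn.isOpen_inter_preimage e'.open_source
    e.open_target, ⟨hmaps hx, ?_⟩, he.comp (hτ.mono inter_subset_left) inter_subset_right, ?_, ?_⟩
  · rw [mem_preimage, hτx]
    exact e.map_source hx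
  · simp only [hτx, e.left_inv hx]
  · intro p hp
    refine e'.injOn (hmaps (e.map_target hp.2)) hp.1 ?_
    rw [heq _ hp.2]
    simp [τ]

lemma surjective_mfderiv (hφ : Manifold.IsSubmersion 𝓘(ℝ, E) 𝓘(ℝ, E') ∞ φ) (x : M) :
    Function.Surjective (mfderiv 𝓘(ℝ, E) 𝓘(ℝ, E') φ x) := by
  obtain ⟨V, σ, hV, hxV, hσ, hσx, hφσ⟩ := exists_local_section hφ x
  have h1 : MDifferentiableAt 𝓘(ℝ, E') 𝓘(ℝ, E) σ (φ x) :=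
    (hσ.contMDiffAt (hV.mem_nhds hxV)).mdifferentiableAt (by simp)
  have h2 : MDifferentiableAt 𝓘(ℝ, E) 𝓘(ℝ, E') φ (σ (φ x)) :=
    (hφ.contMDiff _).mdifferentiableAt (by simp)
  have h3 := mfderiv_comp (φ x) h2 h1
  have h4 : φ ∘ σ =ᶠ[𝓝 (φ x)] id := by
    filter_upwards [hV.mem_nhds hxV] with p hp using hφσ p hp
  rw [h4.mfderiv_eq, mfderiv_id] at h3
  intro w
  have h5 := congrArg (fun f : TangentSpace 𝓘(ℝ, E') (φ x) →L[ℝ] E' ↦ f w) h3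
  have h6 : mfderiv 𝓘(ℝ, E) 𝓘(ℝ, E') φ (σ (φ x)) (mfderiv 𝓘(ℝ, E') 𝓘(ℝ, E) σ (φ x) w) = w :=
    h5.symm
  -- The equality `σ (φ x) = x` is only propositional, so the tangent vector is generalized before
  -- the base point is rewritten.
  revert h6
  generalize mfderiv 𝓘(ℝ, E') 𝓘(ℝ, E) σ (φ x) w = v
  revert v
  rw [hσx]
  exact fun v hv ↦ ⟨v, hv⟩

/-- A function which is infinitesimally constant along the fibres is locally so. -/
lemma eventually_eq_of_mvfderiv_ker (hφ : Manifold.IsSubmersion 𝓘(ℝ, E) 𝓘(ℝ, E') ∞ φ) {h : M → ℝ}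
    (hh : ContMDiff 𝓘(ℝ, E) 𝓘(ℝ, ℝ) ∞ h)
    (hk : ∀ x v, mfderiv 𝓘(ℝ, E) 𝓘(ℝ, E') φ x v = 0 → mvfderiv 𝓘(ℝ, E) h x v = 0) (x : M) :
    ∀ᶠ y in 𝓝 x, φ y = φ x → h y = h x := by
  obtain ⟨F, _, _, A, e, e', hx, hmaps, he, he', heq⟩ := exists_submersion_charts hφ x
  set c := A (e x)
  have hT : A.symm ⁻¹' e.target ∈ 𝓝 c :=
    A.symm.continuous.continuousAt.preimage_mem_nhds
      (by rw [A.symm_apply_apply]; exact e.open_target.mem_nhds (e.map_source hx))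
  obtain ⟨ε, hε, hball⟩ := Metric.mem_nhds_iff.1 hT
  have hc : ContinuousAt (fun y ↦ A (e y)) x :=
    A.continuous.continuousAt.comp (e.continuousAt hx)
  filter_upwards [e.open_source.mem_nhds hx, hc.preimage_mem_nhds (Metric.ball_mem_nhds c hε)]
    with y hy hyb hyx
  have h1 : ∀ y ∈ e.source, (A (e y)).1 = e' (φ y) := fun y hy ↦ by
    rw [← heq _ (e.map_source hy), e.left_inv hy]
  have hcy : (A (e y)).1 = c.1 := by rw [h1 y hy, hyx, ← h1 x hx]
  -- `γ` parametrizes the fibre through `x` near `x`. On a ball of `F`, which is convex, a function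
  -- with zero derivative is constant.
  set γ : F → M := fun w ↦ e.symm (A.symm (c.1, w))
  have hmem : ∀ w ∈ Metric.ball c.2 ε, A.symm (c.1, w) ∈ e.target := fun w hw ↦ by
    refine hball (?_ : (c.1, w) ∈ Metric.ball c ε)
    rw [Metric.mem_ball, Prod.dist_eq]
    simpa [hε] using hw
  have hγ : ContMDiffOn 𝓘(ℝ, F) 𝓘(ℝ, E) ∞ γ (Metric.ball c.2 ε) :=
    he.comp (ContDiff.contMDiff (A.symm.contDiff.comp
      (contDiff_const.prodMk contDiff_id))).contMDiffOn hmem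
  have hφγ : ∀ w ∈ Metric.ball c.2 ε, φ (γ w) = φ x := fun w hw ↦ by
    refine e'.injOn (hmaps (e.map_target (hmem w hw))) (hmaps hx) ?_
    rw [heq _ (hmem w hw), ← h1 x hx]
    simp [c]
  have hconst : ∀ w ∈ Metric.ball c.2 ε, fderiv ℝ (h ∘ γ) w = 0 := fun w hw ↦ by
    have hb : Metric.ball c.2 ε ∈ 𝓝 w := Metric.isOpen_ball.mem_nhds hw
    have d1 : MDifferentiableAt 𝓘(ℝ, F) 𝓘(ℝ, E) γ w :=
      (hγ.contMDiffAt hb).mdifferentiableAt (by simp)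
    have d2 := mfderiv_comp w ((hφ.contMDiff (γ w)).mdifferentiableAt (by simp)) d1
    have d3 : φ ∘ γ =ᶠ[𝓝 w] fun _ ↦ φ x := by
      filter_upwards [hb] with w' hw' using hφγ w' hw'
    have d4 := mvfderiv_comp w ((hh (γ w)).mdifferentiableAt (by simp)) d1
    have d5 : mvfderiv 𝓘(ℝ, F) (h ∘ γ) w = fderiv ℝ (h ∘ γ) w := mfderiv_eq_fderiv
    rw [← d5, d4]
    ext v
    refine hk _ _ ?_
    have d6 := congrArg (fun f : F →L[ℝ] E' ↦ f v) d2
    refine d6.symm.trans ?_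
    rw [d3.mfderiv_eq, mfderiv_const]
    rfl
  have hd : DifferentiableOn ℝ (h ∘ γ) (Metric.ball c.2 ε) := fun w hw ↦ by
    have := hh.comp_contMDiffOn hγ
    exact ((this.contMDiffAt (Metric.isOpen_ball.mem_nhds hw)).contDiffAt.differentiableAt
      (by simp)).differentiableWithinAt
  have hy2 : (A (e y)).2 ∈ Metric.ball c.2 ε := by
    have : dist (A (e y)) c < ε := hyb
    rw [Prod.dist_eq] at this
    exact (le_max_right _ _).trans_lt this
  have key := Metric.isOpen_ball.is_const_of_fderiv_eq_zero
    (convex_ball c.2 ε).isPreconnected hd hconst hy2 (Metric.mem_ball_self hε)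
  have e1 : γ (A (e y)).2 = y := by
    simp only [γ, ← hcy]
    rw [Prod.mk.eta, A.symm_apply_apply, e.left_inv hy]
  have e2 : γ c.2 = x := by
    simp only [γ]
    rw [Prod.mk.eta, A.symm_apply_apply, e.left_inv hx]
  simpa [e1, e2] using key

/-- A function which is infinitesimally constant along connected fibres is constant on them. -/
lemma eq_of_mvfderiv_ker (hφ : IsConnectedSubmersion E E' φ) {h : M → ℝ}
    (hh : ContMDiff 𝓘(ℝ, E) 𝓘(ℝ, ℝ) ∞ h)
    (hk : ∀ x v, mfderiv 𝓘(ℝ, E) 𝓘(ℝ, E') φ x v = 0 → mvfderiv 𝓘(ℝ, E) h x v = 0) {x y : M}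
    (hxy : φ x = φ y) : h x = h y := by
  have : PreconnectedSpace (φ ⁻¹' {φ y}) :=
    isPreconnected_iff_preconnectedSpace.1 (hφ.connected_fibres (φ y)).isPreconnected
  have hl : IsLocallyConstant (fun z : φ ⁻¹' {φ y} ↦ h z) := by
    rw [IsLocallyConstant.iff_eventually_eq]
    intro z
    have := eventually_eq_of_mvfderiv_ker hφ.submersion hh hk z
    filter_upwards [continuous_subtype_val.continuousAt.eventually this] with w hw
    exact hw ((show φ w = φ y from w.2).trans (show φ z = φ y from z.2).symm)
  exact hl.apply_eq_of_preconnectedSpace ⟨x, hxy⟩ ⟨y, rfl⟩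

end Submersions

end DiracGeometry

namespace DiracGeometry

open Bundle Set Filter
open scoped Topology

/-! ### Covectors as differentials of global functions -/

section TestFunctions

variable {E : Type*} [NormedAddCommGroup E] [NormedSpace ℝ E] [FiniteDimensional ℝ E]
  {M : Type*} [TopologicalSpace M] [T2Space M] [ChartedSpace E M] [IsManifold 𝓘(ℝ, E) ∞ M]

/-- A constant covector in a chart is, near the centre, the differential of a global function. -/
lemma exists_mvfderiv_eq_coord (p : M) (ε : E →L[ℝ] ℝ) :
    ∃ (f : M → ℝ) (V : Set M), ContMDiff 𝓘(ℝ, E) 𝓘(ℝ, ℝ) ∞ f ∧ IsOpen V ∧ p ∈ V ∧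
      V ⊆ (chartAt E p).source ∧ ∀ y ∈ V, mvfderiv 𝓘(ℝ, E) f y = ε.comp (coordMap p y) := by
  let ψ : SmoothBumpFunction 𝓘(ℝ, E) p := Classical.arbitrary _
  have hg : ContMDiffOn 𝓘(ℝ, E) 𝓘(ℝ, ℝ) ∞ (fun y ↦ ε (extChartAt 𝓘(ℝ, E) p y))
      (chartAt E p).source :=
    ε.contDiff.contMDiff.comp_contMDiffOn contMDiffOn_extChartAt
  obtain ⟨V, hV, hVo, hpV⟩ := eventually_nhds_iff.1 ψ.eventuallyEq_one
  refine ⟨fun y ↦ ψ y • ε (extChartAt 𝓘(ℝ, E) p y), V ∩ (chartAt E p).source,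
    ψ.contMDiff_smul hg, hVo.inter (chartAt E p).open_source, ⟨hpV, mem_chart_source E p⟩,
    inter_subset_right, fun y hy ↦ ?_⟩
  have h1 : (fun y ↦ ψ y • ε (extChartAt 𝓘(ℝ, E) p y)) =ᶠ[𝓝 y] ε ∘ extChartAt 𝓘(ℝ, E) p := by
    filter_upwards [hVo.mem_nhds hy.1] with z hz
    have : ψ z = 1 := hV z hz
    simp only [this, one_smul, Function.comp_apply]
  have h2 : MDifferentiableAt 𝓘(ℝ, E) 𝓘(ℝ, E) (extChartAt 𝓘(ℝ, E) p) y :=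
    mdifferentiableAt_extChartAt hy.2
  have h3 := mvfderiv_comp (I := 𝓘(ℝ, E)) y ε.mdifferentiableAt h2
  rw [mvfderiv_congr h1, coordMap_eq_mvfderiv hy.2, h3]
  have h4 : mvfderiv 𝓘(ℝ, E) ε (extChartAt 𝓘(ℝ, E) p y) = ε := ε.mfderiv_eq
  rw [h4]
  rfl

lemma exists_mvfderiv_eq (p : M) (η : TangentSpace 𝓘(ℝ, E) p →L[ℝ] ℝ) :
    ∃ f : M → ℝ, ContMDiff 𝓘(ℝ, E) 𝓘(ℝ, ℝ) ∞ f ∧ mvfderiv 𝓘(ℝ, E) f p = η := by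
  obtain ⟨f, V, hf, -, hp, -, h⟩ := exists_mvfderiv_eq_coord p (η.comp (coordSymm p p))
  refine ⟨f, hf, ?_⟩
  rw [h p hp]
  ext v
  exact congrArg η (coordSymm_coordMap (mem_chart_source E p) v)

omit [FiniteDimensional ℝ E] [T2Space M] [IsManifold 𝓘(ℝ, E) ∞ M] in
lemma eq_of_forall_covector {p : M} {u v : TangentSpace 𝓘(ℝ, E) p}
    (h : ∀ η : TangentSpace 𝓘(ℝ, E) p →L[ℝ] ℝ, η u = η v) : u = v := by
  by_contra huv
  obtain ⟨η, hη⟩ := SeparatingDual.exists_ne_zero (R := ℝ) (V := E)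
    (x := (show E from u) - (show E from v)) (sub_ne_zero.2 huv)
  refine hη ?_
  rw [map_sub]
  exact sub_eq_zero.2 (h η)

/-- A one-form is locally a smooth combination of coordinate differentials, and `ν` is linear on
each fibre. Hence smoothness of `ν` need only be tested on differentials of functions. -/
lemma smoothOneFormOn_apply_of_mvfderiv {ν : CotangentToTangent E M}
    (h : ∀ f : M → ℝ, ContMDiff 𝓘(ℝ, E) 𝓘(ℝ, ℝ) ∞ f →
      SmoothVFieldOn (fun x ↦ ν x (mvfderiv 𝓘(ℝ, E) f x)) univ)
    {ξ : OneForm E M} (hξ : SmoothOneFormOn ξ univ) :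
    SmoothVFieldOn (fun x ↦ ν x (ξ x)) univ := by
  refine .of_locally fun p _ ↦ ?_
  let b := Module.finBasis ℝ E
  choose f V hf hVo hpV hVs hfV using fun i ↦
    exists_mvfderiv_eq_coord p (LinearMap.toContinuousLinearMap (b.coord i))
  have hV : IsOpen ((⋂ i, V i) ∩ (chartAt E p).source) :=
    (isOpen_iInter_of_finite hVo).inter (chartAt E p).open_source
  refine ⟨_, hV, ⟨mem_iInter.2 hpV, mem_chart_source E p⟩, ?_⟩
  have hc := (smoothOneFormOn_iff hV inter_subset_right).1 (hξ.mono (subset_univ _))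
  have key : SmoothVFieldOn (fun y ↦ ∑ i, ((ξ y).comp (coordSymm p y)) (b i) •
      ν y (mvfderiv 𝓘(ℝ, E) (f i) y)) ((⋂ i, V i) ∩ (chartAt E p).source) := by
    refine ContMDiffOn.sum_section fun i _ ↦ ?_
    exact ContMDiffOn.smul_section (hc.clm_apply contMDiffOn_const)
      (ContMDiffOn.mono (h (f i) (hf i)) (subset_univ _))
  refine ContMDiffOn.congr key fun y hy ↦ ?_
  refine congrArg (TotalSpace.mk' E y) ?_
  simp only [← map_smul, ← map_sum]
  congr 1
  ext v
  have hy' := mem_iInter.1 hy.1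
  have h1 : ξ y v = ((ξ y).comp (coordSymm p y)) (coordMap p y v) :=
    congrArg (ξ y) (coordSymm_coordMap hy.2 v).symm
  have h2 := congrArg ((ξ y).comp (coordSymm p y)) (b.sum_repr (coordMap p y v))
  rw [map_sum] at h2
  rw [h1, ← h2]
  simp [hfV _ y (hy' _), mul_comm]

omit [FiniteDimensional ℝ E] [T2Space M] in
lemma IsBivectorField.contMDiff_poissonBracket {ν : CotangentToTangent E M}
    (hν : IsBivectorField ν) {f g : M → ℝ} (hf : ContMDiff 𝓘(ℝ, E) 𝓘(ℝ, ℝ) ∞ f)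
    (hg : ContMDiff 𝓘(ℝ, E) 𝓘(ℝ, ℝ) ∞ g) :
    ContMDiff 𝓘(ℝ, E) 𝓘(ℝ, ℝ) ∞ (poissonBracket ν f g) :=
  contMDiffOn_univ.1 <| (smoothOneFormOn_mvfderiv isOpen_univ hg.contMDiffOn).contMDiffOn_apply
    (hν.smooth _ (smoothOneFormOn_mvfderiv isOpen_univ hf.contMDiffOn))

end TestFunctions

/-! ### Dorfman brackets of lifts of Hamiltonian vector fields -/

section Jacobiator

variable {E E' : Type*} [NormedAddCommGroup E] [NormedSpace ℝ E]
  [NormedAddCommGroup E'] [NormedSpace ℝ E']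
  {M : Type*} [TopologicalSpace M] [ChartedSpace E M] [IsManifold 𝓘(ℝ, E) ∞ M]
  {P : Type*} [TopologicalSpace P] [ChartedSpace E' P] [IsManifold 𝓘(ℝ, E') ∞ P]
  {φ : M → P} {f g h : P → ℝ} {X Y Z k : VField E M} {x : M} {U : Set M}

omit [IsManifold 𝓘(ℝ, E) ∞ M] [IsManifold 𝓘(ℝ, E') ∞ P] in
lemma mvfderiv_comp_submersion (hφ : ContMDiff 𝓘(ℝ, E) 𝓘(ℝ, E') ∞ φ)
    (hf : ContMDiff 𝓘(ℝ, E') 𝓘(ℝ, ℝ) ∞ f) (x : M) :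
    mvfderiv 𝓘(ℝ, E) (f ∘ φ) x =
      (mvfderiv 𝓘(ℝ, E') f (φ x)).comp (mfderiv 𝓘(ℝ, E) 𝓘(ℝ, E') φ x) :=
  mvfderiv_comp x ((hf _).mdifferentiableAt (by simp)) ((hφ _).mdifferentiableAt (by simp))

/-- The section `(X, d (f ∘ φ))` of the generalized tangent bundle. -/
def pullbackSection (φ : M → P) (X : VField E M) (f : P → ℝ) : GenSection E M :=
  fun y ↦ (X y, mvfderiv 𝓘(ℝ, E) (f ∘ φ) y)

omit [IsManifold 𝓘(ℝ, E') ∞ P] in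
lemma SmoothVFieldOn.pullbackSection (hX : SmoothVFieldOn X U)
    (hφ : ContMDiff 𝓘(ℝ, E) 𝓘(ℝ, E') ∞ φ) (hf : ContMDiff 𝓘(ℝ, E') 𝓘(ℝ, ℝ) ∞ f) :
    SmoothGenSectionOn (pullbackSection φ X f) U :=
  ⟨hX, (smoothOneFormOn_mvfderiv isOpen_univ (hf.comp hφ).contMDiffOn).mono (subset_univ _)⟩

/-- On lifts of Hamiltonian vector fields the Dorfman bracket computes the Jacobiator. -/
lemma pairing_dorfman_pullbackSection {ν : CotangentToTangent E' P} (hν : IsBivectorField ν)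
    (hφ : ContMDiff 𝓘(ℝ, E) 𝓘(ℝ, E') ∞ φ)
    (hf : ContMDiff 𝓘(ℝ, E') 𝓘(ℝ, ℝ) ∞ f) (hg : ContMDiff 𝓘(ℝ, E') 𝓘(ℝ, ℝ) ∞ g)
    (hh : ContMDiff 𝓘(ℝ, E') 𝓘(ℝ, ℝ) ∞ h)
    (hX : SmoothVFieldOn X U) (hY : SmoothVFieldOn Y U) (hZ : SmoothVFieldOn Z U)
    (hXf : ∀ y ∈ U, mfderiv 𝓘(ℝ, E) 𝓘(ℝ, E') φ y (X y) = ν (φ y) (mvfderiv 𝓘(ℝ, E') f (φ y)))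
    (hYg : ∀ y ∈ U, mfderiv 𝓘(ℝ, E) 𝓘(ℝ, E') φ y (Y y) = ν (φ y) (mvfderiv 𝓘(ℝ, E') g (φ y)))
    (hZh : ∀ y ∈ U, mfderiv 𝓘(ℝ, E) 𝓘(ℝ, E') φ y (Z y) = ν (φ y) (mvfderiv 𝓘(ℝ, E') h (φ y)))
    (hU : IsOpen U) (hx : x ∈ U) :
    pairing (dorfman (pullbackSection φ X f) (pullbackSection φ Y g) x)
        (pullbackSection φ Z h x) =
      poissonBracket ν f (poissonBracket ν g h) (φ x)
        + poissonBracket ν g (poissonBracket ν h f) (φ x)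
        + poissonBracket ν h (poissonBracket ν f g) (φ x) := by
  have lift : ∀ {f g : P → ℝ} {X : VField E M}, ContMDiff 𝓘(ℝ, E') 𝓘(ℝ, ℝ) ∞ g →
      (∀ y ∈ U, mfderiv 𝓘(ℝ, E) 𝓘(ℝ, E') φ y (X y) = ν (φ y) (mvfderiv 𝓘(ℝ, E') f (φ y))) →
      ∀ y ∈ U, mvfderiv 𝓘(ℝ, E) (g ∘ φ) y (X y) = poissonBracket ν f g (φ y) := by
    intro f g X hg hX y hy
    rw [mvfderiv_comp_submersion hφ hg, ContinuousLinearMap.comp_apply, hX y hy]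
    rfl
  have lift2 : ∀ {f₁ f g : P → ℝ} {X Y : VField E M}, ContMDiff 𝓘(ℝ, E') 𝓘(ℝ, ℝ) ∞ f →
      ContMDiff 𝓘(ℝ, E') 𝓘(ℝ, ℝ) ∞ g →
      (∀ y ∈ U, mfderiv 𝓘(ℝ, E) 𝓘(ℝ, E') φ y (X y) = ν (φ y) (mvfderiv 𝓘(ℝ, E') f₁ (φ y))) →
      (∀ y ∈ U, mfderiv 𝓘(ℝ, E) 𝓘(ℝ, E') φ y (Y y) = ν (φ y) (mvfderiv 𝓘(ℝ, E') f (φ y))) →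
      mvfderiv 𝓘(ℝ, E) (fun y ↦ mvfderiv 𝓘(ℝ, E) (g ∘ φ) y (Y y)) x (X x) =
        poissonBracket ν f₁ (poissonBracket ν f g) (φ x) := by
    intro f₁ f g X Y hf hg hX hY
    rw [← lift (hν.contMDiff_poissonBracket hf hg) hX x hx]
    refine congrArg (fun F : TangentSpace 𝓘(ℝ, E) x →L[ℝ] ℝ ↦ F (X x)) (mvfderiv_congr ?_)
    filter_upwards [hU.mem_nhds hx] with y hy using lift hg hY y hy
  have anti : ∀ a b c : P → ℝ, poissonBracket ν a (poissonBracket ν b c) (φ x) =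
      - poissonBracket ν a (poissonBracket ν c b) (φ x) := by
    intro a b c
    have : poissonBracket ν b c = -poissonBracket ν c b := funext fun p ↦ hν.skew p _ _
    rw [this]
    simp only [poissonBracket, mvfderiv_neg]
    rfl
  rw [pairing_dorfman (hX.pullbackSection hφ hf) (hY.pullbackSection hφ hg)
    (hZ.pullbackSection hφ hh) hU hx]
  simp only [pullbackSection]
  rw [mvfderiv_mlieBracket (hh.comp hφ).contMDiffOn hX hY hU hx,
    mvfderiv_mlieBracket (hg.comp hφ).contMDiffOn hX hZ hU hx,
    mvfderiv_mlieBracket (hf.comp hφ).contMDiffOn hY hZ hU hx,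
    lift2 hg hh hXf hYg, lift2 hf hh hYg hXf, lift2 hh hg hXf hZh, lift2 hf hg hZh hXf,
    lift2 hh hf hYg hZh, lift2 hg hf hZh hYg]
  -- Nine iterated brackets occur. Those from derivatives of contractions cancel half of the six
  -- from Lie brackets; by skew-symmetry the other three form the Jacobiator.
  rw [anti f h g, anti g f h, anti h g f]
  ring

lemma SmoothVFieldOn.mk_zero (hk : SmoothVFieldOn k U) :
    SmoothGenSectionOn (E := E) (M := M) (fun y ↦ (k y, 0)) U := by
  refine ⟨hk, ?_⟩
  exact ContMDiffOn.mono (contMDiff_zeroSection ℝ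
    (fun x : M ↦ TangentSpace 𝓘(ℝ, E) x →L[ℝ] Trivial M ℝ x)).contMDiffOn (subset_univ _)

omit [IsManifold 𝓘(ℝ, E') ∞ P] in
/-- The Dorfman bracket with a vertical vector field computes a vertical derivative. -/
lemma pairing_dorfman_vertical
    (hφ : ContMDiff 𝓘(ℝ, E) 𝓘(ℝ, E') ∞ φ)
    (hf : ContMDiff 𝓘(ℝ, E') 𝓘(ℝ, ℝ) ∞ f) (hg : ContMDiff 𝓘(ℝ, E') 𝓘(ℝ, ℝ) ∞ g)
    (hk : SmoothVFieldOn k U) (hX : SmoothVFieldOn X U) (hY : SmoothVFieldOn Y U)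
    (hkφ : ∀ y ∈ U, mfderiv 𝓘(ℝ, E) 𝓘(ℝ, E') φ y (k y) = 0) (hU : IsOpen U) (hx : x ∈ U) :
    pairing (dorfman (fun y ↦ (k y, 0)) (pullbackSection φ X f) x) (pullbackSection φ Y g x) =
      mvfderiv 𝓘(ℝ, E) (fun y ↦ mvfderiv 𝓘(ℝ, E) (g ∘ φ) y (X y)) x (k x) := by
  have hk0 := hk.mk_zero
  have hk1 : ∀ {f : P → ℝ}, ContMDiff 𝓘(ℝ, E') 𝓘(ℝ, ℝ) ∞ f →
      mvfderiv 𝓘(ℝ, E) (fun y ↦ mvfderiv 𝓘(ℝ, E) (f ∘ φ) y (k y)) x = 0 := by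
    intro f hf
    have : (fun y ↦ mvfderiv 𝓘(ℝ, E) (f ∘ φ) y (k y)) =ᶠ[𝓝 x] fun _ ↦ 0 := by
      filter_upwards [hU.mem_nhds hx] with y hy
      rw [mvfderiv_comp_submersion hφ hf, ContinuousLinearMap.comp_apply, hkφ y hy, map_zero]
    rw [mvfderiv_congr this, mvfderiv_const]
  have hz : ∀ W : VField E M, mvfderiv 𝓘(ℝ, E)
      (fun y ↦ (0 : TangentSpace 𝓘(ℝ, E) y →L[ℝ] ℝ) (W y)) x = 0 := fun W ↦ by
    have : (fun y ↦ (0 : TangentSpace 𝓘(ℝ, E) y →L[ℝ] ℝ) (W y)) = fun _ ↦ 0 := rfl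
    rw [this, mvfderiv_const]
  rw [pairing_dorfman hk0 (hX.pullbackSection hφ hf) (hY.pullbackSection hφ hg) hU hx]
  simp only [pullbackSection]
  rw [mvfderiv_mlieBracket (hg.comp hφ).contMDiffOn hk hX hU hx,
    mvfderiv_mlieBracket (hf.comp hφ).contMDiffOn hk hY hU hx, hk1 hf, hk1 hg, hz, hz]
  have e0 : ∀ v : TangentSpace 𝓘(ℝ, E) x, (0 : TangentSpace 𝓘(ℝ, E) x →L[ℝ] ℝ) v = 0 :=
    fun _ ↦ rfl
  simp only [e0]
  ring

end Jacobiator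

end DiracGeometry

namespace DiracGeometry

open Bundle Set Filter
open scoped Topology

/-! ### Descent of a family to a Poisson structure on the base -/

section Descent

variable {E E' : Type*} [NormedAddCommGroup E] [NormedSpace ℝ E] [FiniteDimensional ℝ E]
  [NormedAddCommGroup E'] [NormedSpace ℝ E'] [FiniteDimensional ℝ E']
  {M : Type*} [TopologicalSpace M] [T2Space M] [ChartedSpace E M] [IsManifold 𝓘(ℝ, E) ∞ M]
  {P : Type*} [TopologicalSpace P] [T2Space P] [ChartedSpace E' P] [IsManifold 𝓘(ℝ, E') ∞ P]
  {φ : M → P} {Λ : Family E M}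

variable (E') in
/-- Every Hamiltonian one-form of the base of `φ` has local smooth lifts with values in `Λ`. -/
def HasHamiltonianLifts (φ : M → P) (Λ : Family E M) : Prop :=
  ∀ f : P → ℝ, ContMDiff 𝓘(ℝ, E') 𝓘(ℝ, ℝ) ∞ f → ∀ x, ∃ (U : Set M) (X : VField E M),
    IsOpen U ∧ x ∈ U ∧ SmoothVFieldOn X U ∧ ∀ y ∈ U, pullbackSection φ X f y ∈ Λ y

/-- The Poisson structure `ν` is induced by `Λ` under `φ`. -/
structure IsReduction (φ : M → P) (Λ : Family E M) (ν : CotangentToTangent E' P) : Prop where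
  poisson : IsPoissonBivector ν
  mfderiv_eq : ∀ x (u : TangentSpace 𝓘(ℝ, E) x) (η : TangentSpace 𝓘(ℝ, E') (φ x) →L[ℝ] ℝ),
    (u, η.comp (mfderiv 𝓘(ℝ, E) 𝓘(ℝ, E') φ x)) ∈ Λ x →
    mfderiv 𝓘(ℝ, E) 𝓘(ℝ, E') φ x u = ν (φ x) η
  exists_mem : ∀ x (η : TangentSpace 𝓘(ℝ, E') (φ x) →L[ℝ] ℝ), ∃ u : TangentSpace 𝓘(ℝ, E) x,
    (u, η.comp (mfderiv 𝓘(ℝ, E) 𝓘(ℝ, E') φ x)) ∈ Λ x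

omit [FiniteDimensional ℝ E] [T2Space M] [IsManifold 𝓘(ℝ, E) ∞ M] [FiniteDimensional ℝ E']
  [T2Space P]  [IsManifold 𝓘(ℝ, E') ∞ P] in
lemma mfderiv_eq_of_mem
    (hker : ∀ x (u : TangentSpace 𝓘(ℝ, E) x), (u, 0) ∈ Λ x → mfderiv 𝓘(ℝ, E) 𝓘(ℝ, E') φ x u = 0)
    {x : M} {u v : TangentSpace 𝓘(ℝ, E) x} {ξ : TangentSpace 𝓘(ℝ, E) x →L[ℝ] ℝ}
    (hu : (u, ξ) ∈ Λ x) (hv : (v, ξ) ∈ Λ x) :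
    mfderiv 𝓘(ℝ, E) 𝓘(ℝ, E') φ x u = mfderiv 𝓘(ℝ, E) 𝓘(ℝ, E') φ x v := by
  have h := (Λ x).sub_mem hu hv
  rw [Prod.mk_sub_mk, sub_self] at h
  rw [← sub_eq_zero, ← map_sub]
  exact hker x _ h

omit [FiniteDimensional ℝ E] [T2Space M] [FiniteDimensional ℝ E'] [T2Space P]
  [IsManifold 𝓘(ℝ, E') ∞ P] in
/-- The Hamiltonian bracket of two functions, computed upstairs, is constant on the fibres. -/
lemma exists_bracket_of_lifts (hφ : IsConnectedSubmersion E E' φ)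
    (hker : ∀ x (u : TangentSpace 𝓘(ℝ, E) x), (u, 0) ∈ Λ x → mfderiv 𝓘(ℝ, E) 𝓘(ℝ, E') φ x u = 0)
    (hlift : HasHamiltonianLifts E' φ Λ)
    (hvert : ∀ f g : P → ℝ, ContMDiff 𝓘(ℝ, E') 𝓘(ℝ, ℝ) ∞ f → ContMDiff 𝓘(ℝ, E') 𝓘(ℝ, ℝ) ∞ g →
      ∀ (U : Set M) (X : VField E M), IsOpen U → SmoothVFieldOn X U →
      (∀ y ∈ U, pullbackSection φ X f y ∈ Λ y) → ∀ x ∈ U, ∀ k : TangentSpace 𝓘(ℝ, E) x,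
      mfderiv 𝓘(ℝ, E) 𝓘(ℝ, E') φ x k = 0 →
      mvfderiv 𝓘(ℝ, E) (fun y ↦ mvfderiv 𝓘(ℝ, E) (g ∘ φ) y (X y)) x k = 0)
    {f g : P → ℝ} (hf : ContMDiff 𝓘(ℝ, E') 𝓘(ℝ, ℝ) ∞ f) (hg : ContMDiff 𝓘(ℝ, E') 𝓘(ℝ, ℝ) ∞ g) :
    ∃ H : M → ℝ, (∀ x y, φ x = φ y → H x = H y) ∧ ∀ x (u : TangentSpace 𝓘(ℝ, E) x),
      (u, mvfderiv 𝓘(ℝ, E) (f ∘ φ) x) ∈ Λ x → mvfderiv 𝓘(ℝ, E) (g ∘ φ) x u = H x := by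
  have hφs := hφ.submersion.contMDiff
  choose U X hU hxU hX hXΛ using hlift f hf
  have huniq : ∀ x (u v : TangentSpace 𝓘(ℝ, E) x), (u, mvfderiv 𝓘(ℝ, E) (f ∘ φ) x) ∈ Λ x →
      (v, mvfderiv 𝓘(ℝ, E) (f ∘ φ) x) ∈ Λ x →
      mvfderiv 𝓘(ℝ, E) (g ∘ φ) x u = mvfderiv 𝓘(ℝ, E) (g ∘ φ) x v := by
    intro x u v hu hv
    rw [mvfderiv_comp_submersion hφs hg]
    exact congrArg (mvfderiv 𝓘(ℝ, E') g (φ x)) (mfderiv_eq_of_mem hker hu hv)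
  -- `H` uses at each point the lift chosen for that point. By uniqueness it can be computed near
  -- `x` from the single lift `X x`, which gives smoothness and the vertical derivatives.
  let H : M → ℝ := fun x ↦ mvfderiv 𝓘(ℝ, E) (g ∘ φ) x (X x x)
  have hH : ∀ x y, y ∈ U x → H y = mvfderiv 𝓘(ℝ, E) (g ∘ φ) y (X x y) := fun x y hy ↦
    huniq y _ _ (hXΛ y y (hxU y)) (hXΛ x y hy)
  refine ⟨H, fun x y hxy ↦ eq_of_mvfderiv_ker hφ ?_ ?_ hxy,
    fun x u hu ↦ huniq x _ _ hu (hXΛ x x (hxU x))⟩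
  · intro x
    have h1 := ((smoothOneFormOn_mvfderiv isOpen_univ (hg.comp hφs).contMDiffOn).mono
      (subset_univ (U x))).contMDiffOn_apply (hX x)
    exact (h1.congr (hH x)).contMDiffAt ((hU x).mem_nhds (hxU x))
  · intro x k hk
    rw [mvfderiv_congr (g := fun y ↦ mvfderiv 𝓘(ℝ, E) (g ∘ φ) y (X x y))
      (by filter_upwards [(hU x).mem_nhds (hxU x)] with y hy using hH x y hy)]
    exact hvert f g hf hg (U x) (X x) (hU x) (hX x) (hXΛ x) x (hxU x) k hk

/-- A family with sufficiently many basic sections induces a Poisson structure on the base of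
a submersion with connected fibres. -/
theorem exists_isReduction_of_lifts (hφ : IsConnectedSubmersion E E' φ)
    (hiso : ∀ x, ∀ a ∈ Λ x, ∀ b ∈ Λ x, pairing a b = 0) (hinv : IsInvolutive Λ)
    (hker : ∀ x (u : TangentSpace 𝓘(ℝ, E) x), (u, 0) ∈ Λ x → mfderiv 𝓘(ℝ, E) 𝓘(ℝ, E') φ x u = 0)
    (hlift : HasHamiltonianLifts E' φ Λ)
    (hvert : ∀ f g : P → ℝ, ContMDiff 𝓘(ℝ, E') 𝓘(ℝ, ℝ) ∞ f → ContMDiff 𝓘(ℝ, E') 𝓘(ℝ, ℝ) ∞ g →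
      ∀ (U : Set M) (X : VField E M), IsOpen U → SmoothVFieldOn X U →
      (∀ y ∈ U, pullbackSection φ X f y ∈ Λ y) → ∀ x ∈ U, ∀ k : TangentSpace 𝓘(ℝ, E) x,
      mfderiv 𝓘(ℝ, E) 𝓘(ℝ, E') φ x k = 0 →
      mvfderiv 𝓘(ℝ, E) (fun y ↦ mvfderiv 𝓘(ℝ, E) (g ∘ φ) y (X y)) x k = 0) :
    ∃ ν : CotangentToTangent E' P, IsReduction φ Λ ν := by
  have hφs := hφ.submersion.contMDiff
  have hex : ∀ x (η : TangentSpace 𝓘(ℝ, E') (φ x) →L[ℝ] ℝ), ∃ u : TangentSpace 𝓘(ℝ, E) x,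
      (u, η.comp (mfderiv 𝓘(ℝ, E) 𝓘(ℝ, E') φ x)) ∈ Λ x := by
    intro x η
    obtain ⟨f, hf, rfl⟩ := exists_mvfderiv_eq (φ x) η
    obtain ⟨U, X, -, hxU, -, hX⟩ := hlift f hf x
    have := hX x hxU
    rw [pullbackSection, mvfderiv_comp_submersion hφs hf] at this
    exact ⟨_, this⟩
  -- `N` is defined by lifting at one point `x₀` of the fibre. That it works at every other point of
  -- the fibre is exactly the constancy of brackets.
  have hN : ∀ p : P, ∃ N : (TangentSpace 𝓘(ℝ, E') p →L[ℝ] ℝ) →ₗ[ℝ] TangentSpace 𝓘(ℝ, E') p,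
      ∀ f g : P → ℝ, ContMDiff 𝓘(ℝ, E') 𝓘(ℝ, ℝ) ∞ f → ContMDiff 𝓘(ℝ, E') 𝓘(ℝ, ℝ) ∞ g →
      ∀ x, φ x = p → ∀ u : TangentSpace 𝓘(ℝ, E) x, (u, mvfderiv 𝓘(ℝ, E) (f ∘ φ) x) ∈ Λ x →
        mvfderiv 𝓘(ℝ, E) (g ∘ φ) x u = mvfderiv 𝓘(ℝ, E') g p (N (mvfderiv 𝓘(ℝ, E') f p)) := by
    intro p
    obtain ⟨x₀, rfl⟩ := hφ.surjective p
    choose u hu using hex x₀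
    let N : (TangentSpace 𝓘(ℝ, E') (φ x₀) →L[ℝ] ℝ) →ₗ[ℝ] TangentSpace 𝓘(ℝ, E') (φ x₀) :=
      { toFun := fun η ↦ mfderiv 𝓘(ℝ, E) 𝓘(ℝ, E') φ x₀ (u η)
        map_add' := fun η ζ ↦ by
          rw [← map_add]
          exact mfderiv_eq_of_mem hker (hu _) ((Λ x₀).add_mem (hu η) (hu ζ))
        map_smul' := fun c η ↦ by
          rw [RingHom.id_apply, ← map_smul]
          exact mfderiv_eq_of_mem hker (hu _) ((Λ x₀).smul_mem c (hu η)) }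
    refine ⟨N, fun f g hf hg x hx v hv ↦ ?_⟩
    obtain ⟨H, hH, hHv⟩ := exists_bracket_of_lifts hφ hker hlift hvert hf hg
    rw [hHv x v hv, hH x x₀ hx, ← hHv x₀ (u (mvfderiv 𝓘(ℝ, E') f (φ x₀))),
      mvfderiv_comp_submersion hφs hg]
    · rfl
    · rw [mvfderiv_comp_submersion hφs hf]
      exact hu _
  choose ν hν using hN
  have hνeq : ∀ x (u : TangentSpace 𝓘(ℝ, E) x) (η : TangentSpace 𝓘(ℝ, E') (φ x) →L[ℝ] ℝ),
      (u, η.comp (mfderiv 𝓘(ℝ, E) 𝓘(ℝ, E') φ x)) ∈ Λ x →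
      mfderiv 𝓘(ℝ, E) 𝓘(ℝ, E') φ x u = ν (φ x) η := by
    intro x u η hu
    obtain ⟨f, hf, rfl⟩ := exists_mvfderiv_eq (φ x) η
    refine eq_of_forall_covector fun ζ ↦ ?_
    obtain ⟨g, hg, rfl⟩ := exists_mvfderiv_eq (φ x) ζ
    rw [← mvfderiv_comp_submersion hφs hf] at hu
    have h := hν (φ x) f g hf hg x rfl u hu
    rwa [mvfderiv_comp_submersion hφs hg] at h
  have hνX : ∀ {f : P → ℝ} {U : Set M} {X : VField E M}, ContMDiff 𝓘(ℝ, E') 𝓘(ℝ, ℝ) ∞ f →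
      (∀ y ∈ U, pullbackSection φ X f y ∈ Λ y) → ∀ y ∈ U,
      mfderiv 𝓘(ℝ, E) 𝓘(ℝ, E') φ y (X y) = ν (φ y) (mvfderiv 𝓘(ℝ, E') f (φ y)) := by
    intro f U X hf hX y hy
    refine hνeq y _ _ ?_
    rw [← mvfderiv_comp_submersion hφs hf]
    exact hX y hy
  have hb : IsBivectorField ν := by
    refine ⟨fun p ξ η ↦ ?_, fun ξ hξ ↦ smoothOneFormOn_apply_of_mvfderiv (fun f hf ↦ ?_) hξ⟩
    · obtain ⟨x, rfl⟩ := hφ.surjective p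
      obtain ⟨u, hu⟩ := hex x ξ
      obtain ⟨v, hv⟩ := hex x η
      rw [← hνeq x u ξ hu, ← hνeq x v η hv]
      have h := hiso x _ hu _ hv
      exact eq_neg_of_add_eq_zero_left h
    · refine .of_locally fun p _ ↦ ?_
      obtain ⟨x, rfl⟩ := hφ.surjective p
      obtain ⟨U, X, hU, hxU, hX, hXΛ⟩ := hlift f hf x
      -- Along a local section `σ`, the Hamiltonian field of `f` is the image under `φ` of the
      -- smooth lift `X`; this proves its smoothness.
      obtain ⟨V, σ, hV, hxV, hσ, hσx, hφσ⟩ := exists_local_section hφ.submersion x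
      let U' := U ∩ ((chartAt E x).source ∩ φ ⁻¹' (chartAt E' (φ x)).source)
      have hU' : IsOpen U' := hU.inter ((chartAt E x).open_source.inter
        ((chartAt E' (φ x)).open_source.preimage hφs.continuous))
      have hW : IsOpen ((V ∩ σ ⁻¹' U') ∩ (chartAt E' (φ x)).source) :=
        (hσ.continuousOn.isOpen_inter_preimage hV hU').inter (chartAt E' (φ x)).open_source
      refine ⟨_, hW, ⟨⟨hxV, ?_⟩, mem_chart_source E' (φ x)⟩, ?_⟩
      · simp only [mem_preimage, hσx]
        exact ⟨hxU, mem_chart_source E x, mem_chart_source E' (φ x)⟩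
      rw [smoothVFieldOn_iff hW inter_subset_right]
      have hc : ContMDiffOn 𝓘(ℝ, E) 𝓘(ℝ, E') ∞
          (fun y ↦ coordDeriv E E' φ x y (coordMap x y (X y))) U' :=
        ((contMDiffOn_coordDeriv hφs x).mono inter_subset_right).clm_apply
          ((smoothVFieldOn_iff hU' (inter_subset_right.trans inter_subset_left)).1
            (hX.mono inter_subset_left))
      have hc' := hc.comp (hσ.mono (inter_subset_left.trans inter_subset_left))
        (fun p hp ↦ hp.1.2 : (V ∩ σ ⁻¹' U') ∩ (chartAt E' (φ x)).source ⊆ σ ⁻¹' U')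
      refine hc'.congr fun p hp ↦ ?_
      have hσp : σ p ∈ U' := hp.1.2
      rw [Function.comp_apply, coordDeriv_coordMap hσp.2.1, hνX hf hXΛ _ hσp.1]
      exact congrArg (fun q ↦ (coordMap (φ x) q (ν q (mvfderiv 𝓘(ℝ, E') f q)) : E'))
        (hφσ p hp.1.1).symm
  refine ⟨ν, ⟨hb, fun f g h hf hg hh p ↦ ?_⟩, hνeq, hex⟩
  obtain ⟨x, rfl⟩ := hφ.surjective p
  obtain ⟨U, X, hU, hxU, hX, hXΛ⟩ := hlift f hf x
  obtain ⟨V, Y, hV, hxV, hY, hYΛ⟩ := hlift g hg x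
  obtain ⟨W, Z, hW, hxW, hZ, hZΛ⟩ := hlift h hh x
  have hX' := hX.mono (inter_subset_left.trans inter_subset_left : U ∩ V ∩ W ⊆ U)
  have hY' := hY.mono (inter_subset_left.trans inter_subset_right : U ∩ V ∩ W ⊆ V)
  have hZ' := hZ.mono (inter_subset_right : U ∩ V ∩ W ⊆ W)
  have hO : IsOpen (U ∩ V ∩ W) := (hU.inter hV).inter hW
  have hxO : x ∈ U ∩ V ∩ W := ⟨⟨hxU, hxV⟩, hxW⟩
  rw [← pairing_dorfman_pullbackSection hb hφs hf hg hh hX' hY' hZ'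
    (fun y hy ↦ hνX hf hXΛ y hy.1.1) (fun y hy ↦ hνX hg hYΛ y hy.1.2)
    (fun y hy ↦ hνX hh hZΛ y hy.2) hO hxO]
  exact hiso x _ (hinv.dorfman_mem (hX'.pullbackSection hφs hf) (fun y hy ↦ hXΛ y hy.1.1)
    (hY'.pullbackSection hφs hg) (fun y hy ↦ hYΛ y hy.1.2) hO hxO) _ (hZΛ x hxW)

end Descent

end DiracGeometry

namespace DiracGeometry

open Bundle Set Filter
open scoped Topology

/-! ### Smooth vertical projections and vertical vector fields -/

section Vertical

variable {E E' : Type*} [NormedAddCommGroup E] [NormedSpace ℝ E]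
  [NormedAddCommGroup E'] [NormedSpace ℝ E'] [FiniteDimensional ℝ E']
  {M : Type*} [TopologicalSpace M] [ChartedSpace E M] [IsManifold 𝓘(ℝ, E) ∞ M]
  {P : Type*} [TopologicalSpace P] [ChartedSpace E' P] [IsManifold 𝓘(ℝ, E') ∞ P]
  {φ : M → P}

/-- Near a point where `φ` is submersive there is a smooth projection to its vertical bundle. -/
lemma exists_verticalProjection (hφ : ContMDiff 𝓘(ℝ, E) 𝓘(ℝ, E') ∞ φ) (x : M)
    (hs : Function.Surjective (mfderiv 𝓘(ℝ, E) 𝓘(ℝ, E') φ x)) :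
    ∃ (U : Set M) (n : M → E →L[ℝ] E) (σ : E' →L[ℝ] E), IsOpen U ∧ x ∈ U ∧
      U ⊆ (chartAt E x).source ∩ φ ⁻¹' (chartAt E' (φ x)).source ∧
      ContMDiffOn 𝓘(ℝ, E) 𝓘(ℝ, E →L[ℝ] E) ∞ n U ∧
      (∀ y ∈ U, ∀ v, mfderiv 𝓘(ℝ, E) 𝓘(ℝ, E') φ y (coordSymm x y (n y v)) = 0) ∧
      (∀ y ∈ U, ∀ v, mfderiv 𝓘(ℝ, E) 𝓘(ℝ, E') φ y (coordSymm x y v) = 0 → n y v = v) ∧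
      ∀ v, n x v = v - σ (coordDeriv E E' φ x x v) := by
  obtain ⟨U, σ, hU, hx, hUx, hσ, h⟩ := exists_coordSection hφ x hs
  refine ⟨U, fun y ↦ 1 - (σ y).comp (coordDeriv E E' φ x y), σ x, hU, hx, hUx, ?_, ?_, ?_, ?_⟩
  · exact contMDiffOn_const.sub (hσ.clm_comp ((contMDiffOn_coordDeriv hφ x).mono hUx))
  · intro y hy v
    rw [mfderiv_coordSymm (hUx hy).2]
    have : coordDeriv E E' φ x y ((1 - (σ y).comp (coordDeriv E E' φ x y)) v) = 0 := by
      rw [_root_.sub_apply, map_sub, ContinuousLinearMap.comp_apply, (h y hy).1]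
      exact sub_self _
    rw [this, map_zero]
  · intro y hy v hv
    rw [mfderiv_coordSymm (hUx hy).2] at hv
    have : coordDeriv E E' φ x y v = 0 :=
      coordSymm_injective (E := E') (hUx hy).2 (hv.trans (map_zero _).symm)
    simp [this]
  · intro v
    rfl

/-- The constant extension of `k` in the chart is made vertical by the smooth vertical projection,
which fixes `k` at `x`. -/
lemma exists_vertical_extension (hφ : ContMDiff 𝓘(ℝ, E) 𝓘(ℝ, E') ∞ φ) (x : M)
    (hs : Function.Surjective (mfderiv 𝓘(ℝ, E) 𝓘(ℝ, E') φ x)) {k : TangentSpace 𝓘(ℝ, E) x}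
    (hk : mfderiv 𝓘(ℝ, E) 𝓘(ℝ, E') φ x k = 0) :
    ∃ (U : Set M) (K : VField E M), IsOpen U ∧ x ∈ U ∧ SmoothVFieldOn K U ∧ K x = k ∧
      ∀ y ∈ U, mfderiv 𝓘(ℝ, E) 𝓘(ℝ, E') φ y (K y) = 0 := by
  obtain ⟨U, n, -, hU, hx, hUx, hn, hn0, hn1, -⟩ := exists_verticalProjection hφ x hs
  refine ⟨U, fun y ↦ coordSymm x y (n y (coordMap x x k)), hU, hx, ?_, ?_, fun y hy ↦ hn0 y hy _⟩
  · exact smoothVFieldOn_coordSymm hU (hUx.trans inter_subset_left)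
      (hn.clm_apply contMDiffOn_const)
  · have h := coordSymm_coordMap (mem_chart_source E x) k
    have h1 := hn1 x hx (coordMap x x k) (by rw [h, hk])
    simp only [h1, h]

end Vertical

/-! ### Linear algebra of Lagrangian families -/

section Lagrangian

variable {E : Type*} [NormedAddCommGroup E] [NormedSpace ℝ E]
  {M : Type*} [TopologicalSpace M] [ChartedSpace E M] {L : Family E M}

lemma IsLagrangian.pairing_eq_zero (hL : IsLagrangian L) {x : M} {a b : GenTangent E x}
    (ha : a ∈ L x) (hb : b ∈ L x) : pairing a b = 0 :=
  (hL x a).1 ha b hb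

lemma IsLagrangian.apply_kernel (hL : IsLagrangian L) {x : M} {a : GenTangent E x}
    (ha : a ∈ L x) {u : TangentSpace 𝓘(ℝ, E) x} (hu : u ∈ kernel L x) : a.2 u = 0 := by
  have h := hL.pairing_eq_zero (b := (u, 0)) ha hu
  simp only [pairing] at h
  exact (zero_add _).symm.trans h

/-- A covector annihilating the kernel of a Lagrangian family is a covector component. -/
lemma IsLagrangian.exists_mem [FiniteDimensional ℝ E] (hL : IsLagrangian L) {x : M}
    {ξ : TangentSpace 𝓘(ℝ, E) x →L[ℝ] ℝ} (hξ : ∀ u ∈ kernel L x, ξ u = 0) :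
    ∃ u, (u, ξ) ∈ L x := by
  by_contra hcon
  have hnot : ξ ∉ (L x).map (LinearMap.snd ℝ (TangentSpace 𝓘(ℝ, E) x)
      (TangentSpace 𝓘(ℝ, E) x →L[ℝ] ℝ)) := by
    rintro ⟨⟨u, ζ⟩, hu, rfl⟩
    exact hcon ⟨u, hu⟩
  obtain ⟨F, hF, hle⟩ := Submodule.exists_le_ker_of_notMem hnot
  have : FiniteDimensional ℝ (TangentSpace 𝓘(ℝ, E) x) := inferInstanceAs (FiniteDimensional ℝ E)
  let T : Module.Dual ℝ E →ₗ[ℝ] (E →L[ℝ] ℝ) := LinearMap.toContinuousLinearMap.toLinearMap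
  -- By reflexivity the separating functional `F` is evaluation at a vector `v`. As `F` kills all
  -- covector parts of `L`, the vector `v` is orthogonal to `L`, hence lies in the kernel, where `ξ`
  -- vanishes.
  let v : E := (Module.evalEquiv ℝ E).symm (F ∘ₗ T)
  have hv : ∀ ζ : E →L[ℝ] ℝ, F ζ = ζ v := by
    intro ζ
    have h1 := congrArg (fun G : Module.Dual ℝ (Module.Dual ℝ E) ↦ G ζ.toLinearMap)
      ((Module.evalEquiv ℝ E).apply_symm_apply (F ∘ₗ T))
    exact h1.symm
  refine hF ((hv ξ).trans (hξ v ?_))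
  refine (hL x (v, 0)).2 fun b hb ↦ ?_
  have h0 : F b.2 = 0 := hle ⟨b, hb, rfl⟩
  have h1 : b.2 v = 0 := (hv b.2).symm.trans h0
  simp only [pairing]
  rw [h1]
  exact zero_add _

end Lagrangian

/-! ### Smooth solutions of linear equations -/

section Coefficients

variable {E : Type*} [NormedAddCommGroup E] [NormedSpace ℝ E]
  {M : Type*} [TopologicalSpace M] [ChartedSpace E M]
  {W : Type*} [NormedAddCommGroup W] [NormedSpace ℝ W] [FiniteDimensional ℝ W]

/-- A smooth family of linear equations which is solvable at a point is smoothly solvable nearby. -/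
lemma exists_smooth_coefficients {k : ℕ} {ξ : Fin k → M → W} {N : M → W →L[ℝ] W} {β : M → W}
    {U : Set M} {x : M} (hU : IsOpen U) (hx : x ∈ U)
    (hξ : ∀ i, ContMDiffOn 𝓘(ℝ, E) 𝓘(ℝ, W) ∞ (ξ i) U)
    (hN : ContMDiffOn 𝓘(ℝ, E) 𝓘(ℝ, W →L[ℝ] W) ∞ N U)
    (hβ : ContMDiffOn 𝓘(ℝ, E) 𝓘(ℝ, W) ∞ β U)
    (hs : ∀ w, ∃ (c : Fin k → ℝ) (z : W), ∑ i, c i • ξ i x + N x z = w) :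
    ∃ (U' : Set M) (c : Fin k → M → ℝ) (z : M → W), IsOpen U' ∧ x ∈ U' ∧ U' ⊆ U ∧
      (∀ i, ContMDiffOn 𝓘(ℝ, E) 𝓘(ℝ, ℝ) ∞ (c i) U') ∧
      ∀ y ∈ U', ∑ i, c i y • ξ i y + N y (z y) = β y := by
  let pr : Fin k → ((Fin k → ℝ) × W →L[ℝ] ℝ) := fun i ↦
    (ContinuousLinearMap.proj i).comp (ContinuousLinearMap.fst ℝ (Fin k → ℝ) W)
  let ψ : M → (Fin k → ℝ) × W →L[ℝ] W := fun y ↦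
    ∑ i, ContinuousLinearMap.smulRightL ℝ ((Fin k → ℝ) × W) W (pr i) (ξ i y) +
      (N y).comp (ContinuousLinearMap.snd ℝ (Fin k → ℝ) W)
  have hψ : ContMDiffOn 𝓘(ℝ, E) 𝓘(ℝ, (Fin k → ℝ) × W →L[ℝ] W) ∞ ψ U := by
    refine ContMDiffOn.add (contMDiffOn_finsetSum fun i _ ↦ ?_) (hN.clm_comp contMDiffOn_const)
    exact (ContinuousLinearMap.contDiff _).contMDiff.comp_contMDiffOn (hξ i)
  have hψv : ∀ y c, ψ y c = ∑ i, c.1 i • ξ i y + N y c.2 := by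
    intro y c
    simp [ψ, pr]
  have hsx : Function.Surjective (ψ x) := fun w ↦ by
    obtain ⟨c, z, h⟩ := hs w
    exact ⟨(c, z), (hψv x _).trans h⟩
  obtain ⟨U', ρ, hU', hx', hUU, hρ, h⟩ := exists_smooth_rightInverse hU hx hψ hsx
  refine ⟨U', fun i y ↦ (ρ y (β y)).1 i, fun y ↦ (ρ y (β y)).2, hU', hx', hUU, fun i ↦ ?_,
    fun y hy ↦ ?_⟩
  · exact (pr i).contDiff.contMDiff.comp_contMDiffOn (hρ.clm_apply (hβ.mono hUU))
  · rw [← hψv y (ρ y (β y)), (h y hy).1]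

end Coefficients

/-! ### Lifting one-forms to sections of a Dirac structure -/

section Lift

variable {E E' : Type*} [NormedAddCommGroup E] [NormedSpace ℝ E] [FiniteDimensional ℝ E]
  [NormedAddCommGroup E'] [NormedSpace ℝ E'] [FiniteDimensional ℝ E']
  {M : Type*} [TopologicalSpace M] [ChartedSpace E M] [IsManifold 𝓘(ℝ, E) ∞ M]
  {P : Type*} [TopologicalSpace P] [ChartedSpace E' P] [IsManifold 𝓘(ℝ, E') ∞ P]
  {φ : M → P} {L : Family E M}

/-- If the kernel of a Dirac structure is the vertical bundle of a submersion, then every smooth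
one-form annihilating the kernel is locally the covector component of a smooth section. -/
theorem IsDirac.exists_lift (hL : IsDirac L) (hφ : ContMDiff 𝓘(ℝ, E) 𝓘(ℝ, E') ∞ φ) {x : M}
    (hs : Function.Surjective (mfderiv 𝓘(ℝ, E) 𝓘(ℝ, E') φ x))
    (hk : ∀ y, (mfderiv 𝓘(ℝ, E) 𝓘(ℝ, E') φ y).ker = kernel L y) {α : OneForm E M}
    (hα : SmoothOneFormOn α univ) (hα0 : ∀ y, ∀ u ∈ kernel L y, α y u = 0) :
    ∃ (U : Set M) (X : VField E M), IsOpen U ∧ x ∈ U ∧ SmoothVFieldOn X U ∧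
      ∀ y ∈ U, (X y, α y) ∈ L y := by
  obtain ⟨U₁, n, σ, hU₁, hx₁, hUx, hn, hn0, hn1, hnx⟩ := exists_verticalProjection hφ x hs
  obtain ⟨U₂, k, s, hU₂, hx₂, hsm, hspan⟩ := hL.subbundle x
  have hU : IsOpen (U₁ ∩ U₂) := hU₁.inter hU₂
  have hUc : U₁ ∩ U₂ ⊆ (chartAt E x).source :=
    inter_subset_left.trans (hUx.trans inter_subset_left)
  have hξ := fun i ↦ (smoothOneFormOn_iff hU hUc).1 ((hsm i).2.mono inter_subset_right)
  have hα' := (smoothOneFormOn_iff hU hUc).1 (hα.mono (subset_univ _))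
  have hN : ContMDiffOn 𝓘(ℝ, E) 𝓘(ℝ, (E →L[ℝ] ℝ) →L[ℝ] (E →L[ℝ] ℝ)) ∞
      (fun y ↦ (ContinuousLinearMap.compL ℝ E E ℝ).flip (n y)) (U₁ ∩ U₂) :=
    (ContinuousLinearMap.contDiff _).contMDiff.comp_contMDiffOn (hn.mono inter_subset_left)
  -- The covector parts of the frame span only the annihilator of the kernel. The extra term `z ∘ n`
  -- makes the system surjective: `w` splits as `w ∘ σ ∘ D`, which annihilates the kernel, plus `w ∘
  -- n`.
  have hsolve : ∀ w : E →L[ℝ] ℝ, ∃ (c : Fin k → ℝ) (z : E →L[ℝ] ℝ),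
      ∑ i, c i • ((s i x).2).comp (coordSymm x x) +
        (ContinuousLinearMap.compL ℝ E E ℝ).flip (n x) z = w := by
    intro w
    obtain ⟨u, hu⟩ := hL.lagrangian.exists_mem
      (ξ := (w.comp (σ.comp (coordDeriv E E' φ x x))).comp (coordMap x x)) fun u hu ↦ by
        rw [← hk x] at hu
        have h1 : coordDeriv E E' φ x x (coordMap x x u) = 0 := by
          rw [coordDeriv_coordMap (mem_chart_source E x)]
          exact (congrArg _ hu).trans (map_zero _)
        simp [h1]
    rw [← (hspan x hx₂).2, Submodule.mem_span_range_iff_exists_fun] at hu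
    obtain ⟨c, hc⟩ := hu
    refine ⟨c, w, ?_⟩
    ext v
    have h2 := congrArg (fun a : GenTangent E x ↦ a.2 (coordSymm x x v)) hc
    simp only [Prod.snd_sum, Prod.smul_snd] at h2
    simp only [ContinuousLinearMap.comp_apply, coordMap_coordSymm (mem_chart_source E x)] at h2
    have h3 : w (n x v) = w v - w (σ (coordDeriv E E' φ x x v)) := by rw [hnx, map_sub]
    simp only [_root_.add_apply, _root_.sum_apply, _root_.smul_apply] at h2 ⊢
    refine (congrArg₂ (· + ·) h2 h3).trans ?_
    ring
  obtain ⟨U', c, z, hU', hx', hUU, hc, hz⟩ :=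
    exists_smooth_coefficients hU ⟨hx₁, hx₂⟩ hξ hN hα' hsolve
  have hmem : ∀ y ∈ U', ∀ i, s i y ∈ L y := fun y hy i ↦ by
    rw [← (hspan y (hUU hy).2).2]
    exact Submodule.subset_span ⟨i, rfl⟩
  refine ⟨U', fun y ↦ ∑ i, c i y • (s i y).1, hU', hx', ?_, fun y hy ↦ ?_⟩
  · exact ContMDiffOn.sum_section fun i _ ↦ ContMDiffOn.smul_section (hc i)
      ((hsm i).1.mono (hUU.trans inter_subset_right))
  have hyc := hUc (hUU hy)
  have hnker : ∀ v, coordSymm x y (n y v) ∈ kernel L y := fun v ↦ by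
    rw [← hk y]
    exact hn0 y (hUU hy).1 v
  -- The extra term vanishes in the solution: `α` and the covector parts of the frame kill vertical
  -- vectors, so `z ∘ n` does too, and `n` is idempotent.
  have hzn : ∀ v, z y (n y v) = 0 := by
    intro v
    have h1 := congrArg (fun f : E →L[ℝ] ℝ ↦ f (n y v)) (hz y hy)
    simp only [_root_.add_apply, _root_.sum_apply, _root_.smul_apply,
      ContinuousLinearMap.comp_apply, hα0 y _ (hnker v),
      hL.lagrangian.apply_kernel (hmem y hy _) (hnker v), smul_zero, Finset.sum_const_zero,
      zero_add] at h1
    have h2 : n y (n y v) = n y v := hn1 y (hUU hy).1 _ (hn0 y (hUU hy).1 v)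
    have h3 : z y (n y (n y v)) = 0 := h1
    rwa [h2] at h3
  have hα1 : α y = ∑ i, c i y • (s i y).2 := by
    ext v
    have h1 := congrArg (fun f : E →L[ℝ] ℝ ↦ f (coordMap x y v)) (hz y hy)
    simp only [_root_.add_apply, _root_.sum_apply, _root_.smul_apply,
      ContinuousLinearMap.comp_apply, coordSymm_coordMap hyc] at h1
    have h2 : (ContinuousLinearMap.compL ℝ E E ℝ).flip (n y) (z y) (coordMap x y v) = 0 := hzn _
    rw [h2, add_zero] at h1
    rw [← h1]
    simp only [_root_.sum_apply, _root_.smul_apply]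
  have : ((∑ i, c i y • (s i y).1, α y) : GenTangent E y) = ∑ i, c i y • s i y := by
    rw [hα1]
    ext1 <;> simp [Prod.fst_sum, Prod.snd_sum]
  rw [this]
  exact (L y).sum_mem fun i _ ↦ (L y).smul_mem _ (hmem y hy i)

end Lift

end DiracGeometry

namespace DiracGeometry

open Bundle Set Filter
open scoped Topology

/-! ### Involutivity tested on frames -/

section Involutivity

variable {E : Type*} [NormedAddCommGroup E] [NormedSpace ℝ E]
  {M : Type*} [TopologicalSpace M] [ChartedSpace E M]

lemma IsLagrangian.mem_of_span {L : Family E M} (hL : IsLagrangian L) {x : M} {ι : Type*}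
    {s : ι → GenTangent E x} (hs : Submodule.span ℝ (range s) = L x) {w : GenTangent E x}
    (hw : ∀ i, pairing w (s i) = 0) : w ∈ L x := by
  refine (hL x w).2 fun b hb ↦ ?_
  rw [← hs] at hb
  induction hb using Submodule.span_induction with
  | mem b hb => obtain ⟨i, rfl⟩ := hb; exact hw i
  | zero => simp [pairing]
  | add b c _ _ hb hc =>
    have : pairing w (b + c) = pairing w b + pairing w c := by
      simp only [pairing, Prod.snd_add, Prod.fst_add, map_add, _root_.add_apply]
      ring
    rw [this, hb, hc, add_zero]
  | smul t b _ hb =>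
    have : pairing w (t • b) = t * pairing w b := by
      simp only [pairing, Prod.smul_snd, Prod.smul_fst, map_smul, _root_.smul_apply, smul_eq_mul]
      ring
    rw [this, hb, mul_zero]

variable [IsManifold 𝓘(ℝ, E) ∞ M]

/-- Sections of `L` pair to zero, so their contractions are skew-symmetric near `x`, and the
expansion of `pairing_dorfman` becomes cyclic. This lets any argument be rotated into the last slot,
which depends only on its value at the point. -/
lemma IsLagrangian.pairing_dorfman_cyclic {L : Family E M} (hL : IsLagrangian L)
    {a b c : GenSection E M} {U : Set M} {x : M}
    (ha : SmoothGenSectionOn a U) (haL : ∀ y ∈ U, a y ∈ L y)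
    (hb : SmoothGenSectionOn b U) (hbL : ∀ y ∈ U, b y ∈ L y)
    (hc : SmoothGenSectionOn c U) (hcL : ∀ y ∈ U, c y ∈ L y) (hU : IsOpen U) (hx : x ∈ U) :
    pairing (dorfman a b x) (c x) = pairing (dorfman b c x) (a x) := by
  have hD : ∀ {a c : GenSection E M}, (∀ y ∈ U, a y ∈ L y) → (∀ y ∈ U, c y ∈ L y) →
      mvfderiv 𝓘(ℝ, E) (fun y ↦ (a y).2 (c y).1) x =
        - mvfderiv 𝓘(ℝ, E) (fun y ↦ (c y).2 (a y).1) x := by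
    intro a c ha hc
    rw [← mvfderiv_neg]
    refine mvfderiv_congr ?_
    filter_upwards [hU.mem_nhds hx] with y hy
    have h := hL.pairing_eq_zero (hc y hy) (ha y hy)
    exact eq_neg_of_add_eq_zero_left h
  rw [pairing_dorfman ha hb hc hU hx, pairing_dorfman hb hc ha hU hx, hD hcL haL, hD hbL haL,
    VectorField.mlieBracket_swap_apply (V := fun y ↦ (b y).1) (W := fun y ↦ (a y).1),
    VectorField.mlieBracket_swap_apply (V := fun y ↦ (c y).1) (W := fun y ↦ (a y).1)]
  simp only [map_neg, _root_.neg_apply]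
  ring

/-- Involutivity can be checked on frames. -/
lemma IsLagrangian.isInvolutive_of_frame {L : Family E M} (hL : IsLagrangian L)
    (h : ∀ x, ∃ (U : Set M) (k : ℕ) (s : Fin k → GenSection E M), IsOpen U ∧ x ∈ U ∧
      (∀ i, SmoothGenSectionOn (s i) U) ∧
      (∀ y ∈ U, Submodule.span ℝ (range fun i ↦ s i y) = L y) ∧
      ∀ i j l, pairing (dorfman (s i) (s j) x) (s l x) = 0) : IsInvolutive L := by
  intro a ha b hb x
  obtain ⟨U, k, s, hU, hx, hs, hspan, hzero⟩ := h x
  have hsL : ∀ i, ∀ y ∈ U, s i y ∈ L y := fun i y hy ↦ by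
    rw [← hspan y hy]
    exact Submodule.subset_span ⟨i, rfl⟩
  have ha' : SmoothGenSectionOn a U := ⟨ha.1.1.mono (subset_univ _), ha.1.2.mono (subset_univ _)⟩
  have hb' : SmoothGenSectionOn b U := ⟨hb.1.1.mono (subset_univ _), hb.1.2.mono (subset_univ _)⟩
  have haL : ∀ y ∈ U, a y ∈ L y := fun y _ ↦ ha.2 y
  have hbL : ∀ y ∈ U, b y ∈ L y := fun y _ ↦ hb.2 y
  -- Each rotation moves one more argument to the last slot, where it can be tested on the frame; no
  -- coefficient functions or Leibniz rule are needed.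
  refine hL.mem_of_span (hspan x hx) fun l ↦ ?_
  rw [hL.pairing_dorfman_cyclic ha' haL hb' hbL (hs l) (hsL l) hU hx]
  refine hL.pairing_eq_zero (hL.mem_of_span (hspan x hx) fun j ↦ ?_) (haL x hx)
  rw [hL.pairing_dorfman_cyclic hb' hbL (hs l) (hsL l) (hs j) (hsL j) hU hx]
  exact hL.pairing_eq_zero (hL.mem_of_span (hspan x hx) fun i ↦ hzero l j i) (hbL x hx)

end Involutivity

/-! ### Pullbacks of bivector graphs -/

section Pullback

variable {E E' : Type*} [NormedAddCommGroup E] [NormedSpace ℝ E]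
  [NormedAddCommGroup E'] [NormedSpace ℝ E']
  {M : Type*} [TopologicalSpace M] [ChartedSpace E M]
  {P : Type*} [TopologicalSpace P] [ChartedSpace E' P]

/-- The pullback `φ^! Gr(ν)` of the graph of `ν`. -/
def pullbackGraph (φ : M → P) (ν : CotangentToTangent E' P) : Family E M := fun x ↦
  { carrier := {a | ∃ ξ : TangentSpace 𝓘(ℝ, E') (φ x) →L[ℝ] ℝ,
      mfderiv 𝓘(ℝ, E) 𝓘(ℝ, E') φ x a.1 = ν (φ x) ξ ∧
        a.2 = ξ.comp (mfderiv 𝓘(ℝ, E) 𝓘(ℝ, E') φ x)}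
    add_mem' := by
      rintro a b ⟨ξ, h₁, h₂⟩ ⟨η, h₃, h₄⟩
      exact ⟨ξ + η, by rw [Prod.fst_add, map_add, map_add, h₁, h₃],
        by rw [Prod.snd_add, h₂, h₄, ContinuousLinearMap.add_comp]⟩
    zero_mem' := ⟨0, by simp, by simp⟩
    smul_mem' := by
      rintro c a ⟨ξ, h₁, h₂⟩
      exact ⟨c • ξ, by rw [Prod.smul_fst, map_smul, map_smul, h₁],
        by rw [Prod.smul_snd, h₂, ContinuousLinearMap.smul_comp]⟩ }

variable {φ : M → P} {ν : CotangentToTangent E' P}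

lemma mem_pullbackGraph {x : M} {a : GenTangent E x} :
    a ∈ pullbackGraph φ ν x ↔ ∃ ξ : TangentSpace 𝓘(ℝ, E') (φ x) →L[ℝ] ℝ,
      mfderiv 𝓘(ℝ, E) 𝓘(ℝ, E') φ x a.1 = ν (φ x) ξ ∧
        a.2 = ξ.comp (mfderiv 𝓘(ℝ, E) 𝓘(ℝ, E') φ x) :=
  Iff.rfl

lemma mem_bivectorGraph {x : P} {a : GenTangent E' x} :
    a ∈ bivectorGraph ν x ↔ a.1 = ν x a.2 := by
  refine ⟨?_, fun h ↦ ⟨a.2, Prod.ext h.symm rfl⟩⟩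
  rintro ⟨ξ, rfl⟩
  rfl

lemma isForward_pullbackGraph
    (hs : ∀ x, Function.Surjective (mfderiv 𝓘(ℝ, E) 𝓘(ℝ, E') φ x)) :
    IsForward φ (pullbackGraph φ ν : Family E M) (bivectorGraph ν) := by
  intro x b hb
  rw [mem_bivectorGraph] at hb
  obtain ⟨u, hu⟩ := hs x b.1
  exact ⟨(u, b.2.comp (mfderiv 𝓘(ℝ, E) 𝓘(ℝ, E') φ x)), ⟨b.2, hu.trans hb, rfl⟩, hu, rfl⟩

lemma pullbackGraph_id : pullbackGraph id ν = bivectorGraph ν := by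
  funext x
  ext a
  rw [mem_bivectorGraph, mem_pullbackGraph, mfderiv_id]
  constructor
  · rintro ⟨ξ, h₁, h₂⟩
    rw [h₂]
    exact h₁
  · exact fun h ↦ ⟨a.2, h, rfl⟩

/-- A covector annihilating the vertical vectors of a submersion is pulled back from the base. -/
lemma exists_covector_comp [FiniteDimensional ℝ E'] {x : M}
    (hs : Function.Surjective (mfderiv 𝓘(ℝ, E) 𝓘(ℝ, E') φ x))
    {ξ : TangentSpace 𝓘(ℝ, E) x →L[ℝ] ℝ}
    (hξ : ∀ k, mfderiv 𝓘(ℝ, E) 𝓘(ℝ, E') φ x k = 0 → ξ k = 0) :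
    ∃ η : TangentSpace 𝓘(ℝ, E') (φ x) →L[ℝ] ℝ,
      ξ = η.comp (mfderiv 𝓘(ℝ, E) 𝓘(ℝ, E') φ x) := by
  obtain ⟨B, hB⟩ := (mfderiv 𝓘(ℝ, E) 𝓘(ℝ, E') φ x).toLinearMap.exists_rightInverse_of_surjective
    (LinearMap.range_eq_top.2 hs)
  let T : Module.Dual ℝ E' →ₗ[ℝ] (E' →L[ℝ] ℝ) := LinearMap.toContinuousLinearMap.toLinearMap
  refine ⟨T (ξ.toLinearMap ∘ₗ B), ?_⟩
  ext v
  have h1 : mfderiv 𝓘(ℝ, E) 𝓘(ℝ, E') φ x (B (mfderiv 𝓘(ℝ, E) 𝓘(ℝ, E') φ x v)) =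
      mfderiv 𝓘(ℝ, E) 𝓘(ℝ, E') φ x v := LinearMap.congr_fun hB _
  have h2 := hξ (v - B (mfderiv 𝓘(ℝ, E) 𝓘(ℝ, E') φ x v)) (by rw [map_sub, h1, sub_self])
  rw [map_sub, sub_eq_zero] at h2
  exact h2

lemma isLagrangian_pullbackGraph [FiniteDimensional ℝ E']
    (hν : ∀ p (ξ η : TangentSpace 𝓘(ℝ, E') p →L[ℝ] ℝ), η (ν p ξ) = - ξ (ν p η))
    (hs : ∀ x, Function.Surjective (mfderiv 𝓘(ℝ, E) 𝓘(ℝ, E') φ x)) :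
    IsLagrangian (pullbackGraph φ ν : Family E M) := by
  intro x a
  constructor
  · rintro ⟨ξ, h₁, h₂⟩ b ⟨η, h₃, h₄⟩
    rw [pairing, h₂, h₄]
    simp only [ContinuousLinearMap.comp_apply]
    rw [h₁, h₃, hν]
    ring
  · intro h
    -- Orthogonality to vertical vectors makes the covector part basic; orthogonality to lifts of `ν
    -- η + η` then determines the image of the vector part.
    obtain ⟨ξ, hξ⟩ := exists_covector_comp (hs x) (ξ := a.2) fun k hk ↦ by
      have h1 := h (k, 0) ⟨0, by simp [hk], by simp⟩
      exact (zero_add _).symm.trans h1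
    refine ⟨ξ, eq_of_forall_covector fun η ↦ ?_, hξ⟩
    obtain ⟨v, hv⟩ := hs x (ν (φ x) η)
    have h1 := h (v, η.comp (mfderiv 𝓘(ℝ, E) 𝓘(ℝ, E') φ x)) ⟨η, hv, rfl⟩
    rw [pairing, hξ] at h1
    simp only [ContinuousLinearMap.comp_apply] at h1
    rw [hv] at h1
    rw [hν]
    exact eq_neg_of_add_eq_zero_left h1

end Pullback

end DiracGeometry

namespace DiracGeometry

open Bundle Set Filter
open scoped Topology

/-! ### Hamiltonian frames; pullbacks of Poisson structures are Dirac -/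

section PullbackFrame

variable {E E' : Type*} [NormedAddCommGroup E] [NormedSpace ℝ E] [FiniteDimensional ℝ E]
  [NormedAddCommGroup E'] [NormedSpace ℝ E'] [FiniteDimensional ℝ E']
  {M : Type*} [TopologicalSpace M] [ChartedSpace E M] [IsManifold 𝓘(ℝ, E) ∞ M]
  {P : Type*} [TopologicalSpace P] [T2Space P] [ChartedSpace E' P] [IsManifold 𝓘(ℝ, E') ∞ P]
  {φ : M → P} {ν : CotangentToTangent E' P}

/-- The pullback of the graph of a bivector field has frames consisting of lifts of Hamiltonian
vector fields. -/
lemma exists_frame_pullbackGraph (hφ : ContMDiff 𝓘(ℝ, E) 𝓘(ℝ, E') ∞ φ)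
    (hs : ∀ x, Function.Surjective (mfderiv 𝓘(ℝ, E) 𝓘(ℝ, E') φ x)) (hν : IsBivectorField ν)
    (x : M) :
    ∃ (U : Set M) (k : ℕ) (X : Fin k → VField E M) (F : Fin k → P → ℝ), IsOpen U ∧ x ∈ U ∧
      (∀ i, SmoothVFieldOn (X i) U) ∧ (∀ i, ContMDiff 𝓘(ℝ, E') 𝓘(ℝ, ℝ) ∞ (F i)) ∧
      (∀ i, ∀ y ∈ U, mfderiv 𝓘(ℝ, E) 𝓘(ℝ, E') φ y (X i y) =
        ν (φ y) (mvfderiv 𝓘(ℝ, E') (F i) (φ y))) ∧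
      ∀ y ∈ U, LinearIndependent ℝ (fun i ↦ pullbackSection φ (X i) (F i) y) ∧
        Submodule.span ℝ (range fun i ↦ pullbackSection φ (X i) (F i) y) =
          pullbackGraph φ ν y := by
  obtain ⟨U₁, σ, hU₁, hx₁, hUx, hσ, h⟩ := exists_coordSection hφ x (hs x)
  let e := Module.finBasis ℝ E'
  choose f V hf hV hxV hVx hfV using fun j ↦
    exists_mvfderiv_eq_coord (φ x) (LinearMap.toContinuousLinearMap (e.coord j))
  let κ := Module.finBasis ℝ (coordDeriv E E' φ x x).ker
  have hVo : IsOpen (⋂ j, V j) := isOpen_iInter_of_finite hV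
  let U := U₁ ∩ φ ⁻¹' (⋂ j, V j)
  have hU : IsOpen U := hU₁.inter (hVo.preimage hφ.continuous)
  have hUV : ∀ y ∈ U, ∀ j, φ y ∈ V j := fun y hy ↦ mem_iInter.1 hy.2
  have hyx : ∀ y ∈ U, y ∈ (chartAt E x).source := fun y hy ↦ (hUx hy.1).1
  have hyφ : ∀ y ∈ U, φ y ∈ (chartAt E' (φ x)).source := fun y hy ↦ (hUx hy.1).2
  let D : M → E →L[ℝ] E' := coordDeriv E E' φ x
  have hD : ContMDiffOn 𝓘(ℝ, E) 𝓘(ℝ, E →L[ℝ] E') ∞ D U :=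
    (contMDiffOn_coordDeriv hφ x).mono (inter_subset_left.trans hUx)
  -- The `A i` project a basis of the vertical space at `x` to the vertical space at `y` along the
  -- fixed image of `σ`; the `B j` lift the Hamiltonian fields of the coordinate functions.
  let A : Fin (Module.finrank ℝ (coordDeriv E E' φ x x).ker) → VField E M := fun i y ↦
    coordSymm x y ((κ i : E) - σ y (D y (κ i)))
  let η : Fin (Module.finrank ℝ E') → M → E' := fun j y ↦
    coordMap (φ x) (φ y) (ν (φ y) (mvfderiv 𝓘(ℝ, E') (f j) (φ y)))
  let B : Fin (Module.finrank ℝ E') → VField E M := fun j y ↦ coordSymm x y (σ y (η j y))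
  have hη : ∀ j, ContMDiffOn 𝓘(ℝ, E) 𝓘(ℝ, E') ∞ (η j) U := by
    intro j
    have h1 := (smoothVFieldOn_iff (chartAt E' (φ x)).open_source subset_rfl).1
      ((hν.smooth _ (smoothOneFormOn_mvfderiv isOpen_univ (hf j).contMDiffOn)).mono
        (subset_univ _))
    exact h1.comp hφ.contMDiffOn hyφ
  have hA : ∀ i, SmoothVFieldOn (A i) U := fun i ↦
    smoothVFieldOn_coordSymm hU hyx (contMDiffOn_const.sub
      ((hσ.mono inter_subset_left).clm_apply (hD.clm_apply contMDiffOn_const)))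
  have hB : ∀ j, SmoothVFieldOn (B j) U := fun j ↦
    smoothVFieldOn_coordSymm hU hyx ((hσ.mono inter_subset_left).clm_apply (hη j))
  have hAφ : ∀ i, ∀ y ∈ U, mfderiv 𝓘(ℝ, E) 𝓘(ℝ, E') φ y (A i y) = 0 := by
    intro i y hy
    have : coordDeriv E E' φ x y ((κ i : E) - σ y (D y (κ i))) = 0 := by
      rw [map_sub, (h y hy.1).1, sub_self]
    rw [mfderiv_coordSymm (hyφ y hy), this, map_zero]
  have hBφ : ∀ j, ∀ y ∈ U, mfderiv 𝓘(ℝ, E) 𝓘(ℝ, E') φ y (B j y) =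
      ν (φ y) (mvfderiv 𝓘(ℝ, E') (f j) (φ y)) := by
    intro j y hy
    rw [mfderiv_coordSymm (hyφ y hy), (h y hy.1).1]
    exact coordSymm_coordMap (hyφ y hy) _
  let X := Sum.elim A B
  -- Vertical frame elements are treated as lifts belonging to the zero function, so one Jacobiator
  -- formula covers the whole frame.
  let F : Fin (Module.finrank ℝ (coordDeriv E E' φ x x).ker) ⊕ Fin (Module.finrank ℝ E') →
    P → ℝ := Sum.elim (fun _ _ ↦ 0) f
  have hF : ∀ i, ContMDiff 𝓘(ℝ, E') 𝓘(ℝ, ℝ) ∞ (F i) := by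
    rintro (i | j)
    exacts [contMDiff_const, hf j]
  have hF0 : ∀ i p, mvfderiv 𝓘(ℝ, E') (F (Sum.inl i)) p = 0 := fun i p ↦
    mvfderiv_const (0 : ℝ)
  have hXφ : ∀ i, ∀ y ∈ U, mfderiv 𝓘(ℝ, E) 𝓘(ℝ, E') φ y (X i y) =
      ν (φ y) (mvfderiv 𝓘(ℝ, E') (F i) (φ y)) := by
    rintro (i | j) y hy
    · rw [hF0, map_zero]
      exact hAφ i y hy
    · exact hBφ j y hy
  have hmem : ∀ i, ∀ y ∈ U, pullbackSection φ (X i) (F i) y ∈ pullbackGraph φ ν y :=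
    fun i y hy ↦ ⟨_, hXφ i y hy, mvfderiv_comp_submersion hφ (hF i) y⟩
  have hXs : ∀ i, SmoothVFieldOn (X i) U := by
    rintro (i | j)
    exacts [hA i, hB j]
  have hFl : ∀ i, ∀ y ∈ U, ∀ v, mvfderiv 𝓘(ℝ, E) (F (Sum.inl i) ∘ φ) y v = 0 := by
    intro i y hy v
    rw [mvfderiv_comp_submersion hφ (hF _), hF0]
    rfl
  have hFr : ∀ j, ∀ y ∈ U, ∀ v, mvfderiv 𝓘(ℝ, E) (F (Sum.inr j) ∘ φ) y v =
      e.coord j (coordMap (φ x) (φ y) (mfderiv 𝓘(ℝ, E) 𝓘(ℝ, E') φ y v)) := by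
    intro j y hy v
    rw [mvfderiv_comp_submersion hφ (hF _)]
    exact congrArg (fun G : TangentSpace 𝓘(ℝ, E') (φ y) →L[ℝ] ℝ ↦
      G (mfderiv 𝓘(ℝ, E) 𝓘(ℝ, E') φ y v)) (hfV j (φ y) (hUV y hy j))
  have hAsum : ∀ (c : Fin (Module.finrank ℝ (coordDeriv E E' φ x x).ker) → ℝ), ∀ y,
      ∑ i, c i • A i y = coordSymm x y (((∑ i, c i • κ i : (coordDeriv E E' φ x x).ker) : E) -
        σ y (D y ((∑ i, c i • κ i : (coordDeriv E E' φ x x).ker) : E))) := by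
    intro c y
    simp only [A, Submodule.coe_sum, Submodule.coe_smul, map_sum, map_smul,
      ← Finset.sum_sub_distrib, ← smul_sub]
  let ε := finSumFinEquiv (m := Module.finrank ℝ (coordDeriv E E' φ x x).ker)
    (n := Module.finrank ℝ E')
  refine ⟨U, _, X ∘ ε.symm, F ∘ ε.symm, hU, ⟨hx₁, mem_iInter.2 hxV⟩, fun i ↦ hXs _,
    fun i ↦ hF _, fun i ↦ hXφ _, fun y hy ↦ ⟨?_, ?_⟩⟩
  · refine (linearIndependent_equiv (R := ℝ) ε.symm
      (f := fun i ↦ pullbackSection φ (X i) (F i) y)).2 ?_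
    rw [Fintype.linearIndependent_iff]
    intro c hc
    rw [Fintype.sum_sum_type] at hc
    have hr : ∀ j, c (Sum.inr j) = 0 := by
      intro j
      obtain ⟨v, hv⟩ := hs y (coordSymm (φ x) (φ y) (e j))
      have h1 := congrArg (fun a : GenTangent E y ↦ a.2 v) hc
      simp only [pullbackSection, Prod.snd_add, Prod.snd_sum, Prod.smul_snd, _root_.add_apply,
        _root_.sum_apply, _root_.smul_apply, hFl _ y hy, hFr _ y hy, hv,
        coordMap_coordSymm (hyφ y hy)] at h1
      simpa [Finsupp.single_apply] using h1
    have h1 := congrArg (fun a : GenTangent E y ↦ a.1) hc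
    simp only [pullbackSection, Prod.fst_sum, Prod.smul_fst, hr, zero_smul,
      Finset.sum_const_zero, add_zero] at h1
    have h2 := (hAsum (fun i ↦ c (Sum.inl i)) y).symm.trans h1
    set K := ∑ i, c (Sum.inl i) • κ i with hK
    -- `K` lies in the kernel of `D x` and in the image of `σ y`, which is contained in that of `σ
    -- x`; these meet only in zero.
    have h3 : (K : E) = σ y (D y K) :=
      sub_eq_zero.1 (coordSymm_injective (E := E) (hyx y hy) (h2.trans (map_zero _).symm))
    obtain ⟨w, hw⟩ := (h y hy.1).2.2 (D y K)
    have h4 : w = 0 := by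
      rw [← (h x hx₁).1 w, ← hw, ← h3]
      exact K.2
    have h5 : K = 0 := by
      refine Subtype.ext ?_
      rw [h3, hw, h4, map_zero]
      rfl
    rintro (i | j)
    · exact Fintype.linearIndependent_iff.1 κ.linearIndependent _ h5 i
    · exact hr j
  · have hr : (range fun i ↦ pullbackSection φ ((X ∘ ε.symm) i) ((F ∘ ε.symm) i) y) =
        range fun i ↦ pullbackSection φ (X i) (F i) y :=
      ε.symm.surjective.range_comp (fun i ↦ pullbackSection φ (X i) (F i) y)
    rw [hr]
    refine le_antisymm (Submodule.span_le.2 ?_) fun a ha ↦ ?_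
    · rintro _ ⟨i, rfl⟩
      exact hmem i y hy
    · obtain ⟨ξ, h₁, h₂⟩ := ha
      rw [Submodule.mem_span_range_iff_exists_fun]
      let b := fun j ↦ ξ (coordSymm (φ x) (φ y) (e j))
      have hξ : ξ = ∑ j, b j • mvfderiv 𝓘(ℝ, E') (f j) (φ y) := by
        ext v
        have h3 := congrArg (fun z : E' ↦ ξ (coordSymm (φ x) (φ y) z))
          (e.sum_repr (coordMap (φ x) (φ y) v))
        simp only [coordSymm_coordMap (hyφ y hy), map_sum, map_smul] at h3
        rw [← h3]
        simp only [_root_.sum_apply, _root_.smul_apply, hfV _ _ (hUV y hy _),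
          ContinuousLinearMap.comp_apply, b, smul_eq_mul]
        exact Finset.sum_congr rfl fun j _ ↦ mul_comm _ _
      have hνξ : coordMap (φ x) (φ y) (ν (φ y) ξ) = ∑ j, b j • η j y := by
        rw [hξ]
        simp only [map_sum, map_smul, η]
      let w : E := coordMap x y a.1 - ∑ j, b j • σ y (η j y)
      have hw : D y w = 0 := by
        simp only [D, w, map_sub, map_sum, map_smul, coordDeriv_coordMap (hyx y hy), h₁, hνξ,
          (h y hy.1).1, sub_self]
      have hk : w - σ x (D x w) ∈ (coordDeriv E E' φ x x).ker := by
        have : D x (w - σ x (D x w)) = 0 := by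
          simp only [D, map_sub, (h x hx₁).1, sub_self]
        exact this
      -- The correction `σ x (D x w)` is fixed by `σ y ∘ D y`, so projecting to the vertical space
      -- at `y` recovers `w`.
      have hwk : (w - σ x (D x w)) - σ y (D y (w - σ x (D x w))) = w := by
        have : σ y (D y (σ x (D x w))) = σ x (D x w) := (h y hy.1).2.1 _
        have h3 : D y (w - σ x (D x w)) = - D y (σ x (D x w)) := by
          rw [map_sub (D y) w, hw, zero_sub]
        rw [h3, map_neg, this, sub_neg_eq_add, sub_add_cancel]
      refine ⟨Sum.elim (κ.repr ⟨_, hk⟩) b, ?_⟩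
      rw [Fintype.sum_sum_type]
      refine Prod.ext ?_ ?_
      · simp only [pullbackSection, Prod.fst_add, Prod.fst_sum, Prod.smul_fst, Sum.elim_inl,
          Sum.elim_inr, X]
        rw [hAsum, κ.sum_repr]
        simp only [hwk]
        have h3 : ∑ j, b j • B j y = coordSymm x y (∑ j, b j • σ y (η j y)) := by
          simp only [map_sum, map_smul, B]
        rw [h3, ← map_add, sub_add_cancel, coordSymm_coordMap (hyx y hy)]
      · ext v
        simp only [pullbackSection, Prod.snd_add, Prod.snd_sum, Prod.smul_snd, Sum.elim_inl,
          Sum.elim_inr, _root_.add_apply, _root_.sum_apply, _root_.smul_apply, hFl _ y hy,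
          smul_zero, Finset.sum_const_zero, zero_add]
        rw [h₂, hξ]
        simp only [ContinuousLinearMap.comp_apply, _root_.sum_apply, _root_.smul_apply]
        refine Finset.sum_congr rfl fun j _ ↦ ?_
        rw [mvfderiv_comp_submersion hφ (hF _)]
        rfl

/-- The pullback of a Poisson structure under a submersion is a Dirac structure. -/
theorem IsPoissonBivector.isDirac_pullbackGraph (hν : IsPoissonBivector ν)
    (hφ : ContMDiff 𝓘(ℝ, E) 𝓘(ℝ, E') ∞ φ)
    (hs : ∀ x, Function.Surjective (mfderiv 𝓘(ℝ, E) 𝓘(ℝ, E') φ x)) :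
    IsDirac (pullbackGraph φ ν : Family E M) := by
  have hlag : IsLagrangian (pullbackGraph φ ν : Family E M) :=
    isLagrangian_pullbackGraph hν.bivector.skew hs
  refine ⟨hlag, fun x ↦ ?_, hlag.isInvolutive_of_frame fun x ↦ ?_⟩
  · obtain ⟨U, k, X, F, hU, hx, hX, hF, -, h⟩ := exists_frame_pullbackGraph hφ hs hν.bivector x
    exact ⟨U, k, fun i ↦ pullbackSection φ (X i) (F i), hU, hx,
      fun i ↦ (hX i).pullbackSection hφ (hF i), h⟩
  · obtain ⟨U, k, X, F, hU, hx, hX, hF, hXF, h⟩ :=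
      exists_frame_pullbackGraph hφ hs hν.bivector x
    refine ⟨U, k, fun i ↦ pullbackSection φ (X i) (F i), hU, hx,
      fun i ↦ (hX i).pullbackSection hφ (hF i), fun y hy ↦ (h y hy).2, fun i j l ↦ ?_⟩
    rw [pairing_dorfman_pullbackSection hν.bivector hφ (hF i) (hF j) (hF l) (hX i) (hX j) (hX l)
      (hXF i) (hXF j) (hXF l) hU hx]
    exact hν.jacobi _ _ _ (hF i) (hF j) (hF l) _

/-- A graph is its own pullback under the identity, which is a submersion. -/
lemma IsPoissonBivector.isDirac_bivectorGraph (hν : IsPoissonBivector ν) :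
    IsDirac (bivectorGraph ν) := by
  rw [← pullbackGraph_id]
  refine hν.isDirac_pullbackGraph contMDiff_id fun x v ↦ ⟨v, ?_⟩
  rw [mfderiv_id]
  rfl

end PullbackFrame

end DiracGeometry

namespace DiracGeometry

open Bundle Set Filter
open scoped Topology

/-! ### Algebra of the cotangent product -/

section CotangentProduct

variable {E : Type*} [NormedAddCommGroup E] [NormedSpace ℝ E]
  {M : Type*} [TopologicalSpace M] [ChartedSpace E M] {L R : Family E M}

lemma cotangentProduct_comm (L R : Family E M) : cotangentProduct L R = cotangentProduct R L := by
  funext x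
  ext a
  exact ⟨fun ⟨u, v, hu, hv, h⟩ ↦ ⟨v, u, hv, hu, h.trans (add_comm u v)⟩,
    fun ⟨u, v, hu, hv, h⟩ ↦ ⟨v, u, hv, hu, h.trans (add_comm u v)⟩⟩

lemma WeaklyConcur.symm [IsManifold 𝓘(ℝ, E) ∞ M] (h : WeaklyConcur L R) : WeaklyConcur R L := by
  rwa [WeaklyConcur, cotangentProduct_comm]

lemma add_mem_cotangentProduct {x : M} {u v : TangentSpace 𝓘(ℝ, E) x}
    {ξ : TangentSpace 𝓘(ℝ, E) x →L[ℝ] ℝ} (hu : (u, ξ) ∈ L x) (hv : (v, ξ) ∈ R x) :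
    (u + v, ξ) ∈ cotangentProduct L R x :=
  ⟨u, v, hu, hv, rfl⟩

lemma mk_zero_mem_cotangentProduct {x : M} {u : TangentSpace 𝓘(ℝ, E) x} :
    (u, 0) ∈ cotangentProduct L R x ↔ u ∈ kernel L x ⊔ kernel R x := by
  rw [Submodule.mem_sup]
  constructor
  · rintro ⟨v, w, hv, hw, rfl⟩
    exact ⟨v, hv, w, hw, rfl⟩
  · rintro ⟨v, hv, w, hw, rfl⟩
    exact ⟨v, w, hv, hw, rfl⟩

lemma IsLagrangian.pairing_cotangentProduct (hL : IsLagrangian L) (hR : IsLagrangian R) {x : M}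
    {a b : GenTangent E x} (ha : a ∈ cotangentProduct L R x) (hb : b ∈ cotangentProduct L R x) :
    pairing a b = 0 := by
  obtain ⟨u, v, hu, hv, ha⟩ := ha
  obtain ⟨u', v', hu', hv', hb⟩ := hb
  have h1 := hL.pairing_eq_zero hu hu'
  have h2 := hR.pairing_eq_zero hv hv'
  simp only [pairing] at h1 h2 ⊢
  rw [ha, hb, map_add, map_add]
  linarith

lemma cotangentProduct_bivectorGraph (ν ρ : CotangentToTangent E M) :
    cotangentProduct (bivectorGraph ν) (bivectorGraph ρ) = bivectorGraph (ν + ρ) := by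
  funext x
  ext a
  rw [mem_bivectorGraph]
  constructor
  · rintro ⟨u, v, hu, hv, h⟩
    rw [mem_bivectorGraph] at hu hv
    rw [h]
    exact congrArg₂ (· + ·) hu hv
  · exact fun h ↦ ⟨ν x a.2, ρ x a.2, mem_bivectorGraph.2 rfl, mem_bivectorGraph.2 rfl, h⟩

end CotangentProduct

/-! ### Constancy of brackets along the kernel of an involutive family -/

section VerticalDerivative

variable {E E' : Type*} [NormedAddCommGroup E] [NormedSpace ℝ E] [FiniteDimensional ℝ E]
  [NormedAddCommGroup E'] [NormedSpace ℝ E']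
  {M : Type*} [TopologicalSpace M] [T2Space M] [ChartedSpace E M] [IsManifold 𝓘(ℝ, E) ∞ M]
  {P : Type*} [TopologicalSpace P] [ChartedSpace E' P]
  {φ : M → P} {Λ : Family E M}

/-- Brackets of functions of the base are constant along the vertical vectors in `Λ`. -/
lemma IsInvolutive.mvfderiv_bracket_eq_zero (hinv : IsInvolutive Λ)
    (hiso : ∀ x, ∀ a ∈ Λ x, ∀ b ∈ Λ x, pairing a b = 0)
    (hφ : ContMDiff 𝓘(ℝ, E) 𝓘(ℝ, E') ∞ φ) (hlift : HasHamiltonianLifts E' φ Λ)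
    {f g : P → ℝ} (hf : ContMDiff 𝓘(ℝ, E') 𝓘(ℝ, ℝ) ∞ f) (hg : ContMDiff 𝓘(ℝ, E') 𝓘(ℝ, ℝ) ∞ g)
    {U V : Set M} {X K : VField E M} {x : M}
    (hU : IsOpen U) (hxU : x ∈ U) (hX : SmoothVFieldOn X U)
    (hXΛ : ∀ y ∈ U, pullbackSection φ X f y ∈ Λ y)
    (hV : IsOpen V) (hxV : x ∈ V) (hK : SmoothVFieldOn K V) (hKΛ : ∀ y ∈ V, (K y, 0) ∈ Λ y)
    (hKφ : ∀ y ∈ V, mfderiv 𝓘(ℝ, E) 𝓘(ℝ, E') φ y (K y) = 0) :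
    mvfderiv 𝓘(ℝ, E) (fun y ↦ mvfderiv 𝓘(ℝ, E) (g ∘ φ) y (X y)) x (K x) = 0 := by
  obtain ⟨W, Y, hW, hxW, hY, hYΛ⟩ := hlift g hg x
  have hO : IsOpen (U ∩ V ∩ W) := (hU.inter hV).inter hW
  have hxO : x ∈ U ∩ V ∩ W := ⟨⟨hxU, hxV⟩, hxW⟩
  have hX' := hX.mono (inter_subset_left.trans inter_subset_left : U ∩ V ∩ W ⊆ U)
  have hK' := hK.mono (inter_subset_left.trans inter_subset_right : U ∩ V ∩ W ⊆ V)
  have hY' := hY.mono (inter_subset_right : U ∩ V ∩ W ⊆ W)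
  rw [← pairing_dorfman_vertical hφ hf hg hK' hX' hY' (fun y hy ↦ hKφ y hy.1.2) hO hxO]
  refine hiso x _ (hinv.dorfman_mem (hK'.mk_zero) (fun y hy ↦ hKΛ y hy.1.2)
    (hX'.pullbackSection hφ hf) (fun y hy ↦ hXΛ y hy.1.1) hO hxO) _ (hYΛ x hxW)

end VerticalDerivative

/-! ### Reduction of a Dirac structure by its kernel -/

section Reduction

variable {E EP EP' EQ : Type*} [NormedAddCommGroup E] [NormedSpace ℝ E] [FiniteDimensional ℝ E]
  [NormedAddCommGroup EP] [NormedSpace ℝ EP] [FiniteDimensional ℝ EP]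
  [NormedAddCommGroup EP'] [NormedSpace ℝ EP'] [FiniteDimensional ℝ EP']
  [NormedAddCommGroup EQ] [NormedSpace ℝ EQ] [FiniteDimensional ℝ EQ]
  {M P P' Q : Type*} [TopologicalSpace M] [T2Space M] [ChartedSpace E M] [IsManifold 𝓘(ℝ, E) ∞ M]
  [TopologicalSpace P] [T2Space P] [ChartedSpace EP P] [IsManifold 𝓘(ℝ, EP) ∞ P]
  [TopologicalSpace P'] [T2Space P'] [ChartedSpace EP' P'] [IsManifold 𝓘(ℝ, EP') ∞ P']
  [TopologicalSpace Q] [T2Space Q] [ChartedSpace EQ Q] [IsManifold 𝓘(ℝ, EQ) ∞ Q]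
  {L R : Family E M} {p : M → P} {p' : M → P'} {r : M → Q}

omit [FiniteDimensional ℝ EQ] [T2Space M] [T2Space P] [T2Space Q] [IsManifold 𝓘(ℝ, EQ) ∞ Q] in
-- Two maps play different roles: `p` makes the kernel of `L` a vertical bundle, as lifting
-- requires, while the functions come from the base of `r`, which only has to be constant to first
-- order along that kernel.
lemma IsDirac.hasHamiltonianLifts (hL : IsDirac L) (hp : IsConnectedSubmersion E EP p)
    (hk : ∀ x, (mfderiv 𝓘(ℝ, E) 𝓘(ℝ, EP) p x).ker = kernel L x)
    (hr : ContMDiff 𝓘(ℝ, E) 𝓘(ℝ, EQ) ∞ r)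
    (hkr : ∀ x, kernel L x ≤ (mfderiv 𝓘(ℝ, E) 𝓘(ℝ, EQ) r x).ker) :
    HasHamiltonianLifts EQ r L := by
  intro f hf x
  refine hL.exists_lift hp.submersion.contMDiff (surjective_mfderiv hp.submersion x) hk
    (smoothOneFormOn_mvfderiv isOpen_univ (hf.comp hr).contMDiffOn) fun y u hu ↦ ?_
  rw [mvfderiv_comp_submersion hr hf]
  exact (congrArg (mvfderiv 𝓘(ℝ, EQ) f (r y)) (hkr y hu)).trans (map_zero _)

omit [FiniteDimensional ℝ EQ] [T2Space P] [T2Space Q] [IsManifold 𝓘(ℝ, EQ) ∞ Q] in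
/-- Brackets of functions of the base of `r` are constant along the kernel of `L`. -/
lemma IsDirac.mvfderiv_bracket_eq_zero (hL : IsDirac L) (hp : IsConnectedSubmersion E EP p)
    (hk : ∀ x, (mfderiv 𝓘(ℝ, E) 𝓘(ℝ, EP) p x).ker = kernel L x)
    (hr : ContMDiff 𝓘(ℝ, E) 𝓘(ℝ, EQ) ∞ r)
    (hkr : ∀ x, kernel L x ≤ (mfderiv 𝓘(ℝ, E) 𝓘(ℝ, EQ) r x).ker)
    {f g : Q → ℝ} (hf : ContMDiff 𝓘(ℝ, EQ) 𝓘(ℝ, ℝ) ∞ f) (hg : ContMDiff 𝓘(ℝ, EQ) 𝓘(ℝ, ℝ) ∞ g)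
    {U : Set M} {X : VField E M} (hU : IsOpen U) (hX : SmoothVFieldOn X U)
    (hXL : ∀ y ∈ U, pullbackSection r X f y ∈ L y) {x : M} (hx : x ∈ U)
    {k : TangentSpace 𝓘(ℝ, E) x} (hkx : k ∈ kernel L x) :
    mvfderiv 𝓘(ℝ, E) (fun y ↦ mvfderiv 𝓘(ℝ, E) (g ∘ r) y (X y)) x k = 0 := by
  obtain ⟨V, K, hV, hxV, hK, rfl, hKp⟩ := exists_vertical_extension hp.submersion.contMDiff x
    (surjective_mfderiv hp.submersion x) (k := k) (by rw [← hk x] at hkx; exact hkx)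
  have hKL : ∀ y ∈ V, K y ∈ kernel L y := fun y hy ↦ by
    rw [← hk y]
    exact hKp y hy
  exact hL.involutive.mvfderiv_bracket_eq_zero
    (fun x a ha b hb ↦ hL.lagrangian.pairing_eq_zero ha hb) hr
    (hL.hasHamiltonianLifts hp hk hr hkr) hf hg hU hx hX hXL hV hxV hK hKL
    fun y hy ↦ hkr y (hKL y hy)

/-- A Dirac structure whose kernel is the vertical bundle descends to a Poisson structure. -/
theorem IsDirac.exists_isReduction (hL : IsDirac L) (hp : IsConnectedSubmersion E EP p)
    (hk : ∀ x, (mfderiv 𝓘(ℝ, E) 𝓘(ℝ, EP) p x).ker = kernel L x) :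
    ∃ ν : CotangentToTangent EP P, IsReduction p L ν := by
  have hp' := hp.submersion.contMDiff
  refine exists_isReduction_of_lifts hp (fun x a ha b hb ↦ hL.lagrangian.pairing_eq_zero ha hb)
    hL.involutive (fun x u hu ↦ ?_) (hL.hasHamiltonianLifts hp hk hp' fun x ↦ (hk x).ge) ?_
  · have : u ∈ (mfderiv 𝓘(ℝ, E) 𝓘(ℝ, EP) p x).ker := by rw [hk x]; exact hu
    exact this
  · intro f g hf hg U X hU hX hXL x hx k hkx
    refine hL.mvfderiv_bracket_eq_zero hp hk hp' (fun x ↦ (hk x).ge) hf hg hU hX hXL hx ?_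
    rw [← hk x]
    exact hkx

omit [FiniteDimensional ℝ E] [FiniteDimensional ℝ EQ] [T2Space M] [T2Space Q]
  [IsManifold 𝓘(ℝ, EQ) ∞ Q] in
lemma hasHamiltonianLifts_cotangentProduct (hL : HasHamiltonianLifts EQ r L)
    (hR : HasHamiltonianLifts EQ r R) : HasHamiltonianLifts EQ r (cotangentProduct L R) := by
  intro f hf x
  obtain ⟨U, X, hU, hxU, hX, hXL⟩ := hL f hf x
  obtain ⟨V, Y, hV, hxV, hY, hYR⟩ := hR f hf x
  exact ⟨U ∩ V, X + Y, hU.inter hV, ⟨hxU, hxV⟩,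
    ContMDiffOn.add_section (hX.mono inter_subset_left) (hY.mono inter_subset_right),
    fun y hy ↦ add_mem_cotangentProduct (hXL y hy.1) (hYR y hy.2)⟩

/-! ### Reduction of the weakly concurring pair to the bottom vertex -/

section Diamond

variable (hL : IsDirac L) (hR : IsDirac R) (hLR : WeaklyConcur L R)
  (hp : IsConnectedSubmersion E EP p) (hp' : IsConnectedSubmersion E EP' p')
  (hr : IsConnectedSubmersion E EQ r)
  (hk : ∀ x, (mfderiv 𝓘(ℝ, E) 𝓘(ℝ, EP) p x).ker = kernel L x)
  (hk' : ∀ x, (mfderiv 𝓘(ℝ, E) 𝓘(ℝ, EP') p' x).ker = kernel R x)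
  (hkr : ∀ x, (mfderiv 𝓘(ℝ, E) 𝓘(ℝ, EQ) r x).ker = kernel L x ⊔ kernel R x)

include hL hR hLR hp hp' hr hk hk' hkr

omit [T2Space P] [T2Space P'] in
-- Weak concurrence is the involutivity that descent needs, and the kernel of the product is the
-- whole vertical bundle of `r`. Lifts are sums of lifts in `L` and in `R`.
theorem WeaklyConcur.exists_isReduction_cotangentProduct :
    ∃ ν : CotangentToTangent EQ Q, IsReduction r (cotangentProduct L R) ν := by
  have hr' := hr.submersion.contMDiff
  have hiso : ∀ x, ∀ a ∈ cotangentProduct L R x, ∀ b ∈ cotangentProduct L R x,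
      pairing a b = 0 := fun x a ha b hb ↦ hL.lagrangian.pairing_cotangentProduct hR.lagrangian ha hb
  have hlift := hasHamiltonianLifts_cotangentProduct
    (hL.hasHamiltonianLifts hp hk hr' fun x ↦ by rw [hkr]; exact le_sup_left)
    (hR.hasHamiltonianLifts hp' hk' hr' fun x ↦ by rw [hkr]; exact le_sup_right)
  refine exists_isReduction_of_lifts hr hiso hLR (fun x u hu ↦ ?_) hlift ?_
  · rw [mk_zero_mem_cotangentProduct, ← hkr] at hu
    exact hu
  · intro f g hf hg U X hU hX hXL x hx k hkx
    obtain ⟨V, K, hV, hxV, hK, rfl, hKr⟩ := exists_vertical_extension hr' x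
      (surjective_mfderiv hr.submersion x) hkx
    refine IsInvolutive.mvfderiv_bracket_eq_zero hLR hiso hr' hlift hf hg hU hx hX hXL hV hxV hK
      (fun y hy ↦ ?_) hKr
    rw [mk_zero_mem_cotangentProduct, ← hkr]
    exact hKr y hy

omit [T2Space P] [T2Space P'] in
-- Involutivity of `L` alone controls only derivatives along `K(L)`; those along `K(R)` come from
-- comparing `L ⊛ R` with `R`.
theorem WeaklyConcur.exists_isReduction_left :
    ∃ ν : CotangentToTangent EQ Q, IsReduction r L ν := by
  have hr' := hr.submersion.contMDiff
  have hiso : ∀ x, ∀ a ∈ cotangentProduct L R x, ∀ b ∈ cotangentProduct L R x,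
      pairing a b = 0 := fun x a ha b hb ↦ hL.lagrangian.pairing_cotangentProduct hR.lagrangian ha hb
  have hkL : ∀ x, kernel L x ≤ (mfderiv 𝓘(ℝ, E) 𝓘(ℝ, EQ) r x).ker := fun x ↦ by
    rw [hkr]; exact le_sup_left
  have hkR : ∀ x, kernel R x ≤ (mfderiv 𝓘(ℝ, E) 𝓘(ℝ, EQ) r x).ker := fun x ↦ by
    rw [hkr]; exact le_sup_right
  have hliftL := hL.hasHamiltonianLifts hp hk hr' hkL
  have hliftR := hR.hasHamiltonianLifts hp' hk' hr' hkR
  have hlift := hasHamiltonianLifts_cotangentProduct hliftL hliftR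
  refine exists_isReduction_of_lifts hr (fun x a ha b hb ↦ hL.lagrangian.pairing_eq_zero ha hb)
    hL.involutive (fun x u hu ↦ hkL x hu) hliftL ?_
  intro f g hf hg U X hU hX hXL x hx k hkx
  have hkx' : k ∈ kernel L x ⊔ kernel R x := by
    rw [← hkr]
    exact hkx
  obtain ⟨kL, hkL', kR, hkR', rfl⟩ := Submodule.mem_sup.1 hkx'
  rw [map_add, hL.mvfderiv_bracket_eq_zero hp hk hr' hkL hf hg hU hX hXL hx hkL', zero_add]
  obtain ⟨V, Y, hV, hxV, hY, hYR⟩ := hliftR f hf x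
  obtain ⟨W, K, hW, hxW, hK, rfl, hKp⟩ := exists_vertical_extension hp'.submersion.contMDiff x
    (surjective_mfderiv hp'.submersion x) (k := kR) (by rw [← hk' x] at hkR'; exact hkR')
  have hKR : ∀ y ∈ W, K y ∈ kernel R y := fun y hy ↦ by
    rw [← hk' y]
    exact hKp y hy
  have hX' := hX.mono (inter_subset_left : U ∩ V ⊆ U)
  have hY' := hY.mono (inter_subset_right : U ∩ V ⊆ V)
  have h1 := hR.mvfderiv_bracket_eq_zero hp' hk' hr' hkR hf hg hV hY hYR hxV hkR'
  -- `X + Y` lifts `f` in `L ⊛ R`, and `K` with zero covector also lies in `L ⊛ R`. Subtracting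
  -- `h1`, the statement for `Y` in `R`, leaves the statement for `X`.
  have h2 := IsInvolutive.mvfderiv_bracket_eq_zero hLR hiso hr' hlift hf hg (hU.inter hV) ⟨hx, hxV⟩
    (X := X + Y) (ContMDiffOn.add_section hX' hY')
    (fun y hy ↦ add_mem_cotangentProduct (hXL y hy.1) (hYR y hy.2)) hW hxW hK
    (fun y hy ↦ mk_zero_mem_cotangentProduct.2 (Submodule.mem_sup_right (hKR y hy)))
    fun y hy ↦ hkR y (hKR y hy)
  have hdiff : ∀ {Z : VField E M} {O : Set M}, IsOpen O → x ∈ O → SmoothVFieldOn Z O →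
      MDifferentiableAt 𝓘(ℝ, E) 𝓘(ℝ, ℝ) (fun y ↦ mvfderiv 𝓘(ℝ, E) (g ∘ r) y (Z y)) x :=
    fun hO hxO hZ ↦ ((((smoothOneFormOn_mvfderiv isOpen_univ (hg.comp hr').contMDiffOn).mono
      (subset_univ _)).contMDiffOn_apply hZ).contMDiffAt (hO.mem_nhds hxO)).mdifferentiableAt
      (by simp)
  have h3 : (fun y ↦ mvfderiv 𝓘(ℝ, E) (g ∘ r) y ((X + Y) y)) =
      (fun y ↦ mvfderiv 𝓘(ℝ, E) (g ∘ r) y (X y)) +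
        fun y ↦ mvfderiv 𝓘(ℝ, E) (g ∘ r) y (Y y) := by
    funext y
    exact map_add _ _ _
  rw [h3, mvfderiv_add (hdiff hU hx hX) (hdiff hV hxV hY), _root_.add_apply, h1, add_zero] at h2
  exact h2

end Diamond

end Reduction

end DiracGeometry

namespace DiracGeometry

open Bundle Set Filter
open scoped Topology

/-! ### The intermediate vertices -/

section Quotients

variable {E EP EQ : Type*} [NormedAddCommGroup E] [NormedSpace ℝ E] [FiniteDimensional ℝ E]
  [NormedAddCommGroup EP] [NormedSpace ℝ EP] [FiniteDimensional ℝ EP]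
  [NormedAddCommGroup EQ] [NormedSpace ℝ EQ] [FiniteDimensional ℝ EQ]
  {M P Q : Type*} [TopologicalSpace M] [T2Space M] [ChartedSpace E M] [IsManifold 𝓘(ℝ, E) ∞ M]
  [TopologicalSpace P] [T2Space P] [ChartedSpace EP P] [IsManifold 𝓘(ℝ, EP) ∞ P]
  [TopologicalSpace Q] [T2Space Q] [ChartedSpace EQ Q] [IsManifold 𝓘(ℝ, EQ) ∞ Q]
  {L R : Family E M} {p : M → P} {q : P → Q} {r : M → Q}

omit [FiniteDimensional ℝ E] [T2Space M] [IsManifold 𝓘(ℝ, E) ∞ M] in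
lemma IsReduction.pushesForwardTo {ν : CotangentToTangent EP P} (h : IsReduction p L ν) :
    PushesForwardTo p L (bivectorGraph ν) := by
  refine ⟨h.poisson.isDirac_bivectorGraph, fun x b hb ↦ ?_⟩
  obtain ⟨u, hu⟩ := h.exists_mem x b.2
  exact ⟨_, hu, (h.mfderiv_eq x u b.2 hu).trans (mem_bivectorGraph.1 hb).symm, rfl⟩

omit [FiniteDimensional ℝ E] [FiniteDimensional ℝ EP] [FiniteDimensional ℝ EQ] [T2Space M]
  [IsManifold 𝓘(ℝ, E) ∞ M] [T2Space P] [IsManifold 𝓘(ℝ, EP) ∞ P] [T2Space Q]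
  [IsManifold 𝓘(ℝ, EQ) ∞ Q] in
-- The kernel of `r` is the preimage under the derivative of `p` of the image of `K(L) + K(R)`.
-- Taking the preimage adds only the kernel of `p`, which is `K(L)` and already contained in the
-- sum.
lemma ker_mfderiv_comp (hp : ContMDiff 𝓘(ℝ, E) 𝓘(ℝ, EP) ∞ p)
    (hq : ContMDiff 𝓘(ℝ, EP) 𝓘(ℝ, EQ) ∞ q) (hqp : q ∘ p = r)
    (hk : ∀ x, (mfderiv 𝓘(ℝ, E) 𝓘(ℝ, EP) p x).ker = kernel L x)
    (hkq : ∀ x, (mfderiv 𝓘(ℝ, EP) 𝓘(ℝ, EQ) q (p x)).ker =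
      (kernel L x ⊔ kernel R x).map (mfderiv 𝓘(ℝ, E) 𝓘(ℝ, EP) p x).toLinearMap) (x : M) :
    (mfderiv 𝓘(ℝ, E) 𝓘(ℝ, EQ) r x).ker = kernel L x ⊔ kernel R x := by
  subst hqp
  have hc : ∀ u, mfderiv 𝓘(ℝ, E) 𝓘(ℝ, EQ) (q ∘ p) x u =
      mfderiv 𝓘(ℝ, EP) 𝓘(ℝ, EQ) q (p x) (mfderiv 𝓘(ℝ, E) 𝓘(ℝ, EP) p x u) := fun u ↦
    congrArg (fun f : TangentSpace 𝓘(ℝ, E) x →L[ℝ] TangentSpace 𝓘(ℝ, EQ) ((q ∘ p) x) ↦ f u)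
      (mfderiv_comp x ((hq _).mdifferentiableAt (by simp)) ((hp _).mdifferentiableAt (by simp)))
  ext u
  have h1 : u ∈ (mfderiv 𝓘(ℝ, E) 𝓘(ℝ, EQ) (q ∘ p) x).ker ↔
      mfderiv 𝓘(ℝ, E) 𝓘(ℝ, EP) p x u ∈ (mfderiv 𝓘(ℝ, EP) 𝓘(ℝ, EQ) q (p x)).ker :=
    Eq.congr_left (hc u)
  rw [h1, hkq x]
  constructor
  · rintro ⟨k, hkm, hku⟩
    have h2 : u - k ∈ kernel L x := by
      rw [← hk x]
      exact (map_sub (mfderiv 𝓘(ℝ, E) 𝓘(ℝ, EP) p x) u k).trans (sub_eq_zero.2 hku.symm)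
    have h3 := Submodule.add_mem _ (Submodule.mem_sup_left (T := kernel R x) h2) hkm
    rwa [sub_add_cancel] at h3
  · exact fun h ↦ ⟨u, h, rfl⟩

/-- The intermediate quotient by the kernel of `L` carries the two reduced Dirac structures. -/
theorem exists_pushesForwardTo_of_isReduction (hL : IsDirac L)
    (hp : IsConnectedSubmersion E EP p) (hq : IsConnectedSubmersion EP EQ q) (hqp : q ∘ p = r)
    (hk : ∀ x, (mfderiv 𝓘(ℝ, E) 𝓘(ℝ, EP) p x).ker = kernel L x)
    (hkq : ∀ x, (mfderiv 𝓘(ℝ, EP) 𝓘(ℝ, EQ) q (p x)).ker =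
      (kernel L x ⊔ kernel R x).map (mfderiv 𝓘(ℝ, E) 𝓘(ℝ, EP) p x).toLinearMap)
    {νL νR : CotangentToTangent EQ Q} (hνL : IsReduction r L νL) (hνR : IsReduction r R νR)
    (hν : IsPoissonBivector (νL + νR)) :
    ∃ L₁ R₁ : Family EP P, IsPoisson L₁ ∧ PushesForwardTo p L L₁ ∧ PushesForwardTo p R R₁ ∧
      WeaklyConcur L₁ R₁ ∧ PushesForwardTo q L₁ (bivectorGraph νL) ∧
      PushesForwardTo q R₁ (bivectorGraph νR) := by
  have hkr := ker_mfderiv_comp hp.submersion.contMDiff hq.submersion.contMDiff hqp hk hkq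
  subst hqp
  have hp' := hp.submersion.contMDiff
  have hq' := hq.submersion.contMDiff
  have hps := fun x ↦ surjective_mfderiv hp.submersion x
  have hqs := fun x ↦ surjective_mfderiv hq.submersion x
  have hc : ∀ x, mfderiv 𝓘(ℝ, E) 𝓘(ℝ, EQ) (q ∘ p) x =
      (mfderiv 𝓘(ℝ, EP) 𝓘(ℝ, EQ) q (p x)).comp (mfderiv 𝓘(ℝ, E) 𝓘(ℝ, EP) p x) := fun x ↦
    mfderiv_comp x ((hq' _).mdifferentiableAt (by simp)) ((hp' _).mdifferentiableAt (by simp))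
  obtain ⟨ρ, hρ⟩ := hL.exists_isReduction hp hk
  -- One vector `u`, lifting `r^* ξ` in `L`, computes both sides: `ρ` through `p` and `νL` through
  -- `r = q ∘ p`.
  have hρν : ∀ y (ξ : TangentSpace 𝓘(ℝ, EQ) (q y) →L[ℝ] ℝ),
      mfderiv 𝓘(ℝ, EP) 𝓘(ℝ, EQ) q y (ρ y (ξ.comp (mfderiv 𝓘(ℝ, EP) 𝓘(ℝ, EQ) q y))) =
        νL (q y) ξ := by
    intro y ξ
    obtain ⟨x, rfl⟩ := hp.surjective y
    obtain ⟨u, hu⟩ := hνL.exists_mem x ξ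
    have h1 := hνL.mfderiv_eq x u ξ hu
    rw [hc x] at hu h1
    rw [← hρ.mfderiv_eq x u _ hu]
    exact h1
  refine ⟨bivectorGraph ρ, pullbackGraph q νR, ⟨ρ, hρ.poisson, rfl⟩, hρ.pushesForwardTo,
    ⟨hνR.poisson.isDirac_pullbackGraph hq' hqs, ?_⟩, ?_,
    ⟨hνL.poisson.isDirac_bivectorGraph, ?_⟩,
    hνR.poisson.isDirac_bivectorGraph, isForward_pullbackGraph hqs⟩
  -- A lift `u` of `r^* ξ` in `R` and a lift `v` of `w` have the same image under `r`, so `v - u =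
  -- kL + kR`. Replacing `u` by `u + kR` stays in `R`, and its difference `kL` from `v` is killed by
  -- `p`.
  · rintro x ⟨w, ζ⟩ ⟨ξ, hw, rfl⟩
    obtain ⟨u, hu⟩ := hνR.exists_mem x ξ
    obtain ⟨v, rfl⟩ := hps x w
    have h1 := hνR.mfderiv_eq x u ξ hu
    have h2 : v - u ∈ kernel L x ⊔ kernel R x := by
      rw [← hkr x]
      have h3 : mfderiv 𝓘(ℝ, E) 𝓘(ℝ, EQ) (q ∘ p) x v = νR (q (p x)) ξ := by
        rw [hc x]
        exact hw
      exact (map_sub (mfderiv 𝓘(ℝ, E) 𝓘(ℝ, EQ) (q ∘ p) x) v u).trans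
        (sub_eq_zero.2 (h3.trans h1.symm))
    obtain ⟨kL, hkL, kR, hkR, hsum⟩ := Submodule.mem_sup.1 h2
    have hkL' : mfderiv 𝓘(ℝ, E) 𝓘(ℝ, EP) p x kL = 0 := by
      rw [← hk x] at hkL
      exact hkL
    have hmem := (R x).add_mem hu hkR
    refine ⟨_, hmem, ?_, ?_⟩
    · have h3 : u + kR = v - kL := by
        rw [eq_sub_iff_add_eq, add_assoc, add_comm kR, hsum, add_sub_cancel]
      have h4 : mfderiv 𝓘(ℝ, E) 𝓘(ℝ, EP) p x (u + kR) = mfderiv 𝓘(ℝ, E) 𝓘(ℝ, EP) p x v := by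
        rw [h3, map_sub, hkL', sub_zero]
      exact h4
    · have h3 : (ξ.comp (mfderiv 𝓘(ℝ, E) 𝓘(ℝ, EQ) (q ∘ p) x)) + 0 =
          (ξ.comp (mfderiv 𝓘(ℝ, EP) 𝓘(ℝ, EQ) q (p x))).comp (mfderiv 𝓘(ℝ, E) 𝓘(ℝ, EP) p x) := by
        rw [add_zero, hc x]
        rfl
      exact h3
  · have h1 : cotangentProduct (bivectorGraph ρ) (pullbackGraph q νR) =
        pullbackGraph q (νL + νR) := by
      funext y
      ext a
      constructor
      · rintro ⟨u, v, hu, ⟨ξ, hv, hξ⟩, ha⟩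
        refine ⟨ξ, ?_, hξ⟩
        have h2 : u = ρ y a.2 := mem_bivectorGraph.1 hu
        have h3 : a.2 = ξ.comp (mfderiv 𝓘(ℝ, EP) 𝓘(ℝ, EQ) q y) := hξ
        rw [ha, map_add, h2, h3, hρν, hv]
        rfl
      · rintro ⟨ξ, ha, hξ⟩
        refine ⟨ρ y a.2, a.1 - ρ y a.2, mem_bivectorGraph.2 rfl, ⟨ξ, ?_, hξ⟩,
          (add_sub_cancel _ _).symm⟩
        rw [map_sub, ha, hξ, hρν]
        exact add_sub_cancel_left (νL (q y) ξ) (νR (q y) ξ)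
    rw [WeaklyConcur, h1]
    exact (hν.isDirac_pullbackGraph hq' hqs).involutive
  · intro y b hb
    refine ⟨(ρ y (b.2.comp (mfderiv 𝓘(ℝ, EP) 𝓘(ℝ, EQ) q y)),
      b.2.comp (mfderiv 𝓘(ℝ, EP) 𝓘(ℝ, EQ) q y)), mem_bivectorGraph.2 rfl, ?_, rfl⟩
    exact (hρν y b.2).trans (mem_bivectorGraph.1 hb).symm

omit [FiniteDimensional ℝ E] [FiniteDimensional ℝ EQ] [T2Space M] [IsManifold 𝓘(ℝ, E) ∞ M]
  [T2Space Q] in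
-- The sum of a lift of a covector in `L` and one in `R` is a lift in `L ⊛ R`. This is how
-- commutation of the two Poisson structures is obtained.
lemma IsReduction.eq_add {νL νR ν : CotangentToTangent EQ Q} (hr : Function.Surjective r)
    (hL : IsReduction r L νL) (hR : IsReduction r R νR)
    (h : IsReduction r (cotangentProduct L R) ν) : ν = νL + νR := by
  funext y
  obtain ⟨x, rfl⟩ := hr y
  ext1 η
  obtain ⟨u, hu⟩ := hL.exists_mem x η
  obtain ⟨v, hv⟩ := hR.exists_mem x η
  rw [← h.mfderiv_eq x _ η (add_mem_cotangentProduct hu hv), map_add, hL.mfderiv_eq x u η hu,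
    hR.mfderiv_eq x v η hv]
  rfl

end Quotients

end DiracGeometry

end

/-! ### The diamond of quotients -/

open DiracGeometry in
theorem mainTheorem5
    {E EL ER ELR : Type*}
    [NormedAddCommGroup E] [NormedSpace ℝ E] [FiniteDimensional ℝ E]
    [NormedAddCommGroup EL] [NormedSpace ℝ EL] [FiniteDimensional ℝ EL]
    [NormedAddCommGroup ER] [NormedSpace ℝ ER] [FiniteDimensional ℝ ER]
    [NormedAddCommGroup ELR] [NormedSpace ℝ ELR] [FiniteDimensional ℝ ELR]
    {M ML MR MLR : Type*}
    [TopologicalSpace M] [T2Space M] [SecondCountableTopology M]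
    [ChartedSpace E M] [IsManifold 𝓘(ℝ, E) ∞ M]
    [TopologicalSpace ML] [T2Space ML] [SecondCountableTopology ML]
    [ChartedSpace EL ML] [IsManifold 𝓘(ℝ, EL) ∞ ML]
    [TopologicalSpace MR] [T2Space MR] [SecondCountableTopology MR]
    [ChartedSpace ER MR] [IsManifold 𝓘(ℝ, ER) ∞ MR]
    [TopologicalSpace MLR] [T2Space MLR] [SecondCountableTopology MLR]
    [ChartedSpace ELR MLR] [IsManifold 𝓘(ℝ, ELR) ∞ MLR]
    (L R : Family E M) (hL : IsDirac L) (hR : IsDirac R) (hLR : WeaklyConcur L R)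
    (pL : M → ML) (pR : M → MR) (qR : ML → MLR) (qL : MR → MLR) (r : M → MLR)
    (hpL : IsConnectedSubmersion E EL pL) (hpR : IsConnectedSubmersion E ER pR)
    (hqR : IsConnectedSubmersion EL ELR qR) (hqL : IsConnectedSubmersion ER ELR qL)
    (hr : IsConnectedSubmersion E ELR r)
    (hleft : qR ∘ pL = r) (hright : qL ∘ pR = r)
    -- the vertical bundles of `pL` and `pR` are `K(L)` and `K(R)`
    (kpL : ∀ x, (mfderiv 𝓘(ℝ, E) 𝓘(ℝ, EL) pL x).ker = kernel L x)
    (kpR : ∀ x, (mfderiv 𝓘(ℝ, E) 𝓘(ℝ, ER) pR x).ker = kernel R x)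
    -- the vertical bundles of `qR` and `qL` are `K / K(L)` and `K / K(R)`, for `K = K(L) + K(R)`,
    -- where `TM / K(L)` and `TM / K(R)` are identified with the pullbacks of `TML` and `TMR`
    (kqR : ∀ x, (mfderiv 𝓘(ℝ, EL) 𝓘(ℝ, ELR) qR (pL x)).ker =
      (kernel L x ⊔ kernel R x).map (mfderiv 𝓘(ℝ, E) 𝓘(ℝ, EL) pL x).toLinearMap)
    (kqL : ∀ x, (mfderiv 𝓘(ℝ, ER) 𝓘(ℝ, ELR) qL (pR x)).ker =
      (kernel L x ⊔ kernel R x).map (mfderiv 𝓘(ℝ, E) 𝓘(ℝ, ER) pR x).toLinearMap) :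
    ∃ (L₁ R₁ : Family EL ML) (L₂ R₂ : Family ER MR) (L₃ R₃ : Family ELR MLR),
      -- `L` and `R` push forward to weakly concurring Dirac structures at every vertex
      (PushesForwardTo pL L L₁ ∧ PushesForwardTo pL R R₁ ∧ WeaklyConcur L₁ R₁) ∧
      (PushesForwardTo pR L L₂ ∧ PushesForwardTo pR R R₂ ∧ WeaklyConcur L₂ R₂) ∧
      (PushesForwardTo r L L₃ ∧ PushesForwardTo r R R₃ ∧ WeaklyConcur L₃ R₃) ∧
      -- compatibly with the lower edges of the diamond
      (PushesForwardTo qR L₁ L₃ ∧ PushesForwardTo qR R₁ R₃) ∧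
      (PushesForwardTo qL L₂ L₃ ∧ PushesForwardTo qL R₂ R₃) ∧
      -- the Poisson vertices
      IsPoisson L₁ ∧ IsPoisson R₂ ∧
      ∃ νL νR : CotangentToTangent ELR MLR,
        L₃ = bivectorGraph νL ∧ R₃ = bivectorGraph νR ∧ CommutingPoisson νL νR := by
  have hkr := ker_mfderiv_comp hpL.submersion.contMDiff hqR.submersion.contMDiff hleft kpL kqR
  simp only [sup_comm (kernel L _)] at kqL
  have hkr' := fun x ↦ (hkr x).trans (sup_comm _ _)
  obtain ⟨νL, hνL⟩ := hLR.exists_isReduction_left hL hR hpL hpR hr kpL kpR hkr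
  obtain ⟨νR, hνR⟩ := hLR.symm.exists_isReduction_left hR hL hpR hpL hr kpR kpL hkr'
  obtain ⟨ν, hν⟩ := hLR.exists_isReduction_cotangentProduct hL hR hpL hpR hr kpL kpR hkr
  have hsum : IsPoissonBivector (νL + νR) := by
    rw [← hνL.eq_add hr.surjective hνR hν]
    exact hν.poisson
  obtain ⟨L₁, R₁, hL₁, hLL₁, hRR₁, hw₁, hL₁₃, hR₁₃⟩ :=
    exists_pushesForwardTo_of_isReduction hL hpL hqR hleft kpL kqR hνL hνR hsum
  -- The right vertex is the left one with `L` and `R` exchanged; hence the swapped order of the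
  -- sums and of the concurrence.
  obtain ⟨R₂, L₂, hR₂, hRR₂, hLL₂, hw₂, hR₂₃, hL₂₃⟩ :=
    exists_pushesForwardTo_of_isReduction hR hpR hqL hright kpR kqL hνR hνL
      (by rwa [add_comm])
  refine ⟨L₁, R₁, L₂, R₂, bivectorGraph νL, bivectorGraph νR, ⟨hLL₁, hRR₁, hw₁⟩,
    ⟨hLL₂, hRR₂, hw₂.symm⟩, ⟨hνL.pushesForwardTo, hνR.pushesForwardTo, ?_⟩, ⟨hL₁₃, hR₁₃⟩,
    ⟨hL₂₃, hR₂₃⟩, hL₁, hR₂, νL, νR, rfl, rfl, hνL.poisson, hνR.poisson, hsum⟩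
  rw [WeaklyConcur, cotangentProduct_bivectorGraph]
  exact hsum.isDirac_bivectorGraph.involutive
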